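/- Let $k$ be a field, let $N=\mathbb{Z}^d$ with dual lattice $M$, let $\Delta$ be a fan in $N$ (a finite set of strongly convex rational polyhedral cones in $N_{\mathbb R}$, closed under taking faces, any two of which meet in a common face), and let $X=X_\Delta$ be the associated normal toric variety over $k$, glued from the $U_\sigma=\operatorname{Spec}k[S_\sigma]$ with $S_\sigma=\sigma^\vee\cap M$. Let $G=G(X)$ be the group of torus-invariant Weil divisors of $X$ modulo the torus-invariant Cartier divisors (those that on each $U_\sigma$ are the divisor of a character). For the torus-invariant prime divisor $D$ of a ray of $\Delta$ with primitive generator $v$, let $m'=m'(D)$ be the least common multiple, over all $\sigma\in\Delta$ with $v\in\sigma$ and all edges $R$ of $\sigma^\vee$ (faces of dimension one more than the largest linear subspace of $\sigma^\vee$) that are not contained in the facet $\sigma^\vee\cap v^\perp$, of the height of the first lattice point on $R$, that is, of the smallest positive value of $\langle u,v\rangle$ for $u\in R\cap M$. For $n\ge 0$ let $\mathcal{I}_{nD}\subseteq\mathcal{O}_X$ be the ideal sheaf of functions vanishing to order at least $n$ along $D$ (the $n$-th symbolic power of the ideal sheaf of $D$). The stellar subdivision $\Delta^*(v)$ consists of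 the cones $\tau\in\Delta$ with $v\notin\tau$ and of the cones $\mathbb{R}_{\ge0}v+\tau$ for those $\tau\in\Delta$ with $v\notin\tau$ that are contained in some $\sigma\in\Delta$ with $v\in\sigma$. 1. Let $D$ be a torus-invariant prime divisor of $X$ whose class in $G$ has infinite order, belonging to the ray generated by $v$. Then $\Delta'=\Delta^*(v)$ is a fan, and the toric morphism $\pi:\widetilde X=X_{\Delta'}\to X$ is the blow-up of $m'D$ among normal varieties: it is the normalized blow-up of $\mathcal{I}_{m'D}$ (the universal one among the dominant morphisms from normal integral schemes to $X$ under which $\mathcal{I}_{m'D}$ becomes invertible). For all sufficiently large $l$ it is moreover the blow-up of $\mathcal{I}_{lm'D}$ in the usual sense (universal among all morphisms of schemes $T\to X$ under which $\mathcal{I}_{lm'D}$ becomes invertible), so it is a projective toric blow-up. Furthermore $\operatorname{rank}G(\widetilde X)<\operatorname{rank}G(X)$, the fans $\Delta'$ and $\Delta$ have the same rays, and $\pi$ maps the torus-invariant prime divisors of $\widetilde X$ bijectively onto those of $X$, so no new torus-invariant Weil divisors appear. 2. Every torus-invariant prime divisor $D$ of $X$ belongs to a ray of $\Delta$. If $v$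 is its primitive generator, then $D$ has infinite order in $G$ if and only if $\Delta^*(v)\ne\Delta$, and in this case $v$ lies in a non-simplicial cone of $\Delta$. 3. Call the passage from a fan to the fan produced in 1 by some torus-invariant prime divisor of infinite order a step. Every sequence of successive steps starting with $\Delta$ has length at most $\operatorname{rank}G(X)$ and ends with a fan that has the same rays as $\Delta$; no further step is possible from this fan if and only if it is simplicial. In particular, there is a finite sequence of steps, each a projective toric blow-up as in 1 and a stellar subdivision along a ray of $\Delta$, that leads from $\Delta$ to a simplicial fan $\Delta''$ with the same rays, and the toric morphism $X_{\Delta''}\to X$ maps the torus-invariant prime divisors bijectively onto those of $X$. -/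

import Mathlib

open AlgebraicGeometry CategoryTheory CategoryTheory.Limits
open scoped AddMonoidAlgebra

universe u

namespace Toric

/-! ### Lattices, cones and fans

The lattice `N` is `ℤ^d`, its dual lattice `M` is `ℤ^d`, the pairing is the dot product, and
`N_ℝ = M_ℝ = ℝ^d`. -/

/-- A lattice point regarded as a vector of the ambient real vector space. -/
def latticePt {d : ℕ} (w : Fin d → ℤ) : Fin d → ℝ := fun i => (w i : ℝ)

@[simp] lemma latticePt_zero {d : ℕ} : latticePt (0 : Fin d → ℤ) = 0 := by
  ext i; simp [latticePt]

@[simp] lemma latticePt_add {d : ℕ} (u w : Fin d → ℤ) :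
    latticePt (u + w) = latticePt u + latticePt w := by
  ext i; simp [latticePt]

@[simp] lemma latticePt_neg {d : ℕ} (u : Fin d → ℤ) : latticePt (-u) = -latticePt u := by
  ext i; simp [latticePt]

/-- Convex cones in `ℝ^d`. -/
abbrev Cone (d : ℕ) : Type := PointedCone ℝ (Fin d → ℝ)

/-- The cone is generated by finitely many lattice vectors. -/
def IsRational {d : ℕ} (σ : Cone d) : Prop :=
  ∃ s : Finset (Fin d → ℤ), PointedCone.hull ℝ (latticePt '' (s : Set (Fin d → ℤ))) = σ

/-- `τ` is a face of `σ`: it is cut out of `σ` by a linear functional `u` that is nonnegative on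
`σ`. For the rational cones considered here, `u` may be taken in the lattice. -/
def IsFace {d : ℕ} (τ σ : Cone d) : Prop :=
  ∃ u : Fin d → ℤ, (∀ x ∈ σ, 0 ≤ latticePt u ⬝ᵥ x) ∧
    ∀ x, x ∈ τ ↔ x ∈ σ ∧ latticePt u ⬝ᵥ x = 0

/-- The dual cone `σ^∨` in `M_ℝ`. -/
noncomputable def dualCone {d : ℕ} (σ : Cone d) : Cone d :=
  PointedCone.dual (dotProductBilin ℝ ℝ) (σ : Set (Fin d → ℝ))

/-- A fan in `N = ℤ^d`: a finite set of strongly convex rational polyhedral cones, closed under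
taking faces, such that any two of its cones meet in a common face. -/
structure Fan (d : ℕ) where
  cones : Set (Cone d)
  finite : cones.Finite
  rational : ∀ σ ∈ cones, IsRational σ
  stronglyConvex : ∀ σ ∈ cones, σ.lineal = ⊥
  face_mem : ∀ σ ∈ cones, ∀ τ : Cone d, IsFace τ σ → τ ∈ cones
  inter_isFace : ∀ σ ∈ cones, ∀ τ ∈ cones, IsFace (σ ⊓ τ) σ ∧ IsFace (σ ⊓ τ) τ

/-- Every cone of the fan is generated by linearly independent vectors. -/
def Fan.IsSimplicial {d : ℕ} (Δ : Fan d) : Prop :=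
  ∀ σ ∈ Δ.cones, PointedCone.IsSimplicial σ

/-- The half-line `ℝ_{≥0} v`. -/
noncomputable def rayCone {d : ℕ} (v : Fin d → ℤ) : Cone d :=
  PointedCone.hull ℝ {latticePt v}

/-- A primitive lattice vector (in particular, a nonzero one). -/
def IsPrimitive {d : ℕ} (v : Fin d → ℤ) : Prop :=
  ∀ (n : ℤ) (w : Fin d → ℤ), v = n • w → IsUnit n

/-- The rays (one-dimensional cones) of a fan, each given by its primitive generator. -/
def Fan.rays {d : ℕ} (Δ : Fan d) : Set (Fin d → ℤ) :=
  {v | IsPrimitive v ∧ rayCone v ∈ Δ.cones}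

/-- The cones of the stellar subdivision of `Δ` along the half-line through `v`. -/
def Fan.stellar {d : ℕ} (Δ : Fan d) (v : Fin d → ℤ) : Set (Cone d) :=
  {τ | τ ∈ Δ.cones ∧ latticePt v ∉ τ} ∪
  {γ | ∃ τ ∈ Δ.cones, latticePt v ∉ τ ∧ (∃ σ ∈ Δ.cones, latticePt v ∈ σ ∧ τ ≤ σ) ∧
    γ = rayCone v ⊔ τ}

/-! ### Affine toric varieties -/

/-- The monoid `S_σ = σ^∨ ∩ M`. -/
def charMonoid {d : ℕ} (σ : Cone d) : AddSubmonoid (Fin d → ℤ) where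
  carrier := {u | ∀ x ∈ σ, 0 ≤ latticePt u ⬝ᵥ x}
  zero_mem' := fun x _ => by simp
  add_mem' := fun {u w} hu hw x hx => by
    rw [latticePt_add, add_dotProduct]; exact add_nonneg (hu x hx) (hw x hx)

lemma mem_charMonoid {d : ℕ} {σ : Cone d} {u : Fin d → ℤ} :
    u ∈ charMonoid σ ↔ ∀ x ∈ σ, 0 ≤ latticePt u ⬝ᵥ x := Iff.rfl

lemma charMonoid_anti {d : ℕ} {τ σ : Cone d} (h : τ ≤ σ) : charMonoid σ ≤ charMonoid τ :=
  fun _ hu x hx => hu x (h hx)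

/-- The monoid algebra `k[S_σ]`. -/
abbrev charAlgebra (k : Type u) [Field k] {d : ℕ} (σ : Cone d) : Type u :=
  AddMonoidAlgebra k (charMonoid σ)

/-- The monomial `t^s` of `k[S_σ]`. -/
noncomputable def monomial (k : Type u) [Field k] {d : ℕ} {σ : Cone d} (s : charMonoid σ) :
    charAlgebra k σ := AddMonoidAlgebra.single s 1

/-- The inclusion `k[S_σ] → k[S_τ]` for `τ ⊆ σ`. -/
noncomputable def restrictChar (k : Type u) [Field k] {d : ℕ} {τ σ : Cone d} (h : τ ≤ σ) :
    charAlgebra k σ →+* charAlgebra k τ :=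
  AddMonoidAlgebra.mapDomainRingHom k (AddSubmonoid.inclusion (charMonoid_anti h))

lemma restrictChar_refl (k : Type u) [Field k] {d : ℕ} (σ : Cone d) :
    restrictChar k (le_refl σ) = RingHom.id (charAlgebra k σ) :=
  AddMonoidAlgebra.mapDomainRingHom_id

lemma restrictChar_trans (k : Type u) [Field k] {d : ℕ} {ρ τ σ : Cone d} (h : ρ ≤ τ)
    (h' : τ ≤ σ) :
    restrictChar k (h.trans h') = (restrictChar k h).comp (restrictChar k h') :=
  AddMonoidAlgebra.mapDomainRingHom_comp
    (AddSubmonoid.inclusion (charMonoid_anti h)) (AddSubmonoid.inclusion (charMonoid_anti h'))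

/-- The affine toric varieties `U_σ = Spec k[S_σ]`, functorially in the cone `σ`. -/
noncomputable def affineToric (k : Type u) [Field k] (d : ℕ) : Cone d ⥤ Scheme.{u} where
  obj σ := Spec (CommRingCat.of (charAlgebra k σ))
  map f := Spec.map (CommRingCat.ofHom (restrictChar k f.le))
  map_id σ := by
    rw [restrictChar_refl k σ]
    exact Spec.map_id _
  map_comp {ρ τ σ} f g := by
    rw [restrictChar_trans k f.le g.le, CommRingCat.ofHom_comp, Spec.map_comp]

/-! If `τ` is the face of `σ` cut out by `u`, then `k[S_τ]` is the localization of `k[S_σ]`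
at `t^u`. -/

lemma exists_nsmul_add_mem {d : ℕ} {τ σ : Cone d} (hσ : IsRational σ) {u : Fin d → ℤ}
    (hu : ∀ x ∈ σ, 0 ≤ latticePt u ⬝ᵥ x)
    (hτ : ∀ x, x ∈ τ ↔ x ∈ σ ∧ latticePt u ⬝ᵥ x = 0) {w : Fin d → ℤ}
    (hw : w ∈ charMonoid τ) : ∃ n : ℕ, w + n • u ∈ charMonoid σ := by
  obtain ⟨s, rfl⟩ := hσ
  have nsmul_pt : ∀ n : ℕ, latticePt (w + n • u) = latticePt w + (n : ℝ) • latticePt u := by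
    intro n; ext i; simp [latticePt]
  have key : ∀ v ∈ s, ∃ n : ℕ, ∀ m : ℕ, n ≤ m →
      0 ≤ latticePt (w + m • u) ⬝ᵥ latticePt v := by
    intro v hv
    have hvσ : latticePt v ∈ PointedCone.hull ℝ (latticePt '' (s : Set (Fin d → ℤ))) :=
      PointedCone.subset_hull ⟨v, hv, rfl⟩
    rcases (hu _ hvσ).eq_or_lt with h0 | hpos
    · refine ⟨0, fun m _ => ?_⟩
      rw [nsmul_pt, add_dotProduct, smul_dotProduct, ← h0, smul_zero, add_zero]
      exact hw _ ((hτ _).2 ⟨hvσ, h0.symm⟩)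
    · obtain ⟨n, hn⟩ := exists_nat_gt (-(latticePt w ⬝ᵥ latticePt v) /
        (latticePt u ⬝ᵥ latticePt v))
      refine ⟨n, fun m hm => ?_⟩
      rw [nsmul_pt, add_dotProduct, smul_dotProduct, smul_eq_mul]
      rw [div_lt_iff₀ hpos] at hn
      have : (n : ℝ) ≤ m := by exact_mod_cast hm
      nlinarith
  choose! N hN using key
  refine ⟨s.sup N, fun x hx => ?_⟩
  refine Submodule.span_induction (p := fun x _ => 0 ≤ latticePt (w + s.sup N • u) ⬝ᵥ x)
    ?_ (by simp) ?_ ?_ hx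
  · rintro _ ⟨v, hv, rfl⟩
    exact hN v hv _ (Finset.le_sup (f := N) hv)
  · intro x y _ _ hx hy
    rw [dotProduct_add]; exact add_nonneg hx hy
  · intro a x _ hx
    rw [dotProduct_smul]; exact smul_nonneg a.2 hx

lemma neg_mem_charMonoid {d : ℕ} {τ σ : Cone d} {u : Fin d → ℤ}
    (hτ : ∀ x, x ∈ τ ↔ x ∈ σ ∧ latticePt u ⬝ᵥ x = 0) : -u ∈ charMonoid τ := by
  intro x hx
  rw [latticePt_neg, neg_dotProduct, ((hτ x).1 hx).2, neg_zero]

lemma restrictChar_monomial (k : Type u) [Field k] {d : ℕ} {τ σ : Cone d} (h : τ ≤ σ)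
    (s : charMonoid σ) :
    restrictChar k h (monomial k s) =
      monomial k (AddSubmonoid.inclusion (charMonoid_anti h) s) := by
  simp [restrictChar, monomial]

lemma restrictChar_injective (k : Type u) [Field k] {d : ℕ} {τ σ : Cone d} (h : τ ≤ σ) :
    Function.Injective (restrictChar k h) :=
  AddMonoidAlgebra.mapDomain_injective (AddSubmonoid.inclusion_injective _)

lemma isLocalization_restrictChar (k : Type u) [Field k] {d : ℕ} {τ σ : Cone d} (h : τ ≤ σ)
    (hσ : IsRational σ) (u : charMonoid σ)
    (hτ : ∀ x, x ∈ τ ↔ x ∈ σ ∧ latticePt (u : Fin d → ℤ) ⬝ᵥ x = 0) :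
    @IsLocalization.Away _ _ (monomial k u) (charAlgebra k τ) _
      (restrictChar k h).toAlgebra := by
  letI := (restrictChar k h).toAlgebra
  have alg : ∀ x, algebraMap (charAlgebra k σ) (charAlgebra k τ) x = restrictChar k h x :=
    fun _ => rfl
  have hpow : ∀ n : ℕ, monomial k u ^ n = monomial k (n • u) := by
    intro n; simp [monomial, AddMonoidAlgebra.single_pow]
  refine ⟨?_, ?_, ?_⟩
  · rintro ⟨_, n, rfl⟩
    rw [alg]
    simp only [map_pow]
    refine IsUnit.pow n ?_
    refine IsUnit.of_mul_eq_one (monomial k ⟨-(u : Fin d → ℤ), neg_mem_charMonoid hτ⟩) ?_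
    rw [restrictChar_monomial]
    simp only [monomial, AddMonoidAlgebra.single_mul_single, mul_one, AddMonoidAlgebra.one_def]
    congr 1
    ext i
    simp
  · intro z
    suffices H : ∃ (n : ℕ) (a : charAlgebra k σ),
        z * restrictChar k h (monomial k u ^ n) = restrictChar k h a by
      obtain ⟨n, a, hn⟩ := H
      exact ⟨⟨a, ⟨_, n, rfl⟩⟩, hn⟩
    induction z using AddMonoidAlgebra.induction_linear with
    | zero => exact ⟨0, 0, by simp⟩
    | add f g hf hg =>
      obtain ⟨n, a, ha⟩ := hf
      obtain ⟨m, b, hb⟩ := hg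
      refine ⟨n + m, a * monomial k u ^ m + b * monomial k u ^ n, ?_⟩
      rw [map_add, map_mul, map_mul, ← ha, ← hb, pow_add, map_mul]
      ring
    | single w r =>
      obtain ⟨n, hn⟩ := exists_nsmul_add_mem hσ u.2 hτ w.2
      refine ⟨n, AddMonoidAlgebra.single ⟨_, hn⟩ r, ?_⟩
      rw [hpow, restrictChar_monomial]
      simp only [monomial, restrictChar, AddMonoidAlgebra.single_mul_single, mul_one,
        AddMonoidAlgebra.mapDomainRingHom_apply, AddMonoidAlgebra.mapDomain_single]
      congr 1
  · intro x y hxy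
    exact ⟨1, by rw [restrictChar_injective k h hxy]⟩

lemma isOpenImmersion_restrictChar (k : Type u) [Field k] {d : ℕ} {τ σ : Cone d} (h : τ ≤ σ)
    (hσ : IsRational σ) (u : charMonoid σ)
    (hτ : ∀ x, x ∈ τ ↔ x ∈ σ ∧ latticePt (u : Fin d → ℤ) ⬝ᵥ x = 0) :
    IsOpenImmersion (Spec.map (CommRingCat.ofHom (restrictChar k h))) := by
  algebraize [restrictChar k h]
  have := isLocalization_restrictChar k h hσ u hτ
  exact IsOpenImmersion.of_isLocalization (S := charAlgebra k τ) (monomial k u)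

lemma range_restrictChar (k : Type u) [Field k] {d : ℕ} {τ σ : Cone d} (h : τ ≤ σ)
    (hσ : IsRational σ) (u : charMonoid σ)
    (hτ : ∀ x, x ∈ τ ↔ x ∈ σ ∧ latticePt (u : Fin d → ℤ) ⬝ᵥ x = 0) :
    Set.range (PrimeSpectrum.comap (restrictChar k h)) =
      PrimeSpectrum.basicOpen (monomial k u) := by
  algebraize [restrictChar k h]
  have := isLocalization_restrictChar k h hσ u hτ
  exact PrimeSpectrum.localization_away_comap_range (charAlgebra k τ) (monomial k u)

lemma comap_restrictChar_injective (k : Type u) [Field k] {d : ℕ} {τ σ : Cone d} (h : τ ≤ σ)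
    (hσ : IsRational σ) (u : charMonoid σ)
    (hτ : ∀ x, x ∈ τ ↔ x ∈ σ ∧ latticePt (u : Fin d → ℤ) ⬝ᵥ x = 0) :
    Function.Injective (PrimeSpectrum.comap (restrictChar k h)) := by
  algebraize [restrictChar k h]
  have := isLocalization_restrictChar k h hσ u hτ
  exact PrimeSpectrum.localization_comap_injective (charAlgebra k τ)
    (Submonoid.powers (monomial k u))

lemma exists_comap_restrictChar_inf (k : Type u) [Field k] {d : ℕ} {τ₁ τ₂ σ : Cone d}
    (h₁ : τ₁ ≤ σ) (h₂ : τ₂ ≤ σ) (hσ : IsRational σ) (u₁ u₂ : charMonoid σ)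
    (hτ₁ : ∀ x, x ∈ τ₁ ↔ x ∈ σ ∧ latticePt (u₁ : Fin d → ℤ) ⬝ᵥ x = 0)
    (hτ₂ : ∀ x, x ∈ τ₂ ↔ x ∈ σ ∧ latticePt (u₂ : Fin d → ℤ) ⬝ᵥ x = 0)
    (p₁ : PrimeSpectrum (charAlgebra k τ₁)) (p₂ : PrimeSpectrum (charAlgebra k τ₂))
    (hp : PrimeSpectrum.comap (restrictChar k h₁) p₁ =
      PrimeSpectrum.comap (restrictChar k h₂) p₂) :
    ∃ q : PrimeSpectrum (charAlgebra k (τ₁ ⊓ τ₂)),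
      PrimeSpectrum.comap (restrictChar k inf_le_left) q = p₁ ∧
      PrimeSpectrum.comap (restrictChar k inf_le_right) q = p₂ := by
  have hij : ∀ x, x ∈ τ₁ ⊓ τ₂ ↔
      x ∈ σ ∧ latticePt ((u₁ + u₂ : charMonoid σ) : Fin d → ℤ) ⬝ᵥ x = 0 := by
    intro x
    rw [Submodule.mem_inf, hτ₁, hτ₂]
    simp only [AddSubmonoid.coe_add, latticePt_add, add_dotProduct]
    constructor
    · rintro ⟨⟨h1, h2⟩, -, h3⟩
      exact ⟨h1, by rw [h2, h3, add_zero]⟩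
    · rintro ⟨h1, h2⟩
      have a := u₁.2 x h1
      have b := u₂.2 x h1
      exact ⟨⟨h1, by linarith⟩, h1, by linarith⟩
  have hmul : monomial k (u₁ + u₂) = monomial k u₁ * monomial k u₂ := by
    simp [monomial, AddMonoidAlgebra.single_mul_single]
  have hm : PrimeSpectrum.comap (restrictChar k h₁) p₁ ∈
      Set.range (PrimeSpectrum.comap (restrictChar k (inf_le_left.trans h₁ : τ₁ ⊓ τ₂ ≤ σ))) := by
    rw [range_restrictChar k _ hσ _ hij, hmul, PrimeSpectrum.basicOpen_mul]
    refine ⟨?_, ?_⟩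
    · rw [← range_restrictChar k h₁ hσ _ hτ₁]; exact ⟨_, rfl⟩
    · rw [hp, ← range_restrictChar k h₂ hσ _ hτ₂]; exact ⟨_, rfl⟩
  obtain ⟨q, hq⟩ := hm
  refine ⟨q, comap_restrictChar_injective k h₁ hσ u₁ hτ₁ ?_,
    comap_restrictChar_injective k h₂ hσ u₂ hτ₂ ?_⟩
  · rw [← hq, restrictChar_trans k inf_le_left h₁, PrimeSpectrum.comap_comp_apply]
  · rw [← hp, ← hq, ← PrimeSpectrum.comap_comp_apply, ← restrictChar_trans k inf_le_right h₂]

/-! ### The toric variety of a fan -/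

/-- The gluing diagram of a fan: the affine toric varieties of its cones and the open immersions
between them. -/
noncomputable def Fan.diagram (k : Type u) [Field k] {d : ℕ} (Δ : Fan d) :
    Δ.cones ⥤ Scheme.{u} :=
  (Subtype.mono_coe (· ∈ Δ.cones)).functor ⋙ affineToric k d

lemma Fan.exists_localization {d : ℕ} (Δ : Fan d) {τ σ : Δ.cones} (h : τ.1 ≤ σ.1) :
    ∃ u : charMonoid σ.1, ∀ x, x ∈ τ.1 ↔ x ∈ σ.1 ∧ latticePt (u : Fin d → ℤ) ⬝ᵥ x = 0 := by
  obtain ⟨u, hu, hτ⟩ := (Δ.inter_isFace _ σ.2 _ τ.2).1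
  rw [inf_eq_right.2 h] at hτ
  exact ⟨⟨u, hu⟩, hτ⟩

instance (k : Type u) [Field k] {d : ℕ} (Δ : Fan d) {τ σ : Δ.cones} (f : τ ⟶ σ) :
    IsOpenImmersion ((Δ.diagram k).map f) := by
  obtain ⟨u, hu⟩ := Δ.exists_localization f.le
  exact isOpenImmersion_restrictChar k f.le (Δ.rational _ σ.2) u hu

instance (k : Type u) [Field k] {d : ℕ} (Δ : Fan d) :
    (Δ.diagram k ⋙ Scheme.forget).IsLocallyDirected where
  cond {i j l} fi fj xi xj hx := by
    have hmem : i.1 ⊓ j.1 ∈ Δ.cones :=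
      Δ.face_mem _ i.2 _ (Δ.inter_isFace _ i.2 _ j.2).1
    obtain ⟨ui, hui⟩ := Δ.exists_localization fi.le
    obtain ⟨uj, huj⟩ := Δ.exists_localization fj.le
    obtain ⟨q, h₁, h₂⟩ := exists_comap_restrictChar_inf k fi.le fj.le (Δ.rational _ l.2)
      ui uj hui huj xi xj hx
    exact ⟨⟨i.1 ⊓ j.1, hmem⟩, homOfLE (show i.1 ⊓ j.1 ≤ i.1 from inf_le_left),
      homOfLE (show i.1 ⊓ j.1 ≤ j.1 from inf_le_right), q, h₁, h₂⟩

/-- The toric variety `X_Δ`: the affine toric varieties of the cones of `Δ`, glued along the open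
subschemes of their common faces. -/
noncomputable def Fan.toricVariety (k : Type u) [Field k] {d : ℕ} (Δ : Fan d) : Scheme.{u} :=
  colimit (Δ.diagram k)

/-- The open immersion `U_σ → X_Δ` for a cone `σ` of `Δ`. -/
noncomputable def Fan.chart (k : Type u) [Field k] {d : ℕ} (Δ : Fan d) (σ : Δ.cones) :
    (affineToric k d).obj σ.1 ⟶ Δ.toricVariety k :=
  colimit.ι (Δ.diagram k) σ

/-- The point of `X_Δ` given by a prime ideal of `k[S_σ]`. -/
noncomputable def Fan.point (k : Type u) [Field k] {d : ℕ} (Δ : Fan d) (σ : Δ.cones)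
    (p : PrimeSpectrum (charAlgebra k σ.1)) : Δ.toricVariety k :=
  Δ.chart k σ p

/-- `π : X_{Δ'} → X_Δ` is the toric morphism of a refinement `Δ'` of `Δ`: every cone of `Δ'` lies
in a cone of `Δ`, and on charts `π` is given by the inclusions `k[S_σ] → k[S_σ']`. -/
def IsToricMorphism {k : Type u} [Field k] {d : ℕ} {Δ' Δ : Fan d}
    (π : Δ'.toricVariety k ⟶ Δ.toricVariety k) : Prop :=
  (∀ σ' : Δ'.cones, ∃ σ : Δ.cones, σ'.1 ≤ σ.1) ∧
  ∀ (σ' : Δ'.cones) (σ : Δ.cones) (h : σ'.1 ≤ σ.1),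
    Δ'.chart k σ' ≫ π = (affineToric k d).map (homOfLE h) ≫ Δ.chart k σ

/-! ### Torus-invariant divisors and the group `G` -/

/-- The torus-invariant prime divisors of `X_Δ`, given by their generic points: the points of
codimension one whose prime ideal in a chart `k[S_σ]` is graded by characters. -/
def Fan.torusDivisors (k : Type u) [Field k] {d : ℕ} (Δ : Fan d) : Set (Δ.toricVariety k) :=
  {x | Order.coheight x = 1 ∧
    ∃ (σ : Δ.cones) (p : PrimeSpectrum (charAlgebra k σ.1)), Δ.point k σ p = x ∧
      p.asIdeal = Ideal.span {f | f ∈ p.asIdeal ∧ ∃ s, f = monomial k s}}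

/-- The torus-invariant Weil divisors of `X_Δ`. -/
abbrev Fan.WeilDiv (k : Type u) [Field k] {d : ℕ} (Δ : Fan d) : Type u :=
  Δ.torusDivisors k →₀ ℤ

/-- The order of vanishing of the monomial `t^s` at the prime `p` of `k[S_σ]`. -/
noncomputable def ordMonomial {k : Type u} [Field k] {d : ℕ} {σ : Cone d}
    (p : PrimeSpectrum (charAlgebra k σ)) (s : charMonoid σ) : ℕ∞ :=
  Ring.ord (Localization.AtPrime p.asIdeal) (algebraMap _ _ (monomial k s))

/-- `E` is Cartier: on each chart `U_σ` it is the divisor of a character `t^s / t^s'`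
of the torus (here `s, s' ∈ S_σ`, and every character is such a quotient). -/
def Fan.IsCartier {k : Type u} [Field k] {d : ℕ} {Δ : Fan d} (E : Δ.WeilDiv k) : Prop :=
  ∀ σ : Δ.cones, ∃ s s' : charMonoid σ.1,
    ∀ (D : Δ.torusDivisors k) (p : PrimeSpectrum (charAlgebra k σ.1)), Δ.point k σ p = D.1 →
      E D = ((ordMonomial p s).toNat : ℤ) - ((ordMonomial p s').toNat : ℤ)

/-- The group of torus-invariant Cartier divisors inside that of torus-invariant Weil divisors. -/
noncomputable def Fan.cartierSubgroup (k : Type u) [Field k] {d : ℕ} (Δ : Fan d) :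
    AddSubgroup (Δ.WeilDiv k) :=
  AddSubgroup.closure {E | Fan.IsCartier E}

/-- The group `G`: torus-invariant Weil divisors modulo torus-invariant Cartier divisors. -/
abbrev Fan.G (k : Type u) [Field k] {d : ℕ} (Δ : Fan d) : Type u :=
  Δ.WeilDiv k ⧸ Δ.cartierSubgroup k

/-- The class in `G` of a torus-invariant prime divisor. -/
noncomputable def Fan.divisorClass (k : Type u) [Field k] {d : ℕ} (Δ : Fan d)
    (D : Δ.torusDivisors k) : Δ.G k :=
  QuotientAddGroup.mk (Finsupp.single D 1)

/-- The image of `D` in `G` has infinite order. -/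
def Fan.HasInfiniteOrder {k : Type u} [Field k] {d : ℕ} {Δ : Fan d}
    (D : Δ.torusDivisors k) : Prop :=
  ¬ IsOfFinAddOrder (Δ.divisorClass k D)

/-- The point `x` is the generic point of the torus-invariant prime divisor belonging to the ray
of `Δ` with primitive generator `v`: on the chart `U_ρ` of that ray it is the prime generated by
the monomials `t^s` with `⟨s, v⟩ > 0`. -/
def Fan.IsDivisorOfRay {k : Type u} [Field k] {d : ℕ} {Δ : Fan d} (x : Δ.toricVariety k)
    (v : Fin d → ℤ) : Prop :=
  IsPrimitive v ∧ ∃ (hv : rayCone v ∈ Δ.cones)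
    (p : PrimeSpectrum (charAlgebra k (rayCone v))),
    Δ.point k ⟨rayCone v, hv⟩ p = x ∧
    p.asIdeal = Ideal.span {f | ∃ s : charMonoid (rayCone v),
      0 < (s : Fin d → ℤ) ⬝ᵥ v ∧ f = monomial k s}

/-! ### The multiple `m'` -/

/-- `R` is an edge of the cone `C`: a face whose dimension is one more than that of the largest
linear subspace of `C` (a one-dimensional face if `C` contains no line). -/
def IsEdge {d : ℕ} (R C : Cone d) : Prop :=
  IsFace R C ∧
    Module.finrank ℝ (Submodule.span ℝ (R : Set (Fin d → ℝ))) = Module.finrank ℝ C.lineal + 1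

/-- The heights over the facet `v^⊥ ∩ σ^∨` of the first lattice points on the edges of `σ^∨` that
are not contained in this facet, for all cones `σ` of `Δ` containing `v`. -/
def Fan.heights {d : ℕ} (Δ : Fan d) (v : Fin d → ℤ) : Set ℕ :=
  {h | ∃ σ ∈ Δ.cones, latticePt v ∈ σ ∧ ∃ R : Cone d, IsEdge R (dualCone σ) ∧
    IsLeast {n : ℕ | 0 < n ∧ ∃ w : Fin d → ℤ, latticePt w ∈ R ∧ w ⬝ᵥ v = n} h}

/-- The least common multiple of the heights. -/
noncomputable def Fan.heightLcm {d : ℕ} (Δ : Fan d) (v : Fin d → ℤ) : ℕ :=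
  sInf {m : ℕ | 0 < m ∧ ∀ h ∈ Δ.heights v, h ∣ m}

/-! ### Symbolic powers and blow-ups -/

/-- The `n`-th symbolic power of the ideal sheaf of the closure of `x`: the functions whose germ at
`x` lies in `𝔪_x ^ n`, i.e. the kernel of `𝒪_X → 𝒪_{X,x} / 𝔪_x ^ n`. If `x` is the generic point
of a prime divisor `D`, this is the ideal sheaf of `n D`. -/
noncomputable def symbolicPower {X : Scheme.{u}} (x : X) (n : ℕ) : X.IdealSheafData :=
  (Spec.map (CommRingCat.ofHom (Ideal.Quotient.mk
    ((IsLocalRing.maximalIdeal (X.presheaf.stalk x)) ^ n))) ≫ X.fromSpecStalk x).ker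

/-- An invertible ideal sheaf: locally generated by one nonzerodivisor. -/
def IsInvertibleIdeal {T : Scheme.{u}} (J : T.IdealSheafData) : Prop :=
  ∀ x : T, ∃ U : T.affineOpens, x ∈ U.1 ∧
    ∃ f ∈ nonZeroDivisors Γ(T, U.1), J.ideal U = Ideal.span {f}

/-- `π : X' → X` is the blow-up of the ideal sheaf `I` (universal property). -/
structure IsBlowup {X' X : Scheme.{u}} (π : X' ⟶ X) (I : X.IdealSheafData) : Prop where
  invertible : IsInvertibleIdeal (I.comap π)
  existsUnique_lift : ∀ (T : Scheme.{u}) (f : T ⟶ X), IsInvertibleIdeal (I.comap f) →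
    ∃! g : T ⟶ X', g ≫ π = f

/-- A normal integral scheme. -/
def IsNormalIntegral (T : Scheme.{u}) : Prop :=
  IsIntegral T ∧ ∀ x : T, IsIntegrallyClosed (T.presheaf.stalk x)

/-- `π : X' → X` is the normalized blow-up of the ideal sheaf `I`, i.e. the blow-up among normal
varieties (the normalization of the blow-up of `I`): it is universal among the dominant morphisms
from normal integral schemes that make `I` invertible. -/
structure IsNormalizedBlowup {X' X : Scheme.{u}} (π : X' ⟶ X) (I : X.IdealSheafData) :
    Prop where
  normal : IsNormalIntegral X'
  dominant : IsDominant π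
  invertible : IsInvertibleIdeal (I.comap π)
  existsUnique_lift : ∀ (T : Scheme.{u}) (f : T ⟶ X), IsNormalIntegral T → IsDominant f →
    IsInvertibleIdeal (I.comap f) → ∃! g : T ⟶ X', g ≫ π = f

/-- The toric morphism `π : X_{Δ'} → X_Δ` is the blow-up of `m' D`, where `D` is the
torus-invariant prime divisor of the ray `v` and `m'` is the least common multiple of the heights,
and it is the stellar subdivision of `Δ` along `v`. It is the normalized blow-up of the ideal sheaf
of `m' D`, and for all large `l` it is the blow-up of the ideal sheaf of `l m' D`, so `π` is
projective. -/
structure IsDivisorBlowup {k : Type u} [Field k] {d : ℕ} {Δ' Δ : Fan d}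
    (π : Δ'.toricVariety k ⟶ Δ.toricVariety k) (D : Δ.torusDivisors k) (v : Fin d → ℤ) :
    Prop where
  toric : IsToricMorphism π
  divisor_of_ray : Fan.IsDivisorOfRay D.1 v
  stellar : Δ'.cones = Δ.stellar v
  normalizedBlowup : IsNormalizedBlowup π (symbolicPower D.1 (Δ.heightLcm v))
  blowup : ∃ L : ℕ, ∀ l ≥ L, IsBlowup π (symbolicPower D.1 (l * Δ.heightLcm v))

/-- One step of the simplicialization procedure: `X_{Δ'}` is obtained from `X_Δ` by blowing up
`m' D` for a torus-invariant prime divisor `D` whose image in `G` has infinite order. -/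
def Fan.Step (k : Type u) [Field k] {d : ℕ} (Δ Δ' : Fan d) : Prop :=
  ∃ (D : Δ.torusDivisors k) (v : Fin d → ℤ) (π : Δ'.toricVariety k ⟶ Δ.toricVariety k),
    Fan.HasInfiniteOrder D ∧ IsDivisorBlowup π D v

end Toric

namespace Toric

/-! ### Rational cones -/

/-! Everything torus-invariant can be read off from the fan. A prime of height one in `k[S_σ]` that
is generated by monomials is the prime `rayPrime` of a ray of `σ`, and `t^s` vanishes there to order
`⟨s, v⟩`. Hence torus-invariant prime divisors are rays (`Fan.divisorEquiv`), and a divisor is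
Cartier iff on every cone its coefficients are the values of one lattice functional on the ray
generators (`Fan.mem_cartierSubgroup_iff`). Clearing denominators over the finitely many cones, the
class of the divisor of `v` is torsion iff in every cone through `v` some lattice functional is
nonzero at `v` and kills the other rays (`Fan.IsSplit`, `Fan.hasInfiniteOrder_iff`). The same
condition says that every cone through `v` is spanned by `v` and the opposite face, that is, that
subdividing along `v` changes nothing (`Fan.stellar_eq_iff`). Required for all rays of a cone, it
says that the ray generators are linearly independent (`Fan.exists_of_isSimplicial`,
`Fan.isSimplicial_of_exists`). So the procedure is stuck exactly at simplicial fans.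

It terminates because subdividing along `v` twice is the same as once (`Fan.stellarFan_stellar`), so
`v` splits in the new fan. The rays are unchanged and every new cone lies in an old one, so Cartier
divisors stay Cartier and `G(X) → G(X̃)` is surjective. It sends a class of infinite order to a
torsion class, hence the rank drops (`Fan.finrank_G_lt`).

The remaining point is that the subdivision is a blow-up. On `U_σ` with `v ∈ σ`, the ideal of `nD`
is spanned by the `t^p` with `⟨p, v⟩ ≥ n` (`Fan.comap_maximalIdeal_pow`). The number `m'` is chosen
so that every edge of `σ^∨` off the facet `v^⊥` carries a lattice point of height exactly `m'`. Let
`W` be the set of `l`-fold multiples of the points of `S_σ` of height `m'`. For `w ∈ W` the monomial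
`t^w` divides the whole ideal on the chart of `ℝ_{≥0} v + (σ ∩ w^⊥)`, a cone of the subdivision, and
every cone of the subdivision inside `σ` lies in one of these (`Fan.isLocalBlowup_stellar`). Moving
lattice points to edges shows that the ideal is integral over the one generated by `W`
(`Fan.exists_mem_reesMonoid`), so wherever the ideal becomes invertible it is locally generated by a
single `t^w` with `w ∈ W` (`IsLocalBlowup.exists_generates`).

A morphism with this property lifts to the chart of `w` as soon as it can evaluate `t^c` for `c` in
the monoid of that chart. In general `t^c` is only integral over the blow-up algebra, which suffices
on normal schemes (`Fan.hasIntegralReesCharts_stellar`, `IsMonomialSheaf.isNormalizedBlowup`). For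
large `l` the generators `c` satisfy that `t^(c + w)` already lies in the ideal, so `t^c` is a
quotient of elements of the ideal, and the subdivision is the blow-up itself
(`Fan.hasReesCharts_stellar`, `IsMonomialSheaf.isBlowup`). Lifts are unique because `t^w` is a
nonzerodivisor, so they glue. -/

lemma latticePt_dotProduct {d : ℕ} (u w : Fin d → ℤ) :
    latticePt u ⬝ᵥ latticePt w = ((u ⬝ᵥ w : ℤ) : ℝ) := by
  simp [latticePt, dotProduct]

lemma latticePt_injective {d : ℕ} : Function.Injective (latticePt (d := d)) := fun u w h => by
  ext i; simpa [latticePt] using congrFun h i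

lemma latticePt_zsmul {d : ℕ} (n : ℤ) (u : Fin d → ℤ) :
    latticePt (n • u) = (n : ℝ) • latticePt u := by
  ext i; simp [latticePt]

lemma latticePt_nsmul {d : ℕ} (n : ℕ) (u : Fin d → ℤ) :
    latticePt (n • u) = (n : ℝ) • latticePt u := by
  ext i; simp [latticePt]

lemma latticePt_sum {d : ℕ} {ι : Type*} (s : Finset ι) (f : ι → Fin d → ℤ) :
    latticePt (∑ i ∈ s, f i) = ∑ i ∈ s, latticePt (f i) := by
  ext i; simp [latticePt, Finset.sum_apply]

lemma nonneg_of_mem_hull {d : ℕ} {s : Set (Fin d → ℝ)} {u : Fin d → ℝ}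
    (h : ∀ y ∈ s, 0 ≤ u ⬝ᵥ y) {x : Fin d → ℝ} (hx : x ∈ PointedCone.hull ℝ s) : 0 ≤ u ⬝ᵥ x := by
  refine Submodule.span_induction (p := fun x _ => 0 ≤ u ⬝ᵥ x) h (by simp) ?_ ?_ hx
  · intro x y _ _ hx hy
    rw [dotProduct_add]; exact add_nonneg hx hy
  · intro a x _ hx
    rw [dotProduct_smul]; exact smul_nonneg a.2 hx

lemma mem_charMonoid_hull {d : ℕ} {s : Finset (Fin d → ℤ)} {u : Fin d → ℤ} :
    u ∈ charMonoid (PointedCone.hull ℝ (latticePt '' (s : Set (Fin d → ℤ)))) ↔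
      ∀ v ∈ s, 0 ≤ u ⬝ᵥ v := by
  refine ⟨fun h v hv => ?_, fun h x hx => nonneg_of_mem_hull ?_ hx⟩
  · have := h _ (PointedCone.subset_hull ⟨v, hv, rfl⟩)
    rw [latticePt_dotProduct] at this
    exact_mod_cast this
  · rintro _ ⟨v, hv, rfl⟩
    rw [latticePt_dotProduct]
    exact_mod_cast h v hv

lemma smul_mem_cone {d : ℕ} (σ : Cone d) {c : ℝ} (hc : 0 ≤ c) {x : Fin d → ℝ} (hx : x ∈ σ) :
    c • x ∈ σ :=
  σ.smul_mem hc hx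

lemma mem_hull_insert {d : ℕ} {v : Fin d → ℝ} {s : Set (Fin d → ℝ)} {x : Fin d → ℝ} :
    x ∈ PointedCone.hull ℝ (insert v s) ↔
      ∃ t : ℝ, 0 ≤ t ∧ x - t • v ∈ PointedCone.hull ℝ s := by
  rw [PointedCone.hull, Submodule.mem_span_insert]
  constructor
  · rintro ⟨a, z, hz, rfl⟩
    refine ⟨a, a.2, ?_⟩
    have : (a • v + z) - (a : ℝ) • v = z := add_sub_cancel_left _ _
    rwa [this]
  · rintro ⟨t, ht, h⟩
    exact ⟨⟨t, ht⟩, _, h, (add_sub_cancel _ _).symm⟩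

/-- One step of Fourier–Motzkin elimination. -/
lemma exists_nonneg_mul_le_iff {ι : Type*} (A : Finset ι) (α β : ι → ℝ) :
    (∃ t : ℝ, 0 ≤ t ∧ ∀ a ∈ A, t * β a ≤ α a) ↔
      (∀ a ∈ A, 0 ≤ β a → 0 ≤ α a) ∧
        ∀ p ∈ A, ∀ n ∈ A, 0 < β p → β n < 0 → 0 ≤ β p * α n - β n * α p := by
  classical
  constructor
  · rintro ⟨t, ht, h⟩
    refine ⟨fun a ha hb => (mul_nonneg ht hb).trans (h a ha), fun p hp n hn hbp hbn => ?_⟩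
    have h1 := mul_le_mul_of_nonneg_left (h n hn) hbp.le
    have h2 := mul_le_mul_of_nonneg_left (h p hp) (neg_nonneg.2 hbn.le)
    nlinarith
  · rintro ⟨h1, h2⟩
    -- The inequalities with `β < 0` are lower bounds for `t`, as is `0 ≤ t`. The largest of them is
    -- the candidate; the pairwise conditions say that it respects every upper bound.
    let T : Finset ℝ := insert 0 ((A.filter (β · < 0)).image fun n => α n / β n)
    have hT : T.Nonempty := ⟨0, by simp [T]⟩
    refine ⟨T.max' hT, T.le_max' 0 (by simp [T]), fun a ha => ?_⟩
    rcases lt_trichotomy (β a) 0 with hb | hb | hb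
    · have : α a / β a ≤ T.max' hT := T.le_max' _ (by
        simp only [T, Finset.mem_insert, Finset.mem_image, Finset.mem_filter]
        exact Or.inr ⟨a, ⟨ha, hb⟩, rfl⟩)
      rwa [div_le_iff_of_neg hb] at this
    · rw [hb, mul_zero]; exact h1 a ha hb.ge
    · have := T.max'_mem hT
      rw [Finset.mem_insert, Finset.mem_image] at this
      rcases this with h0 | ⟨n, hn, hn'⟩
      · rw [h0, zero_mul]; exact h1 a ha hb.le
      · rw [← hn']
        rw [Finset.mem_filter] at hn
        have := h2 a ha n hn.1 hb hn.2
        rw [div_mul_eq_mul_div, div_le_iff_of_neg hn.2]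
        linarith

/-- A rational cone is cut out by finitely many lattice functionals. -/
lemma exists_halfspaces {d : ℕ} (s : Finset (Fin d → ℤ)) :
    ∃ A : Finset (Fin d → ℤ), ∀ x,
      x ∈ PointedCone.hull ℝ (latticePt '' (s : Set (Fin d → ℤ))) ↔
        ∀ a ∈ A, 0 ≤ latticePt a ⬝ᵥ x := by
  classical
  induction s using Finset.induction_on with
  | empty =>
    refine ⟨Finset.univ.image (fun i => Pi.single i 1) ∪
      Finset.univ.image (fun i => -Pi.single i 1), fun x => ?_⟩
    have hs : ∀ i : Fin d, latticePt (Pi.single i 1) = Pi.single i 1 := by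
      intro i; ext j; by_cases h : j = i
      · subst h; simp [latticePt]
      · simp [latticePt, h]
    simp only [Finset.coe_empty, Set.image_empty, PointedCone.hull, Submodule.span_empty,
      Submodule.mem_bot, Finset.mem_union, Finset.mem_image, Finset.mem_univ, true_and]
    constructor
    · rintro rfl a -; simp
    · intro h
      ext i
      have h1 := h (Pi.single i 1) (Or.inl ⟨i, rfl⟩)
      have h2 := h (-Pi.single i 1) (Or.inr ⟨i, rfl⟩)
      rw [hs, single_one_dotProduct] at h1
      rw [latticePt_neg, hs, neg_dotProduct, single_one_dotProduct] at h2
      simp only [Pi.zero_apply]; linarith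
  | insert v s _ ih =>
    obtain ⟨A, hA⟩ := ih
    -- Adding the generator `v` keeps the functionals that are nonnegative at `v`. The others
    -- survive only in the positive combinations with a positive one that vanish at `v`.
    refine ⟨A.filter (fun a => 0 ≤ a ⬝ᵥ v) ∪
      ((A ×ˢ A).filter fun q => 0 < q.1 ⬝ᵥ v ∧ q.2 ⬝ᵥ v < 0).image
        (fun q => (q.1 ⬝ᵥ v) • q.2 - (q.2 ⬝ᵥ v) • q.1), fun x => ?_⟩
    rw [Finset.coe_insert, Set.image_insert_eq, mem_hull_insert]
    simp only [hA, dotProduct_sub, dotProduct_smul, sub_nonneg, smul_eq_mul]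
    rw [exists_nonneg_mul_le_iff A (fun a => latticePt a ⬝ᵥ x)
      (fun a => latticePt a ⬝ᵥ latticePt v)]
    simp only [latticePt_dotProduct, Finset.mem_union, Finset.mem_filter, Finset.mem_image,
      Finset.mem_product, Int.cast_nonneg_iff, Int.cast_pos, Int.cast_lt_zero]
    have e : ∀ p n : Fin d → ℤ, latticePt ((p ⬝ᵥ v) • n - (n ⬝ᵥ v) • p) ⬝ᵥ x =
        ((p ⬝ᵥ v : ℤ) : ℝ) * (latticePt n ⬝ᵥ x) - ((n ⬝ᵥ v : ℤ) : ℝ) * (latticePt p ⬝ᵥ x) := by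
      intro p n
      rw [sub_eq_add_neg, latticePt_add, latticePt_neg, latticePt_zsmul, latticePt_zsmul,
        add_dotProduct, neg_dotProduct, smul_dotProduct, smul_dotProduct, smul_eq_mul, smul_eq_mul,
        sub_eq_add_neg]
    constructor
    · rintro ⟨h1, h2⟩ a (⟨ha, hb⟩ | ⟨⟨p, n⟩, ⟨⟨hp, hn⟩, hbp, hbn⟩, rfl⟩)
      · exact h1 a ha hb
      · rw [e]; exact h2 p hp n hn hbp hbn
    · intro h
      refine ⟨fun a ha hb => h a (Or.inl ⟨ha, hb⟩), fun p hp n hn hbp hbn => ?_⟩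
      rw [← e]
      exact h _ (Or.inr ⟨⟨p, n⟩, ⟨⟨hp, hn⟩, hbp, hbn⟩, rfl⟩)

lemma IsRational.exists_halfspaces {d : ℕ} {σ : Cone d} (hσ : IsRational σ) :
    ∃ A : Finset (Fin d → ℤ), (∀ a ∈ A, a ∈ charMonoid σ) ∧
      ∀ x, x ∈ σ ↔ ∀ a ∈ A, 0 ≤ latticePt a ⬝ᵥ x := by
  obtain ⟨s, rfl⟩ := hσ
  obtain ⟨A, hA⟩ := Toric.exists_halfspaces s
  exact ⟨A, fun a ha x hx => (hA x).1 hx a ha, hA⟩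

/-- Biduality, restricted to lattice functionals. It holds because a rational cone is a finite
intersection of lattice half-spaces. -/
lemma IsRational.mem_of_forall {d : ℕ} {σ : Cone d} (hσ : IsRational σ) {x : Fin d → ℝ}
    (h : ∀ u ∈ charMonoid σ, 0 ≤ latticePt u ⬝ᵥ x) : x ∈ σ := by
  obtain ⟨A, hA, hA'⟩ := hσ.exists_halfspaces
  exact (hA' x).2 fun a ha => h a (hA a ha)

/-- **Gordan's lemma**: the monoid `S_σ` is finitely generated. -/
lemma IsRational.fg_charMonoid {d : ℕ} {σ : Cone d} (hσ : IsRational σ) :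
    (charMonoid σ).FG := by
  obtain ⟨s, rfl⟩ := hσ
  -- A lattice point is a difference of two natural vectors, and the inequalities defining `S_σ`
  -- become equations once slack variables in `ℕ` are added. So `S_σ` is an image of the equalizer
  -- of two additive maps out of a power of `ℕ`, which is finitely generated.
  let F : (Fin d → ℕ) × (Fin d → ℕ) →+ (Fin d → ℤ) :=
    { toFun := fun q i => (q.1 i : ℤ) - q.2 i
      map_zero' := by ext; simp
      map_add' := by intro q r; ext; simp; ring }
  let f : ((Fin d → ℕ) × (Fin d → ℕ)) × (s → ℕ) →+ (s → ℤ) :=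
    { toFun := fun q v => F q.1 ⬝ᵥ v.1
      map_zero' := by ext; simp
      map_add' := by intro q r; ext; simp [add_dotProduct] }
  let g : ((Fin d → ℕ) × (Fin d → ℕ)) × (s → ℕ) →+ (s → ℤ) :=
    { toFun := fun q v => (q.2 v : ℤ)
      map_zero' := by ext; simp
      map_add' := by intro q r; ext; simp }
  have h := (AddSubmonoid.fg_eqLocusM f g).map (F.comp (AddMonoidHom.fst _ _))
  convert h using 1
  ext u
  rw [mem_charMonoid_hull, AddSubmonoid.mem_map]
  constructor
  · intro hu
    refine ⟨((fun i => (u i).toNat, fun i => (-u i).toNat), fun v => (u ⬝ᵥ v.1).toNat), ?_, ?_⟩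
    · have : F (fun i => (u i).toNat, fun i => (-u i).toNat) = u := by
        ext i; change ((u i).toNat : ℤ) - ((-u i).toNat : ℤ) = u i; omega
      change _ = _
      ext v
      change F _ ⬝ᵥ v.1 = (((u ⬝ᵥ v.1).toNat : ℕ) : ℤ)
      rw [this, Int.toNat_of_nonneg (hu v v.2)]
    · ext i; change ((u i).toNat : ℤ) - ((-u i).toNat : ℤ) = u i; omega
  · rintro ⟨q, hq, rfl⟩ v hv
    have := congrFun (show f q = g q from hq) ⟨v, hv⟩
    change F q.1 ⬝ᵥ v = (q.2 _ : ℤ) at this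
    change 0 ≤ F q.1 ⬝ᵥ v
    rw [this]; positivity

/-- Moving from `p` in a direction `y` until a new inequality becomes an equality. -/
lemma exists_boundary_point {d : ℕ} (V : Finset (Fin d → ℤ)) {p y : Fin d → ℤ}
    (hp : ∀ v ∈ V, 0 ≤ p ⬝ᵥ v) (hy : ∀ v ∈ V, p ⬝ᵥ v = 0 → y ⬝ᵥ v = 0)
    (hneg : ∃ v ∈ V, y ⬝ᵥ v < 0) :
    ∃ v ∈ V, y ⬝ᵥ v < 0 ∧
      (∀ w ∈ V, 0 ≤ ((-(y ⬝ᵥ v)) • p + (p ⬝ᵥ v) • y) ⬝ᵥ w) ∧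
      (V.filter fun w => ((-(y ⬝ᵥ v)) • p + (p ⬝ᵥ v) • y) ⬝ᵥ w ≠ 0).card <
        (V.filter fun w => p ⬝ᵥ w ≠ 0).card := by
  classical
  obtain ⟨v₀, hv₀, hv₀'⟩ := hneg
  -- The smallest ratio belongs to the first inequality that becomes tight along the half-line from
  -- `p` in direction `y`. Scaling by the denominator keeps the new point in the lattice.
  obtain ⟨v, hv, hmin⟩ := Finset.exists_min_image (V.filter fun v => y ⬝ᵥ v < 0)
    (fun v => ((p ⬝ᵥ v : ℤ) : ℚ) / ((-(y ⬝ᵥ v) : ℤ) : ℚ)) ⟨v₀, by simp [hv₀, hv₀']⟩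
  rw [Finset.mem_filter] at hv
  have e : ∀ w, ((-(y ⬝ᵥ v)) • p + (p ⬝ᵥ v) • y) ⬝ᵥ w =
      -(y ⬝ᵥ v) * (p ⬝ᵥ w) + (p ⬝ᵥ v) * (y ⬝ᵥ w) := by
    intro w; simp only [add_dotProduct, smul_dotProduct, smul_eq_mul]
  refine ⟨v, hv.1, hv.2, fun w hw => ?_, ?_⟩
  · rw [e]
    rcases le_or_gt 0 (y ⬝ᵥ w) with h | h
    · have := hp v hv.1
      have := hp w hw
      have := hv.2
      nlinarith [mul_nonneg (hp v hv.1) h]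
    · have := hmin w (by simp [hw, h])
      rw [div_le_div_iff₀ (by exact_mod_cast neg_pos.2 hv.2) (by exact_mod_cast neg_pos.2 h)]
        at this
      have : (p ⬝ᵥ v) * -(y ⬝ᵥ w) ≤ (p ⬝ᵥ w) * -(y ⬝ᵥ v) := by exact_mod_cast this
      linarith
  -- Equalities at `p` persist because `y` respects them, and the inequality at `v`, strict at `p`,
  -- becomes a new equality.
  · refine Finset.card_lt_card ⟨fun w hw => ?_, fun h => ?_⟩
    · rw [Finset.mem_filter] at hw ⊢
      refine ⟨hw.1, fun h0 => hw.2 ?_⟩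
      rw [e, h0, hy w hw.1 h0]; simp
    · have hpv : p ⬝ᵥ v ≠ 0 := fun h0 => hv.2.ne (hy v hv.1 h0)
      have := h (Finset.mem_filter.2 ⟨hv.1, hpv⟩)
      rw [Finset.mem_filter, e] at this
      exact this.2 (by ring)

/-- A point of a rational cone at which `b` is positive can be moved to an edge without leaving
the facets containing it. -/
lemma exists_edge_point {d : ℕ} (V : Finset (Fin d → ℤ)) (b : Fin d → ℤ) {p : Fin d → ℤ}
    (hp : ∀ v ∈ V, 0 ≤ p ⬝ᵥ v) (hb : 0 < p ⬝ᵥ b) :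
    ∃ g : Fin d → ℤ, (∀ v ∈ V, 0 ≤ g ⬝ᵥ v) ∧ 0 < g ⬝ᵥ b ∧
      (∀ v ∈ V, p ⬝ᵥ v = 0 → g ⬝ᵥ v = 0) ∧
      ∀ y : Fin d → ℤ, (∀ v ∈ V, g ⬝ᵥ v = 0 → y ⬝ᵥ v = 0) → y ⬝ᵥ b = 0 →
        ∀ v ∈ V, y ⬝ᵥ v = 0 := by
  induction hn : (V.filter fun w => p ⬝ᵥ w ≠ 0).card using Nat.strong_induction_on
    generalizing p with
  | _ n ih =>
    by_cases H : ∀ y : Fin d → ℤ, (∀ v ∈ V, p ⬝ᵥ v = 0 → y ⬝ᵥ v = 0) → y ⬝ᵥ b = 0 →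
        ∀ v ∈ V, y ⬝ᵥ v = 0
    · exact ⟨p, hp, hb, fun _ _ h => h, H⟩
    push Not at H
    have : ∃ y : Fin d → ℤ, (∀ v ∈ V, p ⬝ᵥ v = 0 → y ⬝ᵥ v = 0) ∧ y ⬝ᵥ b = 0 ∧
        ∃ v ∈ V, y ⬝ᵥ v < 0 := by
      obtain ⟨y, hy, hyb, v, hv, hne⟩ := H
      rcases lt_or_gt_of_ne hne with h | h
      · exact ⟨y, hy, hyb, v, hv, h⟩
      · exact ⟨-y, fun v hv h0 => by simp [hy v hv h0], by simp [hyb], v, hv, by simpa using h⟩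
    obtain ⟨y, hy, hyb, hneg⟩ := this
    obtain ⟨v, hv, hv0, hp', hcard⟩ := exists_boundary_point V hp hy hneg
    obtain ⟨g, h1, h2, h3, h4⟩ := ih _ (hn ▸ hcard) hp' (by
      simp only [add_dotProduct, smul_dotProduct, hyb, smul_eq_mul, mul_zero, add_zero]
      exact mul_pos (neg_pos.2 hv0) hb) rfl
    refine ⟨g, h1, h2, fun w hw h0 => h3 w hw ?_, h4⟩
    simp only [add_dotProduct, smul_dotProduct, h0, hy w hw h0, smul_zero, add_zero]

/-- A submonoid containing enough points of a rational cone contains a multiple of each of its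
lattice points. -/
lemma exists_nsmul_mem {d : ℕ} (V : Finset (Fin d → ℤ)) (b : Fin d → ℤ)
    (hb : ∀ p : Fin d → ℤ, (∀ v ∈ V, 0 ≤ p ⬝ᵥ v) → 0 ≤ p ⬝ᵥ b)
    (S : AddSubmonoid (Fin d → ℤ))
    (h0 : ∀ r : Fin d → ℤ, (∀ v ∈ V, 0 ≤ r ⬝ᵥ v) → r ⬝ᵥ b = 0 → r ∈ S)
    (h1 : ∀ p : Fin d → ℤ, (∀ v ∈ V, 0 ≤ p ⬝ᵥ v) → 0 < p ⬝ᵥ b →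
      ∃ g ∈ S, (∀ v ∈ V, 0 ≤ g ⬝ᵥ v) ∧ 0 < g ⬝ᵥ b ∧ ∀ v ∈ V, p ⬝ᵥ v = 0 → g ⬝ᵥ v = 0)
    {p : Fin d → ℤ} (hp : ∀ v ∈ V, 0 ≤ p ⬝ᵥ v) : ∃ N : ℕ, 0 < N ∧ N • p ∈ S := by
  induction hn : (V.filter fun w => p ⬝ᵥ w ≠ 0).card using Nat.strong_induction_on
    generalizing p with
  | _ n ih =>
    rcases (hb p hp).eq_or_lt with hpb | hpb
    · exact ⟨1, one_pos, by simpa using h0 p hp hpb.symm⟩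
    obtain ⟨g, hgS, hg, hgb, hpg⟩ := h1 p hp hpb
    -- Otherwise `-g` lies in the cone and `b` is negative there. Moving from `p` in direction `-g`
    -- therefore meets the boundary in some `p'` with `(g ⬝ᵥ v) • p = p' + (p ⬝ᵥ v) • g`, and the
    -- induction applies to `p'`.
    have hneg : ∃ v ∈ V, (-g) ⬝ᵥ v < 0 := by
      by_contra hcon
      push Not at hcon
      have := hb (-g) hcon
      simp only [neg_dotProduct] at this
      omega
    obtain ⟨v, hv, hv0, hp', hcard⟩ := exists_boundary_point V hp
      (fun v hv h => by simp [hpg v hv h]) hneg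
    obtain ⟨N, hN, hmem⟩ := ih _ (hn ▸ hcard) hp' rfl
    simp only [neg_dotProduct, neg_neg, Left.neg_neg_iff] at hv0 hmem
    refine ⟨N * (g ⬝ᵥ v).toNat, Nat.mul_pos hN (by omega), ?_⟩
    have hsum := S.add_mem hmem (S.nsmul_mem hgS (N * (p ⬝ᵥ v).toNat))
    convert hsum using 1
    have e1 : ((g ⬝ᵥ v).toNat : ℤ) = g ⬝ᵥ v := Int.toNat_of_nonneg hv0.le
    have e2 : ((p ⬝ᵥ v).toNat : ℤ) = p ⬝ᵥ v := Int.toNat_of_nonneg (hp v hv)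
    ext i
    simp only [Pi.smul_apply, Pi.add_apply, Pi.neg_apply, smul_eq_mul]
    simp only [nsmul_eq_mul, Nat.cast_mul, e1, e2]
    ring

/-- A real solution of a rational system of linear equations is a combination of rational ones. -/
lemma dotProduct_eq_zero_of_forall_int {d : ℕ} (Z : Set (Fin d → ℤ)) (v : Fin d → ℤ)
    (h : ∀ y : Fin d → ℤ, (∀ z ∈ Z, y ⬝ᵥ z = 0) → y ⬝ᵥ v = 0) {y : Fin d → ℝ}
    (hy : ∀ z ∈ Z, y ⬝ᵥ latticePt z = 0) : y ⬝ᵥ latticePt v = 0 := by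
  let q : (Fin d → ℤ) → (Fin d → ℚ) := fun w i => w i
  -- If `v` were outside the rational span of `Z`, a rational functional would separate it. Cleared
  -- of denominators, that functional contradicts `h`.
  have hmem : q v ∈ Submodule.span ℚ (q '' Z) := by
    by_contra hv
    obtain ⟨f, hf, hle⟩ := Submodule.exists_le_ker_of_notMem hv
    let c : Fin d → ℚ := fun i => f (Pi.single i 1)
    have hfc : ∀ x, f x = ∑ i, c i * x i := by
      intro x
      conv_lhs => rw [← Finset.univ_sum_single x]
      rw [map_sum]
      refine Finset.sum_congr rfl fun i _ => ?_
      have : (Pi.single i (x i) : Fin d → ℚ) = x i • Pi.single i 1 := by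
        rw [← Pi.single_smul, smul_eq_mul, mul_one]
      rw [this, map_smul, smul_eq_mul, mul_comm]
    obtain ⟨D, hD⟩ := IsLocalization.exist_integer_multiples_of_finset (nonZeroDivisors ℤ)
      (Finset.univ.image c)
    have hD' : ∀ i, ∃ z : ℤ, (z : ℚ) = ((D : ℤ) : ℚ) * c i := by
      intro i
      obtain ⟨z, hz⟩ := hD (c i) (Finset.mem_image_of_mem _ (Finset.mem_univ i))
      exact ⟨z, by simpa using hz⟩
    choose y' hy' using hD'
    have key : ∀ w, ((y' ⬝ᵥ w : ℤ) : ℚ) = ((D : ℤ) : ℚ) * f (q w) := by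
      intro w
      simp only [dotProduct, Int.cast_sum, Int.cast_mul, hy', hfc, Finset.mul_sum, q, mul_assoc]
    have hD0 : ((D : ℤ) : ℚ) ≠ 0 := by exact_mod_cast nonZeroDivisors.ne_zero D.2
    have h1 := h y' fun z hz => by
      have := key z
      rw [show f (q z) = 0 from hle (Submodule.subset_span ⟨z, hz, rfl⟩), mul_zero] at this
      exact_mod_cast this
    have := key v
    rw [h1, Int.cast_zero] at this
    exact hf ((mul_eq_zero.1 this.symm).resolve_left hD0)
  have : ∀ x ∈ Submodule.span ℚ (q '' Z), ∑ i, y i * (x i : ℝ) = 0 := by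
    intro x hx
    refine Submodule.span_induction (p := fun x _ => ∑ i, y i * (x i : ℝ) = 0) ?_ (by simp)
      ?_ ?_ hx
    · rintro _ ⟨z, hz, rfl⟩
      simpa [q, dotProduct, latticePt] using hy z hz
    · intro a b _ _ ha hb
      simp only [Pi.add_apply, Rat.cast_add, mul_add, Finset.sum_add_distrib, ha, hb, add_zero]
    · intro a b _ hb
      simp only [Pi.smul_apply, smul_eq_mul, Rat.cast_mul]
      rw [show ∑ i, y i * ((a : ℝ) * (b i : ℝ)) = a * ∑ i, y i * (b i : ℝ) by
        rw [Finset.mul_sum]; exact Finset.sum_congr rfl fun i _ => by ring, hb, mul_zero]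
  simpa [q, dotProduct, latticePt] using this _ hmem

/-! ### Faces and rays -/

/-- The points of `σ` at which the lattice functional `u` vanishes. -/
def zeroFace {d : ℕ} (σ : Cone d) (u : Fin d → ℤ) : Cone d where
  carrier := {x | x ∈ σ ∧ latticePt u ⬝ᵥ x = 0}
  add_mem' := fun {x y} hx hy =>
    ⟨σ.add_mem hx.1 hy.1, by rw [dotProduct_add, hx.2, hy.2, add_zero]⟩
  zero_mem' := ⟨σ.zero_mem, by simp⟩
  smul_mem' := fun c x hx => ⟨σ.smul_mem c.2 hx.1, by
    change latticePt u ⬝ᵥ ((c : ℝ) • x) = 0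
    rw [dotProduct_smul, hx.2, smul_zero]⟩

lemma mem_zeroFace {d : ℕ} {σ : Cone d} {u : Fin d → ℤ} {x : Fin d → ℝ} :
    x ∈ zeroFace σ u ↔ x ∈ σ ∧ latticePt u ⬝ᵥ x = 0 := Iff.rfl

lemma zeroFace_le {d : ℕ} (σ : Cone d) (u : Fin d → ℤ) : zeroFace σ u ≤ σ := fun _ hx => hx.1

lemma isFace_zeroFace {d : ℕ} {σ : Cone d} {u : Fin d → ℤ} (hu : u ∈ charMonoid σ) :
    IsFace (zeroFace σ u) σ := ⟨u, hu, fun _ => Iff.rfl⟩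

lemma IsFace.exists_eq_zeroFace {d : ℕ} {τ σ : Cone d} (h : IsFace τ σ) :
    ∃ u ∈ charMonoid σ, τ = zeroFace σ u := by
  obtain ⟨u, hu, h⟩ := h
  exact ⟨u, hu, SetLike.ext h⟩

lemma IsFace.le {d : ℕ} {τ σ : Cone d} (h : IsFace τ σ) : τ ≤ σ := by
  obtain ⟨u, -, h⟩ := h
  exact fun x hx => ((h x).1 hx).1

lemma Fan.isFace_of_le {d : ℕ} (Δ : Fan d) {τ σ : Cone d} (hτ : τ ∈ Δ.cones) (hσ : σ ∈ Δ.cones)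
    (h : τ ≤ σ) : IsFace τ σ := by
  have := (Δ.inter_isFace σ hσ τ hτ).1
  rwa [inf_eq_right.2 h] at this

lemma Fan.inf_mem {d : ℕ} (Δ : Fan d) {τ σ : Cone d} (hτ : τ ∈ Δ.cones) (hσ : σ ∈ Δ.cones) :
    τ ⊓ σ ∈ Δ.cones := Δ.face_mem _ hτ _ (Δ.inter_isFace _ hτ _ hσ).1

lemma Fan.zeroFace_mem {d : ℕ} (Δ : Fan d) {σ : Cone d} (hσ : σ ∈ Δ.cones) {u : Fin d → ℤ}
    (hu : u ∈ charMonoid σ) : zeroFace σ u ∈ Δ.cones := Δ.face_mem _ hσ _ (isFace_zeroFace hu)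

/-- Since `g` vanishes at every generator where `p` does, some multiple of `p` dominates both `g`
and `-g` on all generators, hence on the cone. Where `p` vanishes, this forces `g` to vanish. -/
lemma IsRational.zeroFace_le_zeroFace {d : ℕ} {s : Finset (Fin d → ℤ)} {p g : Fin d → ℤ}
    (hp : ∀ v ∈ s, 0 ≤ p ⬝ᵥ v) (hpg : ∀ v ∈ s, p ⬝ᵥ v = 0 → g ⬝ᵥ v = 0) {x : Fin d → ℝ}
    (hx : x ∈ PointedCone.hull ℝ (latticePt '' (s : Set (Fin d → ℤ))))
    (hpx : latticePt p ⬝ᵥ x = 0) : latticePt g ⬝ᵥ x = 0 := by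
  let N : ℤ := ∑ v ∈ s, |g ⬝ᵥ v|
  have hN : ∀ v ∈ s, |g ⬝ᵥ v| ≤ N * (p ⬝ᵥ v) := by
    intro v hv
    rcases (hp v hv).eq_or_lt with h | h
    · rw [hpg v hv h.symm, ← h]; simp
    · have h1 : |g ⬝ᵥ v| ≤ N :=
        Finset.single_le_sum (f := fun v => |g ⬝ᵥ v|) (fun _ _ => abs_nonneg _) hv
      nlinarith [abs_nonneg (g ⬝ᵥ v)]
  have key : ∀ g' : Fin d → ℤ, (∀ v ∈ s, |g' ⬝ᵥ v| ≤ N * (p ⬝ᵥ v)) →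
      0 ≤ latticePt g' ⬝ᵥ x := by
    intro g' hg'
    have := (mem_charMonoid_hull (u := N • p + g')).2 (fun v hv => by
      rw [add_dotProduct, smul_dotProduct, smul_eq_mul]
      have := neg_abs_le (g' ⬝ᵥ v)
      have := hg' v hv
      linarith) x hx
    rwa [latticePt_add, latticePt_zsmul, add_dotProduct, smul_dotProduct, hpx, smul_zero,
      zero_add] at this
  refine le_antisymm ?_ (key g hN)
  have := key (-g) fun v hv => by rw [neg_dotProduct, abs_neg]; exact hN v hv
  rw [latticePt_neg, neg_dotProduct] at this
  linarith

lemma mem_rayCone {d : ℕ} {v : Fin d → ℤ} {x : Fin d → ℝ} :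
    x ∈ rayCone v ↔ ∃ c : ℝ, 0 ≤ c ∧ x = c • latticePt v := by
  rw [rayCone, PointedCone.hull, Submodule.mem_span_singleton]
  constructor
  · rintro ⟨a, rfl⟩; exact ⟨a, a.2, rfl⟩
  · rintro ⟨c, hc, rfl⟩; exact ⟨⟨c, hc⟩, rfl⟩

lemma latticePt_mem_rayCone {d : ℕ} (v : Fin d → ℤ) : latticePt v ∈ rayCone v :=
  mem_rayCone.2 ⟨1, zero_le_one, (one_smul _ _).symm⟩

lemma rayCone_le {d : ℕ} {v : Fin d → ℤ} {σ : Cone d} (h : latticePt v ∈ σ) : rayCone v ≤ σ := by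
  intro x hx
  obtain ⟨c, hc, rfl⟩ := mem_rayCone.1 hx
  exact smul_mem_cone σ hc h

lemma mem_rayCone_sup {d : ℕ} {v : Fin d → ℤ} {τ : Cone d} {x : Fin d → ℝ} :
    x ∈ rayCone v ⊔ τ ↔ ∃ c : ℝ, 0 ≤ c ∧ ∃ t ∈ τ, x = c • latticePt v + t := by
  rw [Submodule.mem_sup]
  constructor
  · rintro ⟨y, hy, t, ht, rfl⟩
    obtain ⟨c, hc, rfl⟩ := mem_rayCone.1 hy
    exact ⟨c, hc, t, ht, rfl⟩
  · rintro ⟨c, hc, t, ht, rfl⟩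
    exact ⟨_, mem_rayCone.2 ⟨c, hc, rfl⟩, t, ht, rfl⟩

lemma mem_charMonoid_rayCone {d : ℕ} {u v : Fin d → ℤ} :
    u ∈ charMonoid (rayCone v) ↔ 0 ≤ u ⬝ᵥ v := by
  constructor
  · intro h
    have := h _ (latticePt_mem_rayCone v)
    rw [latticePt_dotProduct] at this
    exact_mod_cast this
  · intro h x hx
    obtain ⟨c, hc, rfl⟩ := mem_rayCone.1 hx
    rw [dotProduct_smul, latticePt_dotProduct]
    exact smul_nonneg hc (by exact_mod_cast h)

lemma dotProduct_nonneg_of_mem {d : ℕ} {σ : Cone d} {u v : Fin d → ℤ} (hu : u ∈ charMonoid σ)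
    (hv : latticePt v ∈ σ) : 0 ≤ u ⬝ᵥ v := by
  have := hu _ hv
  rw [latticePt_dotProduct] at this
  exact_mod_cast this

lemma mem_charMonoid_rayCone_sup {d : ℕ} {u v : Fin d → ℤ} {τ : Cone d} :
    u ∈ charMonoid (rayCone v ⊔ τ) ↔ 0 ≤ u ⬝ᵥ v ∧ u ∈ charMonoid τ := by
  constructor
  · intro h
    exact ⟨mem_charMonoid_rayCone.1 (charMonoid_anti le_sup_left h),
      charMonoid_anti le_sup_right h⟩
  · rintro ⟨h1, h2⟩ x hx
    obtain ⟨c, hc, t, ht, rfl⟩ := mem_rayCone_sup.1 hx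
    rw [dotProduct_add, dotProduct_smul, latticePt_dotProduct]
    exact add_nonneg (smul_nonneg hc (by exact_mod_cast h1)) (h2 t ht)

/-! ### Primitive vectors and generation of cones by their rays -/

lemma IsPrimitive.ne_zero {d : ℕ} {v : Fin d → ℤ} (hv : IsPrimitive v) : v ≠ 0 := by
  rintro rfl
  simpa using hv 0 0 (by simp)

lemma exists_primitive {d : ℕ} {g : Fin d → ℤ} (hg : g ≠ 0) :
    ∃ (n : ℤ) (w : Fin d → ℤ), 0 < n ∧ IsPrimitive w ∧ g = n • w := by
  obtain ⟨i, hi⟩ := Function.ne_iff.1 hg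
  have hne : (Finset.univ : Finset (Fin d)).Nonempty := ⟨i, Finset.mem_univ i⟩
  obtain ⟨w, hw, hw1⟩ := Finset.extract_gcd g hne
  have hn0 : Finset.univ.gcd g ≠ 0 := fun h =>
    hi (Finset.gcd_eq_zero_iff.1 h i (Finset.mem_univ i))
  refine ⟨Finset.univ.gcd g, w, ?_, ?_, funext fun j => hw j (Finset.mem_univ j)⟩
  · refine lt_of_le_of_ne ?_ hn0.symm
    exact Int.nonneg_of_normalize_eq_self Finset.normalize_gcd
  · rintro m w' rfl
    refine isUnit_of_dvd_one ?_
    rw [← hw1]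
    exact Finset.dvd_gcd fun j _ => ⟨w' j, rfl⟩

/-- The ideal of `ℤ` generated by the coordinates is principal. Its generator divides `v`, so it is
a unit, and a Bézout relation is the desired functional. -/
lemma IsPrimitive.exists_dotProduct_eq_one {d : ℕ} {v : Fin d → ℤ} (hv : IsPrimitive v) :
    ∃ u : Fin d → ℤ, u ⬝ᵥ v = 1 := by
  let I : Ideal ℤ := Ideal.span (Set.range v)
  obtain ⟨n, hn⟩ := (IsPrincipalIdealRing.principal I).principal
  have hmem : ∀ i, n ∣ v i := fun i => by
    have : v i ∈ I := Ideal.subset_span ⟨i, rfl⟩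
    rw [hn] at this
    exact Ideal.mem_span_singleton.1 this
  choose w hw using hmem
  have hu : IsUnit n := hv n w (funext hw)
  have h1 : (1 : ℤ) ∈ I := by
    rw [hn]; exact Ideal.mem_span_singleton.2 hu.dvd
  rw [Ideal.mem_span_range_iff_exists_fun] at h1
  obtain ⟨c, hc⟩ := h1
  exact ⟨c, hc⟩

lemma IsPrimitive.eq_of_mem_rayCone {d : ℕ} {v w : Fin d → ℤ} (hv : IsPrimitive v)
    (hw : IsPrimitive w) (h : latticePt w ∈ rayCone v) : w = v := by
  obtain ⟨c, hc, hwc⟩ := mem_rayCone.1 h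
  obtain ⟨u, hu⟩ := hv.exists_dotProduct_eq_one
  have hc' : ((u ⬝ᵥ w : ℤ) : ℝ) = c := by
    rw [← latticePt_dotProduct, hwc, dotProduct_smul, latticePt_dotProduct, hu]; simp
  have hwv : w = (u ⬝ᵥ w) • v := latticePt_injective (by rw [latticePt_zsmul, hc', hwc])
  have h1 := hw _ _ hwv
  have h0 : 0 ≤ u ⬝ᵥ w := by exact_mod_cast hc'.symm ▸ hc
  rcases Int.isUnit_iff.1 h1 with h | h
  · rw [h, one_smul] at hwv; exact hwv
  · omega

/-- An element of `S_σ` that is positive away from the origin. -/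
lemma IsRational.exists_interior {d : ℕ} {σ : Cone d} (hσ : IsRational σ) (hσ' : σ.lineal = ⊥) :
    ∃ b ∈ charMonoid σ, zeroFace σ b = ⊥ := by
  obtain ⟨A, hA, hA'⟩ := hσ.exists_halfspaces
  refine ⟨∑ a ∈ A, a, sum_mem hA, ?_⟩
  rw [eq_bot_iff]
  rintro x ⟨hx, hx0⟩
  rw [latticePt_sum, sum_dotProduct, Finset.sum_eq_zero_iff_of_nonneg fun a ha => hA a ha x hx]
    at hx0
  have : x ∈ σ.lineal := ⟨hx, (hA' _).2 fun a ha => by simp [hx0 a ha]⟩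
  rw [hσ'] at this
  exact this

lemma Fan.bot_mem {d : ℕ} (Δ : Fan d) {σ : Cone d} (hσ : σ ∈ Δ.cones) : (⊥ : Cone d) ∈ Δ.cones := by
  obtain ⟨b, hb, h⟩ := (Δ.rational σ hσ).exists_interior (Δ.stronglyConvex σ hσ)
  rw [← h]; exact Δ.zeroFace_mem hσ hb

/-- Every lattice point of a strongly convex cone other than `0` can be moved to a ray. -/
lemma IsRational.exists_ray {d : ℕ} {σ : Cone d} (hσ : IsRational σ) (hσ' : σ.lineal = ⊥)
    (A : Finset (Fin d → ℤ)) (hA : ∀ a ∈ A, a ∈ charMonoid σ)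
    (hA' : ∀ x, x ∈ σ ↔ ∀ a ∈ A, 0 ≤ latticePt a ⬝ᵥ x)
    {p : Fin d → ℤ} (hp : latticePt p ∈ σ) (hp0 : p ≠ 0) :
    ∃ w : Fin d → ℤ, IsPrimitive w ∧ latticePt w ∈ σ ∧ IsFace (rayCone w) σ ∧
      ∀ a ∈ A, p ⬝ᵥ a = 0 → w ⬝ᵥ a = 0 := by
  classical
  have hint : ∀ w : Fin d → ℤ, latticePt w ∈ σ ↔ ∀ a ∈ A, 0 ≤ w ⬝ᵥ a := by
    intro w
    simp only [hA', latticePt_dotProduct, Int.cast_nonneg_iff, dotProduct_comm w]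
  obtain ⟨b, hb, hb'⟩ := hσ.exists_interior hσ'
  have hpos : ∀ w : Fin d → ℤ, latticePt w ∈ σ → w ≠ 0 → 0 < w ⬝ᵥ b := by
    intro w hw hw0
    rw [dotProduct_comm]
    refine lt_of_le_of_ne (dotProduct_nonneg_of_mem hb hw) fun h => hw0 ?_
    have : latticePt w ∈ zeroFace σ b := ⟨hw, by rw [latticePt_dotProduct, ← h, Int.cast_zero]⟩
    rw [hb'] at this
    exact latticePt_injective (by rw [latticePt_zero]; exact this)
  obtain ⟨g, hg, hgb, hpg, hmax⟩ := exists_edge_point A b ((hint p).1 hp) (hpos p hp hp0)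
  have hg0 : g ≠ 0 := by rintro rfl; simp at hgb
  obtain ⟨n, w, hn, hw, rfl⟩ := exists_primitive hg0
  have hnw : ∀ a, (n • w) ⬝ᵥ a = n * (w ⬝ᵥ a) := fun a => by rw [smul_dotProduct, smul_eq_mul]
  have hwσ : latticePt w ∈ σ := (hint w).2 fun a ha => by
    have := hg a ha
    rw [hnw] at this
    exact nonneg_of_mul_nonneg_right this hn
  -- The sum of the defining functionals that vanish at `w` cuts out the smallest face containing
  -- `w`. Extremality of `g` makes this face a ray.
  refine ⟨w, hw, hwσ, ⟨∑ a ∈ A.filter (fun a => w ⬝ᵥ a = 0), a, ?_, fun x => ?_⟩, fun a ha h => ?_⟩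
  · exact sum_mem fun a ha => hA a (Finset.mem_filter.1 ha).1
  · constructor
    · intro hx
      refine ⟨rayCone_le hwσ hx, ?_⟩
      obtain ⟨c, hc, rfl⟩ := mem_rayCone.1 hx
      rw [latticePt_sum, sum_dotProduct]
      refine Finset.sum_eq_zero fun a ha => ?_
      rw [dotProduct_smul, latticePt_dotProduct, dotProduct_comm a, (Finset.mem_filter.1 ha).2]
      simp
    · rintro ⟨hx, hx0⟩
      rw [latticePt_sum, sum_dotProduct, Finset.sum_eq_zero_iff_of_nonneg
        fun a ha => hA a (Finset.mem_filter.1 ha).1 x hx] at hx0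
      have hwb := hpos w hwσ hw.ne_zero
      have hwb' : (0 : ℝ) < ((w ⬝ᵥ b : ℤ) : ℝ) := by exact_mod_cast hwb
      -- The coefficient is forced by evaluating the interior functional `b`. With it, `x - c • w`
      -- is killed by all of `A`, hence lies in the lineality space, which is zero.
      refine mem_rayCone.2 ⟨(latticePt b ⬝ᵥ x) / ((w ⬝ᵥ b : ℤ) : ℝ),
        div_nonneg (hb x hx) hwb'.le, ?_⟩
      set c := (latticePt b ⬝ᵥ x) / ((w ⬝ᵥ b : ℤ) : ℝ) with hcdef
      have key : ∀ a ∈ A, (x - c • latticePt w) ⬝ᵥ latticePt a = 0 := by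
        intro a ha
        refine dotProduct_eq_zero_of_forall_int
          (insert b {a | a ∈ A ∧ w ⬝ᵥ a = 0}) a (fun y hy => ?_) ?_
        · refine hmax y (fun z hz h => hy z (Or.inr ⟨hz, ?_⟩)) (hy b (Or.inl rfl)) a ha
          rw [hnw] at h
          exact (mul_eq_zero.1 h).resolve_left hn.ne'
        · rintro z (rfl | ⟨hz, hz0⟩)
          · rw [sub_dotProduct, smul_dotProduct, latticePt_dotProduct, dotProduct_comm, smul_eq_mul,
              hcdef, div_mul_cancel₀ _ hwb'.ne', sub_self]
          · rw [sub_dotProduct, smul_dotProduct, latticePt_dotProduct, hz0, dotProduct_comm,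
              hx0 z (Finset.mem_filter.2 ⟨hz, hz0⟩)]
            simp
      have hl : x - c • latticePt w ∈ σ.lineal :=
        ⟨(hA' _).2 fun a ha => by rw [dotProduct_comm, key a ha],
          (hA' _).2 fun a ha => by rw [dotProduct_comm, neg_dotProduct, key a ha, neg_zero]⟩
      rw [hσ'] at hl
      exact sub_eq_zero.1 hl
  · have := hpg a ha h
    rw [hnw] at this
    exact (mul_eq_zero.1 this).resolve_left hn.ne'

lemma Fan.isFace_rayCone {d : ℕ} (Δ : Fan d) {v : Fin d → ℤ} (hv : v ∈ Δ.rays) {σ : Cone d}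
    (hσ : σ ∈ Δ.cones) (h : latticePt v ∈ σ) : IsFace (rayCone v) σ :=
  Δ.isFace_of_le hv.2 hσ (rayCone_le h)

/-- The rays of the cone `σ` of a fan. -/
def Fan.raysOf {d : ℕ} (Δ : Fan d) (σ : Cone d) : Set (Fin d → ℤ) :=
  {w | w ∈ Δ.rays ∧ latticePt w ∈ σ}

/-- The cones of a fan are generated by their rays. -/
lemma Fan.hull_raysOf {d : ℕ} (Δ : Fan d) {σ : Cone d} (hσ : σ ∈ Δ.cones) :
    PointedCone.hull ℝ (latticePt '' Δ.raysOf σ) = σ := by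
  have hr := Δ.rational σ hσ
  obtain ⟨A, hA, hA'⟩ := hr.exists_halfspaces
  have hint : ∀ w : Fin d → ℤ, latticePt w ∈ σ ↔ ∀ a ∈ A, 0 ≤ w ⬝ᵥ a := by
    intro w
    simp only [hA', latticePt_dotProduct, Int.cast_nonneg_iff, dotProduct_comm w]
  obtain ⟨b, hb, hb'⟩ := hr.exists_interior (Δ.stronglyConvex σ hσ)
  have hzero : ∀ w : Fin d → ℤ, latticePt w ∈ σ → w ⬝ᵥ b = 0 → w = 0 := by
    intro w hw h
    have : latticePt w ∈ zeroFace σ b :=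
      ⟨hw, by rw [latticePt_dotProduct, dotProduct_comm, h, Int.cast_zero]⟩
    rw [hb'] at this
    exact latticePt_injective (by rw [latticePt_zero]; exact this)
  have hnn : ∀ w : Fin d → ℤ, latticePt w ∈ σ → 0 ≤ w ⬝ᵥ b := fun w hw => by
    rw [dotProduct_comm]; exact dotProduct_nonneg_of_mem hb hw
  refine le_antisymm (Submodule.span_le.2 ?_) ?_
  · rintro _ ⟨w, hw, rfl⟩; exact hw.2
  · obtain ⟨s, hs⟩ := hr
    conv_lhs => rw [← hs]
    refine Submodule.span_le.2 ?_
    rintro _ ⟨v, hv, rfl⟩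
    have hvσ : latticePt v ∈ σ := hs ▸ PointedCone.subset_hull ⟨v, hv, rfl⟩
    -- Some positive multiple of the generator `v` is a sum of primitive ray generators: every
    -- nonzero lattice point of `σ` can be moved to a ray, and `b` vanishes only at the origin.
    obtain ⟨N, hN, hmem⟩ := exists_nsmul_mem A b (fun p hp => hnn p ((hint p).2 hp))
      (AddSubmonoid.closure (Δ.raysOf σ))
      (fun r hr hr0 => by rw [hzero r ((hint r).2 hr) hr0]; exact zero_mem _)
      (fun p hp hpb => by
        obtain ⟨w, hw, hwσ, hwf, hpw⟩ := IsRational.exists_ray ⟨s, hs⟩ (Δ.stronglyConvex σ hσ)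
          A hA hA' ((hint p).2 hp) (by rintro rfl; simp at hpb)
        refine ⟨w, AddSubmonoid.subset_closure ⟨⟨hw, Δ.face_mem σ hσ _ hwf⟩, hwσ⟩,
          (hint w).1 hwσ, ?_, hpw⟩
        exact lt_of_le_of_ne (hnn w hwσ) fun h => hw.ne_zero (hzero w hwσ h.symm))
      ((hint v).1 hvσ)
    have hmem' : latticePt (N • v) ∈ PointedCone.hull ℝ (latticePt '' Δ.raysOf σ) := by
      refine AddSubmonoid.closure_induction
        (motive := fun x _ => latticePt x ∈ PointedCone.hull ℝ (latticePt '' Δ.raysOf σ))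
        ?_ ?_ ?_ hmem
      · exact fun x hx => PointedCone.subset_hull ⟨x, hx, rfl⟩
      · rw [latticePt_zero]; exact zero_mem _
      · intro x y _ _ hx hy
        rw [latticePt_add]; exact add_mem hx hy
    have hN' : (0 : ℝ) < N := by exact_mod_cast hN
    have := smul_mem_cone _ (inv_nonneg.2 hN'.le) hmem'
    rwa [latticePt_nsmul, smul_smul, inv_mul_cancel₀ hN'.ne', one_smul] at this

lemma Fan.rays_finite {d : ℕ} (Δ : Fan d) : Δ.rays.Finite := by
  refine Set.Finite.of_finite_image (f := rayCone) (Δ.finite.subset ?_) ?_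
  · rintro _ ⟨v, hv, rfl⟩; exact hv.2
  · intro v hv w hw h
    exact hw.1.eq_of_mem_rayCone hv.1 (h ▸ latticePt_mem_rayCone v)

/-- A cone other than `0` has a ray. -/
lemma Fan.exists_mem_raysOf {d : ℕ} (Δ : Fan d) {σ : Cone d} (hσ : σ ∈ Δ.cones) (h : σ ≠ ⊥) :
    ∃ w, w ∈ Δ.raysOf σ := by
  by_contra hcon
  push Not at hcon
  apply h
  rw [← Δ.hull_raysOf hσ, Set.eq_empty_of_forall_notMem hcon]
  simp

/-- An element of `S_σ` with value one on a primitive generator of a ray of `σ`. -/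
lemma Fan.exists_dotProduct_eq_one {d : ℕ} (Δ : Fan d) {σ : Cone d} (hσ : σ ∈ Δ.cones)
    {v : Fin d → ℤ} (hv : v ∈ Δ.raysOf σ) : ∃ u ∈ charMonoid σ, u ⬝ᵥ v = 1 := by
  obtain ⟨w, hw⟩ := hv.1.1.exists_dotProduct_eq_one
  obtain ⟨u, hu, hu'⟩ := Δ.isFace_rayCone hv.1 hσ hv.2
  obtain ⟨n, hn⟩ := exists_nsmul_add_mem (Δ.rational σ hσ) hu hu'
    (mem_charMonoid_rayCone.2 (hw.symm ▸ zero_le_one))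
  refine ⟨_, hn, ?_⟩
  have : ((u ⬝ᵥ v : ℤ) : ℝ) = 0 := by
    rw [← latticePt_dotProduct]; exact ((hu' _).1 (latticePt_mem_rayCone v)).2
  have : u ⬝ᵥ v = 0 := by exact_mod_cast this
  rw [add_dotProduct, smul_dotProduct, this, hw, smul_zero, add_zero]

/-- `S_σ` generates the lattice `M`. -/
lemma Fan.exists_sub_eq {d : ℕ} (Δ : Fan d) {σ : Cone d} (hσ : σ ∈ Δ.cones) (w : Fin d → ℤ) :
    ∃ s ∈ charMonoid σ, ∃ s' ∈ charMonoid σ, w = s - s' := by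
  obtain ⟨b, hb, hb'⟩ := (Δ.rational σ hσ).exists_interior (Δ.stronglyConvex σ hσ)
  obtain ⟨n, hn⟩ := exists_nsmul_add_mem (τ := ⊥) (Δ.rational σ hσ) hb
    (fun x => by rw [← hb']; exact Iff.rfl) (w := w) (fun x hx => by
      rw [show x = 0 from hx]; simp)
  exact ⟨_, hn, n • b, nsmul_mem hb n, by abel⟩

/-! ### Stellar subdivisions -/

lemma zero_lt_dotProduct_of_notMem {d : ℕ} {σ : Cone d} {u v : Fin d → ℤ} (hu : u ∈ charMonoid σ)
    (hv : latticePt v ∈ σ) (h : latticePt v ∉ zeroFace σ u) : 0 < u ⬝ᵥ v := by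
  refine lt_of_le_of_ne (dotProduct_nonneg_of_mem hu hv) fun h0 => h ⟨hv, ?_⟩
  rw [latticePt_dotProduct, ← h0, Int.cast_zero]

lemma Fan.exists_cut {d : ℕ} (Δ : Fan d) {τ σ : Cone d} (hτ : τ ∈ Δ.cones) (hσ : σ ∈ Δ.cones)
    (h : τ ≤ σ) {v : Fin d → ℤ} (hv : latticePt v ∈ σ) (hv' : latticePt v ∉ τ) :
    ∃ u ∈ charMonoid σ, τ = zeroFace σ u ∧ 0 < u ⬝ᵥ v := by
  obtain ⟨u, hu, rfl⟩ := (Δ.isFace_of_le hτ hσ h).exists_eq_zeroFace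
  exact ⟨u, hu, rfl, zero_lt_dotProduct_of_notMem hu hv hv'⟩

/-- The face `τ ⊓ σ` of `σ` misses `v`, so a functional cutting it out is positive at `v`. It must
vanish on the sum of two terms on which it is nonnegative. This is what keeps the joins with `v`
from overlapping. -/
lemma Fan.eq_zero_of_smul_add_mem {d : ℕ} (Δ : Fan d) {τ σ : Cone d} (hτ : τ ∈ Δ.cones)
    (hσ : σ ∈ Δ.cones) {v : Fin d → ℤ} (hv : latticePt v ∈ σ) (hv' : latticePt v ∉ τ)
    {c : ℝ} (hc : 0 ≤ c) {t : Fin d → ℝ} (ht : t ∈ σ) (h : c • latticePt v + t ∈ τ) : c = 0 := by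
  obtain ⟨u, hu, hF, huv⟩ := Δ.exists_cut (Δ.inf_mem hτ hσ) hσ inf_le_right hv fun h => hv' h.1
  have hx : c • latticePt v + t ∈ zeroFace σ u :=
    hF ▸ ⟨h, σ.add_mem (smul_mem_cone σ hc hv) ht⟩
  have h0 := hx.2
  rw [dotProduct_add, dotProduct_smul, latticePt_dotProduct, smul_eq_mul] at h0
  have h1 := hu t ht
  have h2 : (0 : ℝ) < ((u ⬝ᵥ v : ℤ) : ℝ) := by exact_mod_cast huv
  nlinarith

/-- Adding a large multiple of `u`, which vanishes on `τ`, to a functional cutting out `ρ` makes it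
positive at `v` without changing it on `τ`. -/
lemma isFace_rayCone_sup_of_isFace {d : ℕ} {ρ τ : Cone d} {v u : Fin d → ℤ}
    (hu : ∀ x ∈ τ, latticePt u ⬝ᵥ x = 0) (huv : 0 < u ⬝ᵥ v) (h : IsFace ρ τ) :
    IsFace ρ (rayCone v ⊔ τ) := by
  obtain ⟨w, hw, rfl⟩ := h.exists_eq_zeroFace
  have key : ∀ c : ℝ, ∀ t ∈ τ, latticePt (w + (|w ⬝ᵥ v| + 1) • u) ⬝ᵥ (c • latticePt v + t) =
      c * ((w ⬝ᵥ v + (|w ⬝ᵥ v| + 1) * (u ⬝ᵥ v) : ℤ) : ℝ) + latticePt w ⬝ᵥ t := by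
    intro c t ht
    rw [dotProduct_add, dotProduct_smul, latticePt_dotProduct, latticePt_add,
      add_dotProduct (latticePt w), latticePt_zsmul, smul_dotProduct _ (latticePt u), hu t ht,
      add_dotProduct, smul_dotProduct, smul_zero, add_zero, smul_eq_mul, smul_eq_mul]
  have hpos : 0 < w ⬝ᵥ v + (|w ⬝ᵥ v| + 1) * (u ⬝ᵥ v) := by
    have := neg_abs_le (w ⬝ᵥ v)
    nlinarith [abs_nonneg (w ⬝ᵥ v)]
  have hpos' : (0 : ℝ) < ((w ⬝ᵥ v + (|w ⬝ᵥ v| + 1) * (u ⬝ᵥ v) : ℤ) : ℝ) := by exact_mod_cast hpos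
  refine ⟨w + (|w ⬝ᵥ v| + 1) • u, ?_, fun x => ⟨fun hx => ⟨?_, ?_⟩, ?_⟩⟩
  · intro x hx
    obtain ⟨c, hc, t, ht, rfl⟩ := mem_rayCone_sup.1 hx
    rw [key c t ht]
    exact add_nonneg (mul_nonneg hc hpos'.le) (hw t ht)
  · exact le_sup_right (a := rayCone v) hx.1
  · have := key 0 x hx.1
    simpa [hx.2] using this
  · rintro ⟨hx, hx0⟩
    obtain ⟨c, hc, t, ht, rfl⟩ := mem_rayCone_sup.1 hx
    rw [key c t ht] at hx0
    have h1 := hw t ht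
    have h2 := mul_nonneg hc hpos'.le
    have hc0 : c = 0 := (mul_eq_zero.1 (by linarith)).resolve_right hpos'.ne'
    rw [hc0, zero_smul, zero_add]
    exact ⟨ht, by linarith⟩

/-- A functional cutting out `ρ` is corrected by `u` so as to vanish at `v`. On `τ` it is only
multiplied by the positive number `u ⬝ᵥ v`. -/
lemma isFace_rayCone_sup_rayCone_sup {d : ℕ} {ρ τ : Cone d} {v u : Fin d → ℤ}
    (hu : ∀ x ∈ τ, latticePt u ⬝ᵥ x = 0) (huv : 0 < u ⬝ᵥ v) (h : IsFace ρ τ) :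
    IsFace (rayCone v ⊔ ρ) (rayCone v ⊔ τ) := by
  obtain ⟨w, hw, rfl⟩ := h.exists_eq_zeroFace
  have key : ∀ c : ℝ, ∀ t ∈ τ, latticePt ((u ⬝ᵥ v) • w + (-(w ⬝ᵥ v)) • u) ⬝ᵥ
      (c • latticePt v + t) = ((u ⬝ᵥ v : ℤ) : ℝ) * (latticePt w ⬝ᵥ t) := by
    intro c t ht
    have e : ((u ⬝ᵥ v) • w + (-(w ⬝ᵥ v)) • u) ⬝ᵥ v = 0 := by
      simp only [add_dotProduct, smul_dotProduct, smul_eq_mul]; ring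
    rw [dotProduct_add, dotProduct_smul, latticePt_dotProduct, e, latticePt_add, add_dotProduct,
      latticePt_zsmul, latticePt_zsmul, smul_dotProduct, smul_dotProduct, hu t ht]
    simp
  have huv' : (0 : ℝ) < ((u ⬝ᵥ v : ℤ) : ℝ) := by exact_mod_cast huv
  refine ⟨(u ⬝ᵥ v) • w + (-(w ⬝ᵥ v)) • u, ?_, fun x => ⟨fun hx => ⟨?_, ?_⟩, ?_⟩⟩
  · intro x hx
    obtain ⟨c, hc, t, ht, rfl⟩ := mem_rayCone_sup.1 hx
    rw [key c t ht]
    exact mul_nonneg huv'.le (hw t ht)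
  · exact sup_le_sup_left (zeroFace_le τ w) _ hx
  · obtain ⟨c, hc, t, ht, rfl⟩ := mem_rayCone_sup.1 hx
    rw [key c t ht.1, ht.2, mul_zero]
  · rintro ⟨hx, hx0⟩
    obtain ⟨c, hc, t, ht, rfl⟩ := mem_rayCone_sup.1 hx
    rw [key c t ht] at hx0
    exact mem_rayCone_sup.2 ⟨c, hc, t, ⟨ht, (mul_eq_zero.1 hx0).resolve_left huv'.ne'⟩, rfl⟩

lemma Fan.rayCone_sup_inf {d : ℕ} (Δ : Fan d) {τ₁ σ₁ τ₂ : Cone d} {v : Fin d → ℤ}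
    (hσ₁ : σ₁ ∈ Δ.cones) (hv₁ : latticePt v ∈ σ₁) (h₁ : τ₁ ≤ σ₁) (hτ₂ : τ₂ ∈ Δ.cones)
    (hv₂ : latticePt v ∉ τ₂) : (rayCone v ⊔ τ₁) ⊓ τ₂ = τ₁ ⊓ τ₂ := by
  refine le_antisymm ?_ (inf_le_inf_right _ le_sup_right)
  rintro x ⟨hx, hx₂⟩
  obtain ⟨c, hc, t, ht, rfl⟩ := mem_rayCone_sup.1 hx
  have hc0 := Δ.eq_zero_of_smul_add_mem hτ₂ hσ₁ hv₁ hv₂ hc (h₁ ht) hx₂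
  rw [hc0, zero_smul, zero_add] at hx₂ ⊢
  exact ⟨ht, hx₂⟩

/-- The coefficient of `v` in a common point is the same in both presentations: otherwise their
difference would exhibit a point of one `τᵢ` with a positive `v`-component, against
`Fan.eq_zero_of_smul_add_mem`. -/
lemma Fan.rayCone_sup_inf_rayCone_sup {d : ℕ} (Δ : Fan d) {τ₁ σ₁ τ₂ σ₂ : Cone d}
    {v : Fin d → ℤ} (hσ₁ : σ₁ ∈ Δ.cones) (hv₁ : latticePt v ∈ σ₁) (h₁ : τ₁ ≤ σ₁)
    (hτ₁ : τ₁ ∈ Δ.cones) (hτv₁ : latticePt v ∉ τ₁)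
    (hσ₂ : σ₂ ∈ Δ.cones) (hv₂ : latticePt v ∈ σ₂) (h₂ : τ₂ ≤ σ₂)
    (hτ₂ : τ₂ ∈ Δ.cones) (hτv₂ : latticePt v ∉ τ₂) :
    (rayCone v ⊔ τ₁) ⊓ (rayCone v ⊔ τ₂) = rayCone v ⊔ (τ₁ ⊓ τ₂) := by
  refine le_antisymm ?_ (le_inf (sup_le_sup_left inf_le_left _) (sup_le_sup_left inf_le_right _))
  rintro x ⟨hx₁, hx₂⟩
  obtain ⟨c₁, hc₁, t₁, ht₁, rfl⟩ := mem_rayCone_sup.1 hx₁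
  obtain ⟨c₂, hc₂, t₂, ht₂, he⟩ := mem_rayCone_sup.1 hx₂
  have hceq : c₁ = c₂ := by
    rcases le_total c₂ c₁ with h | h
    · have e : (c₁ - c₂) • latticePt v + t₁ = t₂ := by
        rw [sub_smul, sub_add_eq_add_sub, he, add_sub_cancel_left]
      exact sub_eq_zero.1 (Δ.eq_zero_of_smul_add_mem hτ₂ hσ₁ hv₁ hτv₂ (sub_nonneg.2 h) (h₁ ht₁)
        (e ▸ ht₂))
    · have e : (c₂ - c₁) • latticePt v + t₂ = t₁ := by
        rw [sub_smul, sub_add_eq_add_sub, ← he, add_sub_cancel_left]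
      exact (sub_eq_zero.1 (Δ.eq_zero_of_smul_add_mem hτ₁ hσ₂ hv₂ hτv₁ (sub_nonneg.2 h) (h₂ ht₂)
        (e ▸ ht₁))).symm
  subst hceq
  have ht : t₁ = t₂ := add_left_cancel he
  subst ht
  exact mem_rayCone_sup.2 ⟨c₁, hc₁, t₁, ⟨ht₁, ht₂⟩, rfl⟩

lemma Fan.exists_le_of_mem_stellar {d : ℕ} (Δ : Fan d) {v : Fin d → ℤ} {γ : Cone d}
    (h : γ ∈ Δ.stellar v) : ∃ σ ∈ Δ.cones, γ ≤ σ := by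
  rcases h with ⟨h, -⟩ | ⟨τ, -, -, ⟨σ, hσ, hv, hle⟩, rfl⟩
  · exact ⟨γ, h, le_rfl⟩
  · exact ⟨σ, hσ, sup_le (rayCone_le hv) hle⟩

lemma Fan.inf_isFace_of_mem_stellar {d : ℕ} (Δ : Fan d) {v : Fin d → ℤ} {γ₁ γ₂ : Cone d}
    (h₁ : γ₁ ∈ Δ.stellar v) (h₂ : γ₂ ∈ Δ.stellar v) : IsFace (γ₁ ⊓ γ₂) γ₁ := by
  rcases h₁ with ⟨h₁, hv₁⟩ | ⟨τ₁, hτ₁, hτv₁, ⟨σ₁, hσ₁, hv₁, hle₁⟩, rfl⟩ <;>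
  rcases h₂ with ⟨h₂, hv₂⟩ | ⟨τ₂, hτ₂, hτv₂, ⟨σ₂, hσ₂, hv₂, hle₂⟩, rfl⟩
  · exact (Δ.inter_isFace _ h₁ _ h₂).1
  · rw [inf_comm, Δ.rayCone_sup_inf hσ₂ hv₂ hle₂ h₁ hv₁, inf_comm]
    exact (Δ.inter_isFace _ h₁ _ hτ₂).1
  · obtain ⟨u, hu, hF, huv⟩ := Δ.exists_cut hτ₁ hσ₁ hle₁ hv₁ hτv₁
    rw [Δ.rayCone_sup_inf hσ₁ hv₁ hle₁ h₂ hv₂]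
    exact isFace_rayCone_sup_of_isFace (fun x hx => (hF ▸ hx : x ∈ zeroFace σ₁ u).2) huv
      (Δ.inter_isFace _ hτ₁ _ h₂).1
  · obtain ⟨u, hu, hF, huv⟩ := Δ.exists_cut hτ₁ hσ₁ hle₁ hv₁ hτv₁
    rw [Δ.rayCone_sup_inf_rayCone_sup hσ₁ hv₁ hle₁ hτ₁ hτv₁ hσ₂ hv₂ hle₂ hτ₂ hτv₂]
    exact isFace_rayCone_sup_rayCone_sup (fun x hx => (hF ▸ hx : x ∈ zeroFace σ₁ u).2) huv
      (Δ.inter_isFace _ hτ₁ _ hτ₂).1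

/-- The stellar subdivision of a fan along a half-line. -/
def Fan.stellarFan {d : ℕ} (Δ : Fan d) (v : Fin d → ℤ) : Fan d where
  cones := Δ.stellar v
  finite := by
    refine (Δ.finite.subset fun _ h => h.1).union ((Δ.finite.image (rayCone v ⊔ ·)).subset ?_)
    rintro _ ⟨τ, hτ, -, -, rfl⟩
    exact ⟨τ, hτ, rfl⟩
  rational := by
    classical
    rintro _ (⟨h, -⟩ | ⟨τ, hτ, -, -, rfl⟩)
    · exact Δ.rational _ h
    · obtain ⟨s, rfl⟩ := Δ.rational τ hτ
      refine ⟨insert v s, ?_⟩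
      rw [Finset.coe_insert, Set.image_insert_eq, rayCone, PointedCone.hull, PointedCone.hull,
        PointedCone.hull, Submodule.span_insert]
  stronglyConvex := by
    intro γ h
    obtain ⟨σ, hσ, hle⟩ := Δ.exists_le_of_mem_stellar h
    rw [eq_bot_iff, ← Δ.stronglyConvex σ hσ]
    exact fun x hx => ⟨hle hx.1, hle hx.2⟩
  face_mem := by
    rintro _ (⟨h, hv⟩ | ⟨τ, hτ, hτv, ⟨σ, hσ, hv, hle⟩, rfl⟩) ρ hρ
    · exact Or.inl ⟨Δ.face_mem _ h _ hρ, fun h => hv (hρ.le h)⟩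
    · obtain ⟨u, hu, rfl⟩ := hρ.exists_eq_zeroFace
      obtain ⟨huv, huτ⟩ := mem_charMonoid_rayCone_sup.1 hu
      -- A functional that vanishes at `v` cuts out the join of `v` with a face of `τ`; one that is
      -- positive at `v` cuts out a face of `τ` alone.
      rcases huv.eq_or_lt with h0 | h0
      · refine Or.inr ⟨zeroFace τ u, Δ.zeroFace_mem hτ huτ, fun h => hτv h.1,
          ⟨σ, hσ, hv, (zeroFace_le _ _).trans hle⟩, ?_⟩
        refine le_antisymm ?_ ?_
        · rintro x ⟨hx, hx0⟩
          obtain ⟨c, hc, t, ht, rfl⟩ := mem_rayCone_sup.1 hx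
          rw [dotProduct_add, dotProduct_smul, latticePt_dotProduct, ← h0, Int.cast_zero,
            smul_zero, zero_add] at hx0
          exact mem_rayCone_sup.2 ⟨c, hc, t, ⟨ht, hx0⟩, rfl⟩
        · intro x hx
          obtain ⟨c, hc, t, ht, rfl⟩ := mem_rayCone_sup.1 hx
          refine ⟨mem_rayCone_sup.2 ⟨c, hc, t, ht.1, rfl⟩, ?_⟩
          rw [dotProduct_add, dotProduct_smul, latticePt_dotProduct, ← h0, ht.2]
          simp
      · refine Or.inl ?_
        have : zeroFace (rayCone v ⊔ τ) u = zeroFace τ u := by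
          refine le_antisymm ?_ fun x hx => ⟨le_sup_right (a := rayCone v) hx.1, hx.2⟩
          rintro x ⟨hx, hx0⟩
          obtain ⟨c, hc, t, ht, rfl⟩ := mem_rayCone_sup.1 hx
          rw [dotProduct_add, dotProduct_smul, latticePt_dotProduct, smul_eq_mul] at hx0
          have h0' : (0 : ℝ) < ((u ⬝ᵥ v : ℤ) : ℝ) := by exact_mod_cast h0
          have h1 := huτ t ht
          have h2 := mul_nonneg hc h0'.le
          have hc0 : c = 0 := (mul_eq_zero.1 (by linarith)).resolve_right h0'.ne'
          rw [hc0, zero_smul, zero_add]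
          exact ⟨ht, by linarith⟩
        rw [this]
        exact ⟨Δ.zeroFace_mem hτ huτ, fun h => hτv h.1⟩
  inter_isFace := by
    intro γ₁ h₁ γ₂ h₂
    refine ⟨Δ.inf_isFace_of_mem_stellar h₁ h₂, ?_⟩
    rw [inf_comm]
    exact Δ.inf_isFace_of_mem_stellar h₂ h₁

lemma Fan.mem_of_mem_stellar {d : ℕ} {Δ : Fan d} {v : Fin d → ℤ} {γ : Cone d}
    (h : γ ∈ Δ.stellar v) (hv : latticePt v ∉ γ) : γ ∈ Δ.cones := by
  rcases h with ⟨h, -⟩ | ⟨τ, -, -, -, rfl⟩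
  · exact h
  · exact absurd (le_sup_left (a := rayCone v) (latticePt_mem_rayCone v)) hv

/-- Subdivision is idempotent: every cone of the subdivision through `v` is already a join of `v`
with a cone missing `v`. Through `Fan.stellar_eq_iff` this makes `v` split in the new fan. -/
lemma Fan.stellarFan_stellar {d : ℕ} (Δ : Fan d) (v : Fin d → ℤ) :
    (Δ.stellarFan v).stellar v = (Δ.stellarFan v).cones := by
  ext γ
  constructor
  · rintro (⟨h, -⟩ | ⟨τ, hτ, hτv, ⟨σ', hσ', hv, hle⟩, rfl⟩)
    · exact h
    · obtain ⟨σ, hσ, hle'⟩ := Δ.exists_le_of_mem_stellar hσ'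
      exact Or.inr ⟨τ, mem_of_mem_stellar hτ hτv, hτv, ⟨σ, hσ, hle' hv, hle.trans hle'⟩, rfl⟩
  · intro h
    by_cases hv : latticePt v ∈ γ
    · rcases (id h : γ ∈ Δ.stellar v) with ⟨-, h'⟩ | ⟨τ, hτ, hτv, hσ, rfl⟩
      · exact absurd hv h'
      · exact Or.inr ⟨τ, Or.inl ⟨hτ, hτv⟩, hτv, ⟨_, h, hv, le_sup_right⟩, rfl⟩
    · exact Or.inl ⟨h, hv⟩

lemma Fan.rays_eq_of_stellar {d : ℕ} {Δ Δ' : Fan d} {v : Fin d → ℤ} (hv : v ∈ Δ.rays)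
    (h : Δ'.cones = Δ.stellar v) : Δ'.rays = Δ.rays := by
  ext w
  simp only [Fan.rays, Set.mem_ofPred_eq, h]
  refine and_congr_right fun hw => ⟨?_, fun hwΔ => ?_⟩
  · rintro (⟨h, -⟩ | ⟨τ, hτ, -, -, he⟩)
    · exact h
    · have : latticePt v ∈ rayCone w := he ▸ le_sup_left (a := rayCone v) (latticePt_mem_rayCone v)
      rw [← hw.eq_of_mem_rayCone hv.1 this]
      exact hv.2
  · by_cases hvw : latticePt v ∈ rayCone w
    -- The ray of `v` itself reappears as the join of `v` with the zero cone.
    · obtain rfl := hw.eq_of_mem_rayCone hv.1 hvw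
      refine Or.inr ⟨⊥, Δ.bot_mem hv.2, fun h => hv.1.ne_zero (latticePt_injective ?_),
        ⟨_, hv.2, latticePt_mem_rayCone v, bot_le⟩, by simp⟩
      rw [latticePt_zero]; exact h
    · exact Or.inl ⟨hwΔ, hvw⟩

lemma Fan.ext_cones {d : ℕ} {Δ Δ' : Fan d} (h : Δ.cones = Δ'.cones) : Δ = Δ' := by
  cases Δ; cases Δ'; cases h; rfl

/-- In every cone containing the ray `v`, this ray is complementary to the other rays. -/
def Fan.IsSplit {d : ℕ} (Δ : Fan d) (v : Fin d → ℤ) : Prop :=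
  ∀ σ ∈ Δ.cones, latticePt v ∈ σ →
    ∃ u : Fin d → ℤ, u ⬝ᵥ v ≠ 0 ∧ ∀ w ∈ Δ.raysOf σ, w ≠ v → u ⬝ᵥ w = 0

lemma Fan.mem_charMonoid_of_raysOf {d : ℕ} (Δ : Fan d) {σ : Cone d} (hσ : σ ∈ Δ.cones)
    {u : Fin d → ℤ} (h : ∀ w ∈ Δ.raysOf σ, 0 ≤ u ⬝ᵥ w) : u ∈ charMonoid σ := by
  intro x hx
  rw [← Δ.hull_raysOf hσ] at hx
  refine nonneg_of_mem_hull ?_ hx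
  rintro _ ⟨w, hw, rfl⟩
  rw [latticePt_dotProduct]
  exact_mod_cast h w hw

lemma Fan.IsSplit.exists_pos {d : ℕ} {Δ : Fan d} {v : Fin d → ℤ} (h : Δ.IsSplit v)
    {σ : Cone d} (hσ : σ ∈ Δ.cones) (hv : latticePt v ∈ σ) :
    ∃ u ∈ charMonoid σ, 0 < u ⬝ᵥ v ∧ (∀ w ∈ Δ.raysOf σ, w ≠ v → u ⬝ᵥ w = 0) ∧
      σ = rayCone v ⊔ zeroFace σ u := by
  have : ∃ u : Fin d → ℤ, 0 < u ⬝ᵥ v ∧ ∀ w ∈ Δ.raysOf σ, w ≠ v → u ⬝ᵥ w = 0 := by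
    obtain ⟨u, hu, hu'⟩ := h σ hσ hv
    rcases lt_or_gt_of_ne hu with h0 | h0
    · exact ⟨-u, by simpa using h0, fun w hw hwv => by simp [hu' w hw hwv]⟩
    · exact ⟨u, h0, hu'⟩
  obtain ⟨u, hu, hu'⟩ := this
  refine ⟨u, Δ.mem_charMonoid_of_raysOf hσ fun w hw => ?_, hu, hu', le_antisymm ?_
    (sup_le (rayCone_le hv) (zeroFace_le _ _))⟩
  · by_cases hwv : w = v
    · rw [hwv]; exact hu.le
    · rw [hu' w hw hwv]
  · conv_lhs => rw [← Δ.hull_raysOf hσ]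
    refine Submodule.span_le.2 ?_
    rintro _ ⟨w, hw, rfl⟩
    by_cases hwv : w = v
    · rw [hwv]; exact le_sup_left (a := rayCone v) (latticePt_mem_rayCone v)
    · exact le_sup_right (a := rayCone v)
        ⟨hw.2, by rw [latticePt_dotProduct, hu' w hw hwv, Int.cast_zero]⟩

/-- If a cone through `v` is a join of `v` with a face `τ`, every other ray of it lies in `τ` by
extremality, so a functional cutting out `τ` splits off `v`. Conversely, let `u` split `v` off from
`σ` and let `u₁` cut out a face `τ` missing `v`; then the combination of `u₁` and `u` that vanishes
at `v` cuts out the join of `v` and `τ`. -/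
lemma Fan.stellar_eq_iff {d : ℕ} (Δ : Fan d) {v : Fin d → ℤ} (hv : v ∈ Δ.rays) :
    Δ.stellar v = Δ.cones ↔ Δ.IsSplit v := by
  constructor
  · intro h σ hσ hvσ
    rcases (h ▸ hσ : σ ∈ Δ.stellar v) with ⟨-, h'⟩ | ⟨τ, hτ, hτv, -, rfl⟩
    · exact absurd hvσ h'
    obtain ⟨u, hu, hF, huv⟩ := Δ.exists_cut hτ hσ le_sup_right hvσ hτv
    refine ⟨u, huv.ne', fun w hw hwv => ?_⟩
    obtain ⟨u', hu', hu''⟩ := Δ.isFace_rayCone hw.1 hσ hw.2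
    obtain ⟨c, hc, t, ht, he⟩ := mem_rayCone_sup.1 hw.2
    have h0 := ((hu'' _).1 (latticePt_mem_rayCone w)).2
    have htσ := le_sup_right (a := rayCone v) ht
    rw [he, dotProduct_add, dotProduct_smul, smul_eq_mul] at h0
    have h1 := mul_nonneg hc (hu' _ hvσ)
    have h2 := hu' t htσ
    rcases mul_eq_zero.1 (show c * (latticePt u' ⬝ᵥ latticePt v) = 0 by linarith) with h3 | h3
    · rw [h3, zero_smul, zero_add] at he
      rw [← he, hF] at ht
      have := ht.2
      rw [latticePt_dotProduct] at this
      exact_mod_cast this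
    · exact absurd (hw.1.1.eq_of_mem_rayCone hv.1 ((hu'' _).2 ⟨hvσ, h3⟩)).symm hwv
  · intro h
    ext γ
    constructor
    · rintro (⟨h, -⟩ | ⟨τ, hτ, hτv, ⟨σ, hσ, hvσ, hle⟩, rfl⟩)
      · exact h
      obtain ⟨u, hu, huv, hur, hσe⟩ := h.exists_pos hσ hvσ
      obtain ⟨u₁, hu₁, rfl⟩ := (Δ.isFace_of_le hτ hσ hle).exists_eq_zeroFace
      have huv' : (0 : ℝ) < ((u ⬝ᵥ v : ℤ) : ℝ) := by exact_mod_cast huv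
      have e : ((u ⬝ᵥ v) • u₁ + (-(u₁ ⬝ᵥ v)) • u) ⬝ᵥ v = 0 := by
        simp only [add_dotProduct, smul_dotProduct, smul_eq_mul]; ring
      have hmem : (u ⬝ᵥ v) • u₁ + (-(u₁ ⬝ᵥ v)) • u ∈ charMonoid σ := by
        refine Δ.mem_charMonoid_of_raysOf hσ fun w hw => ?_
        by_cases hwv : w = v
        · rw [hwv, e]
        · rw [add_dotProduct, smul_dotProduct, smul_dotProduct, hur w hw hwv, smul_zero, add_zero]
          exact mul_nonneg huv.le (dotProduct_nonneg_of_mem hu₁ hw.2)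
      convert Δ.zeroFace_mem hσ hmem using 1
      refine le_antisymm (sup_le (rayCone_le ⟨hvσ, ?_⟩) ?_) ?_
      · rw [latticePt_dotProduct, e, Int.cast_zero]
      · rw [← Δ.hull_raysOf hτ]
        refine Submodule.span_le.2 ?_
        rintro _ ⟨w, hw, rfl⟩
        refine ⟨hw.2.1, ?_⟩
        have hwv : w ≠ v := by rintro rfl; exact hτv hw.2
        rw [latticePt_add, latticePt_zsmul, latticePt_zsmul, add_dotProduct, smul_dotProduct,
          smul_dotProduct, hw.2.2, latticePt_dotProduct, hur w ⟨hw.1, hw.2.1⟩ hwv]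
        simp
      · rintro x ⟨hx, hx0⟩
        rw [hσe] at hx
        obtain ⟨c, hc, t, ht, rfl⟩ := mem_rayCone_sup.1 hx
        rw [dotProduct_add, dotProduct_smul, latticePt_dotProduct, e, latticePt_add,
          latticePt_zsmul, latticePt_zsmul, add_dotProduct, smul_dotProduct, smul_dotProduct,
          ht.2, Int.cast_zero, smul_zero, smul_zero, add_zero, zero_add, smul_eq_mul] at hx0
        exact mem_rayCone_sup.2 ⟨c, hc, t,
          ⟨ht.1, (mul_eq_zero.1 hx0).resolve_left huv'.ne'⟩, rfl⟩
    · intro hγ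
      by_cases hvγ : latticePt v ∈ γ
      · obtain ⟨u, hu, huv, -, hσe⟩ := h.exists_pos hγ hvγ
        refine Or.inr ⟨zeroFace γ u, Δ.zeroFace_mem hγ hu, fun h => huv.ne' ?_,
          ⟨γ, hγ, hvγ, zeroFace_le _ _⟩, hσe⟩
        have := h.2
        rw [latticePt_dotProduct] at this
        exact_mod_cast this
      · exact Or.inl ⟨hγ, hvγ⟩

/-! ### Simplicial cones -/

/-- Each ray generator is a multiple of one of the independent real generators, so a real functional
kills all rays except `v`. Its existence prevents `v` from lying in the rational span of the other
rays, which gives a lattice functional. -/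
lemma Fan.exists_of_isSimplicial {d : ℕ} (Δ : Fan d) {v : Fin d → ℤ} {σ : Cone d}
    (hσ : σ ∈ Δ.cones) (hv : v ∈ Δ.raysOf σ) (h : PointedCone.IsSimplicial σ) :
    ∃ u : Fin d → ℤ, u ⬝ᵥ v ≠ 0 ∧ ∀ w ∈ Δ.raysOf σ, w ≠ v → u ⬝ᵥ w = 0 := by
  obtain ⟨S, -, hli, hS⟩ := h
  have hScone : ∀ s ∈ S, s ∈ σ := fun s hs => hS ▸ PointedCone.subset_hull hs
  have key : ∀ w ∈ Δ.raysOf σ, ∃ s ∈ S, ∃ c : ℝ, 0 < c ∧ s = c • latticePt w := by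
    intro w hw
    obtain ⟨u, hu, hu'⟩ := Δ.isFace_rayCone hw.1 hσ hw.2
    -- Were `u` positive on every generator, it would vanish only at the origin of `σ`, but it
    -- vanishes at `w`.
    have : ∃ s ∈ S, latticePt u ⬝ᵥ s = 0 := by
      by_contra hcon
      push Not at hcon
      have hx : ∀ x ∈ PointedCone.hull ℝ S, latticePt u ⬝ᵥ x = 0 → x = 0 := by
        intro x hx
        refine (Submodule.span_induction
          (p := fun x _ => 0 ≤ latticePt u ⬝ᵥ x ∧ (latticePt u ⬝ᵥ x = 0 → x = 0))
          ?_ ?_ ?_ ?_ hx).2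
        · exact fun s hs => ⟨hu s (hScone s hs), fun h => absurd h (hcon s hs)⟩
        · simp
        · rintro x y - - ⟨hx0, hx⟩ ⟨hy0, hy⟩
          rw [dotProduct_add]
          refine ⟨add_nonneg hx0 hy0, fun h => ?_⟩
          rw [hx (by linarith), hy (by linarith), add_zero]
        · rintro a x - ⟨hx0, hx⟩
          change 0 ≤ latticePt u ⬝ᵥ ((a : ℝ) • x) ∧
            (latticePt u ⬝ᵥ ((a : ℝ) • x) = 0 → (a : ℝ) • x = 0)
          rw [dotProduct_smul]
          refine ⟨smul_nonneg a.2 hx0, fun h => ?_⟩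
          rcases mul_eq_zero.1 h with h | h
          · rw [h, zero_smul]
          · rw [hx h, smul_zero]
      have h0 := hx (latticePt w) (hS ▸ hw.2) ((hu' _).1 (latticePt_mem_rayCone w)).2
      exact hw.1.1.ne_zero (latticePt_injective (by rw [h0, latticePt_zero]))
    obtain ⟨s, hs, hs0⟩ := this
    obtain ⟨c, hc, rfl⟩ := mem_rayCone.1 ((hu' s).2 ⟨hScone s hs, hs0⟩)
    refine ⟨_, hs, c, lt_of_le_of_ne hc ?_, rfl⟩
    rintro rfl
    exact hli.ne_zero hs (zero_smul _ _)
  obtain ⟨s, hs, c, hc, rfl⟩ := key v hv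
  by_contra hcon
  push Not at hcon
  -- If no lattice functional splits off `v`, every lattice functional killing the other rays kills
  -- `v`. By `dotProduct_eq_zero_of_forall_int` this extends to real functionals, and the `f` below
  -- contradicts it.
  have hint : ∀ y : Fin d → ℤ, (∀ w ∈ {w | w ∈ Δ.raysOf σ ∧ w ≠ v}, y ⬝ᵥ w = 0) →
      y ⬝ᵥ v = 0 := by
    intro y hy
    by_contra hne
    obtain ⟨w, hw, hwv, h0⟩ := hcon y hne
    exact h0 (hy w ⟨hw, hwv⟩)
  have hnot : c • latticePt v ∉ Submodule.span ℝ (S \ {c • latticePt v}) := by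
    simpa using hli.notMem_span hs
  obtain ⟨f, hf, hle⟩ := Submodule.exists_le_ker_of_notMem hnot
  have hfc : ∀ x, f x = (fun i => f (Pi.single i 1)) ⬝ᵥ x := by
    intro x
    conv_lhs => rw [← Finset.univ_sum_single x]
    rw [map_sum]
    refine Finset.sum_congr rfl fun i _ => ?_
    have : (Pi.single i (x i) : Fin d → ℝ) = x i • Pi.single i 1 := by
      rw [← Pi.single_smul, smul_eq_mul, mul_one]
    rw [this, map_smul, smul_eq_mul, mul_comm]
  have h1 := dotProduct_eq_zero_of_forall_int _ v hint (y := fun i => f (Pi.single i 1)) ?_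
  · rw [← hfc] at h1
    apply hf
    rw [map_smul, h1, smul_zero]
  · rintro w ⟨hw, hwv⟩
    rw [← hfc]
    obtain ⟨s', hs', c', hc', rfl⟩ := key w hw
    have hmem : c' • latticePt w ∈ S \ {c • latticePt v} := by
      refine ⟨hs', fun h => hwv ?_⟩
      refine hv.1.1.eq_of_mem_rayCone hw.1.1 (mem_rayCone.2 ⟨c'⁻¹ * c, by positivity, ?_⟩)
      rw [mul_smul, ← show _ = c • latticePt v from h, inv_smul_smul₀ hc'.ne']
    have := hle (Submodule.subset_span hmem)
    rw [LinearMap.mem_ker, map_smul, smul_eq_mul] at this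
    exact (mul_eq_zero.1 this).resolve_left hc'.ne'

/-- The splitting functionals form a dual system to the ray generators up to nonzero scalars, so
pairing a linear relation with them kills each coefficient. -/
lemma Fan.isSimplicial_of_exists {d : ℕ} (Δ : Fan d) {σ : Cone d} (hσ : σ ∈ Δ.cones)
    (h : ∀ v ∈ Δ.raysOf σ,
      ∃ u : Fin d → ℤ, u ⬝ᵥ v ≠ 0 ∧ ∀ w ∈ Δ.raysOf σ, w ≠ v → u ⬝ᵥ w = 0) :
    PointedCone.IsSimplicial σ := by
  refine ⟨latticePt '' Δ.raysOf σ, (Δ.rays_finite.subset fun _ h => h.1).image _, ?_,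
    Δ.hull_raysOf hσ⟩
  choose! u hu hu' using h
  rw [LinearIndepOn, linearIndependent_iff']
  intro s g hg i hi
  obtain ⟨_, v, hv, rfl⟩ := i
  have h1 := congrArg (fun x => latticePt (u v) ⬝ᵥ x) hg
  simp only [dotProduct_sum, dotProduct_zero, dotProduct_smul, id, smul_eq_mul] at h1
  rw [Finset.sum_eq_single_of_mem _ hi] at h1
  · rw [latticePt_dotProduct] at h1
    exact (mul_eq_zero.1 h1).resolve_right (by exact_mod_cast hu v hv)
  · rintro ⟨_, w, hw, rfl⟩ - hne
    have : w ≠ v := by rintro rfl; exact hne rfl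
    rw [latticePt_dotProduct, hu' v hv w hw this, Int.cast_zero, mul_zero]

/-! ### Heights -/

lemma mem_dualCone {d : ℕ} {σ : Cone d} {y : Fin d → ℝ} :
    y ∈ dualCone σ ↔ ∀ x ∈ σ, 0 ≤ x ⬝ᵥ y := Iff.rfl

lemma latticePt_mem_dualCone {d : ℕ} {σ : Cone d} {u : Fin d → ℤ} :
    latticePt u ∈ dualCone σ ↔ u ∈ charMonoid σ := by
  rw [mem_dualCone, mem_charMonoid]
  exact forall₂_congr fun x _ => by rw [dotProduct_comm]

lemma mem_dualCone_hull {d : ℕ} {s : Set (Fin d → ℤ)} {y : Fin d → ℝ} :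
    y ∈ dualCone (PointedCone.hull ℝ (latticePt '' s)) ↔ ∀ v ∈ s, 0 ≤ latticePt v ⬝ᵥ y := by
  refine ⟨fun h v hv => h (PointedCone.subset_hull ⟨v, hv, rfl⟩), fun h x hx => ?_⟩
  change 0 ≤ x ⬝ᵥ y
  rw [dotProduct_comm]
  refine nonneg_of_mem_hull ?_ hx
  rintro _ ⟨v, hv, rfl⟩
  rw [dotProduct_comm]; exact h v hv

/-- A rational cone has only finitely many dual faces. -/
lemma IsRational.finite_dual_faces {d : ℕ} {σ : Cone d} (hσ : IsRational σ) :
    {R : Cone d | IsFace R (dualCone σ)}.Finite := by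
  classical
  obtain ⟨s, hs⟩ := hσ
  have key : ∀ x ∈ PointedCone.hull ℝ (latticePt '' (s : Set (Fin d → ℤ))), ∃ J ⊆ s,
      ∀ y ∈ dualCone σ, (x ⬝ᵥ y = 0 ↔ ∀ v ∈ J, latticePt v ⬝ᵥ y = 0) := by
    intro x hx
    refine (Submodule.span_induction (p := fun x hx => ∃ J ⊆ s,
      ∀ y ∈ dualCone σ, (x ⬝ᵥ y = 0 ↔ ∀ v ∈ J, latticePt v ⬝ᵥ y = 0)) ?_ ?_ ?_ ?_ hx)
    · rintro _ ⟨v, hv, rfl⟩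
      exact ⟨{v}, by simpa using hv, by simp⟩
    · exact ⟨∅, by simp, by simp⟩
    · rintro x₁ x₂ hx₁ hx₂ ⟨J₁, hJ₁, h₁⟩ ⟨J₂, hJ₂, h₂⟩
      refine ⟨J₁ ∪ J₂, Finset.union_subset hJ₁ hJ₂, fun y hy => ?_⟩
      have e₁ : 0 ≤ x₁ ⬝ᵥ y := hy (hs ▸ hx₁)
      have e₂ : 0 ≤ x₂ ⬝ᵥ y := hy (hs ▸ hx₂)
      rw [add_dotProduct, add_eq_zero_iff_of_nonneg e₁ e₂, h₁ y hy, h₂ y hy]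
      simp only [Finset.mem_union, or_imp, forall_and]
    · rintro a x - ⟨J, hJ, h⟩
      by_cases ha : (a : ℝ) = 0
      · refine ⟨∅, by simp, fun y _ => ?_⟩
        change ((a : ℝ) • x) ⬝ᵥ y = 0 ↔ _
        simp [ha]
      · refine ⟨J, hJ, fun y hy => ?_⟩
        rw [← h y hy]
        change ((a : ℝ) • x) ⬝ᵥ y = 0 ↔ _
        rw [smul_dotProduct, smul_eq_mul, mul_eq_zero, or_iff_right ha]
  choose! J hJs hJ using key
  have hle : {R : Cone d | IsFace R (dualCone σ)} ⊆
      ⋃ J ∈ (s.powerset : Set (Finset (Fin d → ℤ))),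
        {R : Cone d | ∀ y, y ∈ R ↔ y ∈ dualCone σ ∧ ∀ v ∈ J, latticePt v ⬝ᵥ y = 0} := by
    rintro R ⟨u, hu, hR⟩
    -- By biduality a functional cutting out a dual face is a point of `σ`, so the face depends only
    -- on the subset of generators supporting that point.
    have huσ : latticePt u ∈ PointedCone.hull ℝ (latticePt '' (s : Set (Fin d → ℤ))) := by
      refine IsRational.mem_of_forall ⟨s, rfl⟩ fun w hw => ?_
      rw [dotProduct_comm]
      exact hu _ (latticePt_mem_dualCone.2 (hs ▸ hw))
    refine Set.mem_biUnion (x := J (latticePt u)) ?_ fun y => ?_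
    · simpa using hJs _ huσ
    · rw [hR]
      exact and_congr_right fun hy => hJ _ huσ y hy
  refine Set.Finite.subset (Set.Finite.biUnion (Finset.finite_toSet _) fun J _ => ?_) hle
  refine Set.Subsingleton.finite fun R hR R' hR' => SetLike.ext fun y => ?_
  rw [hR y, hR' y]

lemma Fan.heights_finite {d : ℕ} (Δ : Fan d) (v : Fin d → ℤ) : (Δ.heights v).Finite := by
  have hle : Δ.heights v ⊆ ⋃ σ ∈ Δ.cones, ⋃ R ∈ {R : Cone d | IsFace R (dualCone σ)},
      {h | IsLeast {n : ℕ | 0 < n ∧ ∃ w : Fin d → ℤ, latticePt w ∈ R ∧ w ⬝ᵥ v = n} h} := by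
    rintro h ⟨σ, hσ, -, R, hR, hh⟩
    exact Set.mem_biUnion hσ (Set.mem_biUnion hR.1 hh)
  refine Set.Finite.subset (Δ.finite.biUnion fun σ hσ =>
    (Δ.rational σ hσ).finite_dual_faces.biUnion fun R _ => ?_) hle
  exact Set.Subsingleton.finite fun a ha b hb => ha.unique hb

/-- The infimum is attained: the product of the finitely many positive heights is a common multiple,
so the default value of `sInf` on the empty set does not occur. -/
lemma Fan.heightLcm_mem {d : ℕ} (Δ : Fan d) (v : Fin d → ℤ) :
    0 < Δ.heightLcm v ∧ ∀ h ∈ Δ.heights v, h ∣ Δ.heightLcm v := by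
  refine Nat.sInf_mem (s := {m : ℕ | 0 < m ∧ ∀ h ∈ Δ.heights v, h ∣ m}) ?_
  refine ⟨∏ h ∈ (Δ.heights_finite v).toFinset, h, Finset.prod_pos fun h hh => ?_, fun h hh =>
    Finset.dvd_prod_of_mem _ ((Δ.heights_finite v).mem_toFinset.2 hh)⟩
  obtain ⟨σ, -, -, R, -, hR⟩ := (Δ.heights_finite v).mem_toFinset.1 hh
  exact hR.1.1

/-- An element of `S_σ` not vanishing at `v` can be moved to the first lattice point on an edge
of the dual cone. -/
lemma Fan.exists_height {d : ℕ} (Δ : Fan d) {σ : Cone d} (hσ : σ ∈ Δ.cones) {v : Fin d → ℤ}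
    (hv : latticePt v ∈ σ) (s : Finset (Fin d → ℤ))
    (hs : PointedCone.hull ℝ (latticePt '' (s : Set (Fin d → ℤ))) = σ)
    {p : Fin d → ℤ} (hp : p ∈ charMonoid σ) (hpv : 0 < p ⬝ᵥ v) :
    ∃ g ∈ charMonoid σ, 0 < g ⬝ᵥ v ∧ (∀ w ∈ s, p ⬝ᵥ w = 0 → g ⬝ᵥ w = 0) ∧
      (g ⬝ᵥ v).toNat ∈ Δ.heights v := by
  classical
  have hint : ∀ u, u ∈ charMonoid σ ↔ ∀ w ∈ s, 0 ≤ u ⬝ᵥ w := fun u => by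
    rw [← hs, mem_charMonoid_hull]
  obtain ⟨g, hg, hgv, hpg, hmax⟩ := exists_edge_point s v ((hint p).1 hp) hpv
  -- The sum of the generators of `σ` orthogonal to `g` cuts out the smallest dual face containing
  -- `g`.
  let z : Fin d → ℤ := ∑ w ∈ s.filter (fun w => g ⬝ᵥ w = 0), w
  let R : Cone d := zeroFace (dualCone σ) z
  have hsσ : ∀ w ∈ s, latticePt w ∈ σ := fun w hw => hs ▸ PointedCone.subset_hull ⟨w, hw, rfl⟩
  have hz : ∀ y ∈ dualCone σ, 0 ≤ latticePt z ⬝ᵥ y := by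
    intro y hy
    rw [latticePt_sum, sum_dotProduct]
    exact Finset.sum_nonneg fun w hw => hy (hsσ w (Finset.mem_filter.1 hw).1)
  have hR : ∀ y, y ∈ R ↔ y ∈ dualCone σ ∧ ∀ w ∈ s, g ⬝ᵥ w = 0 → latticePt w ⬝ᵥ y = 0 := by
    intro y
    refine and_congr_right fun hy => ?_
    rw [latticePt_sum, sum_dotProduct, Finset.sum_eq_zero_iff_of_nonneg
      (fun w hw => show 0 ≤ latticePt w ⬝ᵥ y from hy (hsσ w (Finset.mem_filter.1 hw).1))]
    simp only [Finset.mem_filter, and_imp]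
  have hRint : ∀ w, latticePt w ∈ R ↔
      w ∈ charMonoid σ ∧ ∀ x ∈ s, g ⬝ᵥ x = 0 → w ⬝ᵥ x = 0 := by
    intro w
    simp only [hR, latticePt_mem_dualCone, latticePt_dotProduct, Int.cast_eq_zero,
      dotProduct_comm w]
  have hgR : latticePt g ∈ R := (hRint g).2 ⟨(hint g).2 hg, fun _ _ h => h⟩
  have hgv' : (0 : ℝ) < ((g ⬝ᵥ v : ℤ) : ℝ) := by exact_mod_cast hgv
  have hL : ∀ y, y ∈ (dualCone σ).lineal ↔ ∀ w ∈ s, latticePt w ⬝ᵥ y = 0 := by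
    intro y
    rw [PointedCone.mem_lineal, ← hs, mem_dualCone_hull, mem_dualCone_hull]
    constructor
    · rintro ⟨h1, h2⟩ w hw
      have := h2 w hw
      rw [dotProduct_neg] at this
      exact le_antisymm (by linarith) (h1 w hw)
    · intro h
      exact ⟨fun w hw => (h w hw).ge, fun w hw => by rw [dotProduct_neg, h w hw, neg_zero]⟩
  have hvL : ∀ y ∈ (dualCone σ).lineal, y ⬝ᵥ latticePt v = 0 := by
    intro y hy
    have h1 : 0 ≤ latticePt v ⬝ᵥ y := hy.1 hv
    have h2 : 0 ≤ latticePt v ⬝ᵥ (-y) := hy.2 hv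
    rw [dotProduct_neg] at h2
    rw [dotProduct_comm]
    linarith
  -- After subtracting the multiple of `g` with the same value at `v`, extremality of `g` leaves
  -- only an element of the lineality space. So the face has exactly one dimension more than that
  -- space.
  have hspan : Submodule.span ℝ (R : Set (Fin d → ℝ)) =
      (dualCone σ).lineal ⊔ Submodule.span ℝ {latticePt g} := by
    refine le_antisymm (Submodule.span_le.2 fun y hy => ?_) (sup_le ?_ ?_)
    · let c := (y ⬝ᵥ latticePt v) / ((g ⬝ᵥ v : ℤ) : ℝ)
      have hc : (y - c • latticePt g) ⬝ᵥ latticePt v = 0 := by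
        rw [sub_dotProduct, smul_dotProduct, latticePt_dotProduct, smul_eq_mul,
          div_mul_cancel₀ _ hgv'.ne', sub_self]
      have hl : y - c • latticePt g ∈ (dualCone σ).lineal := by
        rw [hL]
        intro w hw
        rw [dotProduct_comm]
        refine dotProduct_eq_zero_of_forall_int (insert v {w | w ∈ s ∧ g ⬝ᵥ w = 0}) w
          (fun y' hy' => hmax y' (fun x hx h0 => hy' x (Or.inr ⟨hx, h0⟩)) (hy' v (Or.inl rfl)) w
            hw) ?_
        rintro x (rfl | ⟨hx, hx0⟩)
        · exact hc
        · rw [sub_dotProduct, smul_dotProduct, latticePt_dotProduct, hx0, dotProduct_comm,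
            ((hR y).1 hy).2 x hx hx0]
          simp
      have : y = (y - c • latticePt g) + c • latticePt g := by abel
      rw [SetLike.mem_coe, this]
      exact add_mem (Submodule.mem_sup_left hl)
        (Submodule.mem_sup_right (Submodule.smul_mem _ _ (Submodule.mem_span_singleton_self _)))
    · intro y hy
      exact Submodule.subset_span ((hR y).2 ⟨hy.1, fun w hw _ => (hL y).1 hy w hw⟩)
    · rw [Submodule.span_le, Set.singleton_subset_iff]
      exact Submodule.subset_span hgR
  have hgL : latticePt g ∉ (dualCone σ).lineal := by
    intro h
    have := hvL _ h
    rw [latticePt_dotProduct] at this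
    exact hgv'.ne' this
  have hedge : IsEdge R (dualCone σ) :=
    ⟨⟨z, hz, fun _ => Iff.rfl⟩, by rw [hspan, Submodule.finrank_sup_span_singleton hgL]⟩
  -- The point `g` need not be the first lattice point on its edge, so it is replaced by a point of
  -- least positive height.
  have hex : ∃ n : ℕ, 0 < n ∧ ∃ w : Fin d → ℤ, latticePt w ∈ R ∧ w ⬝ᵥ v = n :=
    ⟨(g ⬝ᵥ v).toNat, by omega, g, hgR, (Int.toNat_of_nonneg hgv.le).symm⟩
  obtain ⟨h0, w, hwR, hwv⟩ := Nat.find_spec hex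
  refine ⟨w, ((hRint w).1 hwR).1, by omega, fun x hx hpx => ((hRint w).1 hwR).2 x hx
    (hpg x hx hpx), σ, hσ, hv, R, hedge, ?_⟩
  rw [hwv, Int.toNat_natCast]
  exact ⟨⟨h0, w, hwR, hwv⟩, fun n hn => Nat.find_min' hex hn⟩

/-! ### Local description of blow-ups -/

/-- The Rees monoid of the monoid ideal generated by `W` in `S_σ`. -/
def reesMonoid {d : ℕ} (σ : Cone d) (W : Set (Fin d → ℤ)) : AddSubmonoid ((Fin d → ℤ) × ℕ) :=
  AddSubmonoid.closure ({q | q.1 ∈ charMonoid σ ∧ q.2 = 0} ∪ {q | q.1 ∈ W ∧ q.2 = 1})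

lemma mem_reesMonoid_zero {d : ℕ} {σ : Cone d} {W : Set (Fin d → ℤ)} {s : Fin d → ℤ}
    (hs : s ∈ charMonoid σ) : (s, 0) ∈ reesMonoid σ W :=
  AddSubmonoid.subset_closure (Or.inl ⟨hs, rfl⟩)

lemma mem_reesMonoid_one {d : ℕ} {σ : Cone d} {W : Set (Fin d → ℤ)} {w : Fin d → ℤ}
    (hw : w ∈ W) : (w, 1) ∈ reesMonoid σ W :=
  AddSubmonoid.subset_closure (Or.inr ⟨hw, rfl⟩)

lemma mem_reesMonoid_of_le {d : ℕ} {σ : Cone d} {W : Set (Fin d → ℤ)}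
    (hW : W ⊆ charMonoid σ) {q : (Fin d → ℤ) × ℕ} (hq : q ∈ reesMonoid σ W) :
    ∀ b ≤ q.2, (q.1, b) ∈ reesMonoid σ W := by
  refine AddSubmonoid.closure_induction
    (motive := fun q _ => ∀ b ≤ q.2, (q.1, b) ∈ reesMonoid σ W) ?_ ?_ ?_ hq
  · rintro ⟨p, n⟩ (⟨hp, rfl⟩ | ⟨hp, rfl⟩) b hb
    · obtain rfl : b = 0 := by simpa using hb
      exact mem_reesMonoid_zero hp
    · rcases Nat.le_one_iff_eq_zero_or_eq_one.1 hb with rfl | rfl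
      · exact mem_reesMonoid_zero (hW hp)
      · exact mem_reesMonoid_one hp
  · intro b hb
    obtain rfl : b = 0 := by simpa using hb
    exact zero_mem _
  · rintro ⟨p₁, n₁⟩ ⟨p₂, n₂⟩ - - h₁ h₂ b hb
    have e : ((p₁ + p₂, b) : (Fin d → ℤ) × ℕ) = (p₁, min b n₁) + (p₂, b - min b n₁) := by
      ext <;> simp
    change (p₁ + p₂, b) ∈ _
    rw [e]
    have hb' : b ≤ n₁ + n₂ := hb
    exact add_mem (h₁ _ (min_le_right _ _)) (h₂ _ (by
      change b - min b n₁ ≤ n₂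
      omega))

/-- Over `U_σ` the fan `Δ'` describes the blow-up of the ideal generated by the monomials in `P`:
the monomial `w ∈ W` generates this ideal on the chart of the cone `C w`. -/
structure IsLocalBlowup {d : ℕ} (Δ' : Fan d) (σ : Cone d) (P W : Set (Fin d → ℤ))
    (C : (Fin d → ℤ) → Cone d) : Prop where
  subset_charMonoid : P ⊆ charMonoid σ
  subset : W ⊆ P
  cone_mem : ∀ w ∈ W, C w ∈ Δ'.cones
  cone_le : ∀ w ∈ W, C w ≤ σ
  sub_mem : ∀ p ∈ P, ∀ w ∈ W, p - w ∈ charMonoid (C w)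
  mem_cone : ∀ w ∈ W, ∀ u ∈ W, ∀ x ∈ C w, latticePt (u - w) ⬝ᵥ x = 0 → x ∈ C u
  exists_le : ∀ τ ∈ Δ'.cones, τ ≤ σ → ∃ w ∈ W, τ ≤ C w
  dominated : ∀ p ∈ P, ∃ N : ℕ, 0 < N ∧ (N • p, N) ∈ reesMonoid σ W

/-- The charts are those of the blow-up itself. -/
def HasReesCharts {d : ℕ} (σ : Cone d) (P W : Set (Fin d → ℤ)) (C : (Fin d → ℤ) → Cone d) :
    Prop :=
  ∀ w ∈ W, ∀ c ∈ charMonoid (C w), ∃ N : ℕ, (c + N • w, N) ∈ reesMonoid σ P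

/-- The charts are integral over those of the blow-up. -/
def HasIntegralReesCharts {d : ℕ} (σ : Cone d) (W : Set (Fin d → ℤ))
    (C : (Fin d → ℤ) → Cone d) : Prop :=
  ∀ w ∈ W, ∀ c ∈ charMonoid (C w), ∃ N : ℕ, c + N • w ∈ charMonoid σ ∧
    ∃ M : ℕ, 0 < M ∧ (M • (c + N • w), M * N) ∈ reesMonoid σ W

/-- The monomials generating the ideal of `n D` on `U_σ`. -/
def Fan.divisorMonomials {d : ℕ} (σ : Cone d) (v : Fin d → ℤ) (n : ℕ) : Set (Fin d → ℤ) :=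
  {p | p ∈ charMonoid σ ∧ (latticePt v ∈ σ → (n : ℤ) ≤ p ⬝ᵥ v)}

open Classical in
/-- The monomials generating the ideal of `l m' D` on the charts of the stellar subdivision. -/
noncomputable def Fan.stellarMonomials {d : ℕ} (Δ : Fan d) (σ : Cone d) (v : Fin d → ℤ) (l : ℕ) :
    Set (Fin d → ℤ) :=
  if latticePt v ∈ σ then
    {w | ∃ u ∈ charMonoid σ, u ⬝ᵥ v = Δ.heightLcm v ∧ w = l • u}
  else {0}

open Classical in
/-- The cone of the stellar subdivision on whose chart a monomial generates. -/
noncomputable def Fan.stellarCone {d : ℕ} (σ : Cone d) (v w : Fin d → ℤ) : Cone d :=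
  if latticePt v ∈ σ then rayCone v ⊔ zeroFace σ w else σ

lemma Fan.stellarMonomials_subset {d : ℕ} (Δ : Fan d) {σ : Cone d} {v : Fin d → ℤ} (l : ℕ) :
    Δ.stellarMonomials σ v l ⊆ charMonoid σ := by
  unfold stellarMonomials
  split_ifs with h
  · rintro _ ⟨u, hu, -, rfl⟩
    exact nsmul_mem hu l
  · rintro _ rfl
    exact zero_mem _

/-- The integrality statement behind both blow-ups. Lattice points at height zero and first lattice
points on edges satisfy it, since their heights divide `m'`; by `exists_nsmul_mem` they generate, up
to multiples, all of `S_σ`. -/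
lemma Fan.exists_mem_reesMonoid {d : ℕ} (Δ : Fan d) {σ : Cone d} (hσ : σ ∈ Δ.cones)
    {v : Fin d → ℤ} (hv : latticePt v ∈ σ) {l : ℕ} (hl : 0 < l) {q : Fin d → ℤ}
    (hq : q ∈ charMonoid σ) {N : ℕ} (hN : ((N * (l * Δ.heightLcm v) : ℕ) : ℤ) ≤ q ⬝ᵥ v) :
    ∃ M : ℕ, 0 < M ∧ (M • q, M * N) ∈ reesMonoid σ (Δ.stellarMonomials σ v l) := by
  obtain ⟨hm, hdvd⟩ := Δ.heightLcm_mem v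
  set n := l * Δ.heightLcm v with hn
  have hn0 : 0 < n := Nat.mul_pos hl hm
  have hW : Δ.stellarMonomials σ v l =
      {w | ∃ u ∈ charMonoid σ, u ⬝ᵥ v = Δ.heightLcm v ∧ w = l • u} := if_pos hv
  obtain ⟨s, hs⟩ := Δ.rational σ hσ
  have hint : ∀ u, u ∈ charMonoid σ ↔ ∀ w ∈ s, 0 ≤ u ⬝ᵥ w := fun u => by
    rw [← hs, mem_charMonoid_hull]
  -- The normalized form of the claim, in which the degree of `n • p` is the height of `p`. Since
  -- both are additive in `p`, it defines a submonoid.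
  let T : AddSubmonoid (Fin d → ℤ) :=
    { carrier := {p | 0 ≤ p ⬝ᵥ v ∧
        (n • p, (p ⬝ᵥ v).toNat) ∈ reesMonoid σ (Δ.stellarMonomials σ v l)}
      zero_mem' := by
        refine ⟨by simp, ?_⟩
        simpa using mem_reesMonoid_zero (zero_mem (charMonoid σ))
      add_mem' := by
        rintro a b ⟨ha, ha'⟩ ⟨hb, hb'⟩
        refine ⟨by rw [add_dotProduct]; exact add_nonneg ha hb, ?_⟩
        have := add_mem ha' hb'
        rwa [Prod.mk_add_mk, ← smul_add, ← Int.toNat_add ha hb, ← add_dotProduct] at this }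
  obtain ⟨K, hK, hKT⟩ := exists_nsmul_mem s v
    (fun p hp => dotProduct_nonneg_of_mem ((hint p).2 hp) hv) T
    (fun r hr hr0 => ⟨hr0.ge, by
      rw [hr0]; exact mem_reesMonoid_zero (nsmul_mem ((hint r).2 hr) n)⟩)
    (fun p hp hpv => by
      obtain ⟨g, hg, hgv, hpg, hgh⟩ := Δ.exists_height hσ hv s hs ((hint p).2 hp) hpv
      refine ⟨g, ⟨hgv.le, ?_⟩, (hint g).1 hg, hgv, hpg⟩
      obtain ⟨e, he⟩ := hdvd _ hgh
      -- With `e = m' / (g ⬝ᵥ v)`, the point `e • g` has height `m'`, so `l • e • g` is in `W`;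
      -- taking it `g ⬝ᵥ v` times gives `n • g` in degree `g ⬝ᵥ v`.
      have hmem : (l • e • g, 1) ∈ reesMonoid σ (Δ.stellarMonomials σ v l) := by
        refine mem_reesMonoid_one ?_
        rw [hW]
        refine ⟨e • g, nsmul_mem hg e, ?_, rfl⟩
        rw [smul_dotProduct, he, nsmul_eq_mul]
        push_cast
        rw [Int.toNat_of_nonneg hgv.le, mul_comm]
      have := nsmul_mem hmem (g ⬝ᵥ v).toNat
      rw [Prod.smul_mk, smul_smul, smul_smul, smul_eq_mul, mul_one] at this
      rwa [hn, he, show l * ((g ⬝ᵥ v).toNat * e) = (g ⬝ᵥ v).toNat * l * e by ring])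
    ((hint q).1 hq)
  refine ⟨n * K, Nat.mul_pos hn0 hK, ?_⟩
  -- The multiple found has degree `K * (q ⬝ᵥ v)`, possibly more than needed. Degrees can be lowered
  -- since `W` lies in `S_σ`.
  have h2 := mem_reesMonoid_of_le (Δ.stellarMonomials_subset l) hKT.2 (n * K * N) (by
    change n * K * N ≤ ((K • q) ⬝ᵥ v).toNat
    rw [smul_dotProduct, nsmul_eq_mul]
    zify
    rw [Int.toNat_of_nonneg (mul_nonneg (by positivity) (dotProduct_nonneg_of_mem hq hv))]
    push_cast at hN
    have hK' : (0 : ℤ) ≤ K := by positivity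
    nlinarith)
  rwa [smul_smul] at h2

/-- The stellar subdivision describes the blow-up of `l m' D` locally. -/
lemma Fan.isLocalBlowup_stellar {d : ℕ} {Δ Δ' : Fan d} {v : Fin d → ℤ}
    (hΔ' : Δ'.cones = Δ.stellar v) {σ : Cone d} (hσ : σ ∈ Δ.cones) {l : ℕ} (hl : 0 < l) :
    IsLocalBlowup Δ' σ (divisorMonomials σ v (l * Δ.heightLcm v)) (Δ.stellarMonomials σ v l)
      (stellarCone σ v) := by
  obtain ⟨hm, hdvd⟩ := Δ.heightLcm_mem v
  by_cases hv : latticePt v ∈ σ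
  · have hW : Δ.stellarMonomials σ v l =
        {w | ∃ u ∈ charMonoid σ, u ⬝ᵥ v = Δ.heightLcm v ∧ w = l • u} := if_pos hv
    have hC : ∀ w, stellarCone σ v w = rayCone v ⊔ zeroFace σ w := fun w => if_pos hv
    have hWv : ∀ w ∈ Δ.stellarMonomials σ v l, w ⬝ᵥ v = ((l * Δ.heightLcm v : ℕ) : ℤ) := by
      rw [hW]
      rintro _ ⟨u, hu, huv, rfl⟩
      rw [smul_dotProduct, huv, nsmul_eq_mul]; push_cast; ring
    have hWσ := Δ.stellarMonomials_subset (σ := σ) (v := v) l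
    have hpos : 0 < l * Δ.heightLcm v := Nat.mul_pos hl hm
    refine ⟨fun p hp => hp.1, fun w hw => ⟨hWσ hw, fun _ => (hWv w hw).ge⟩, fun w hw => ?_,
      fun w hw => ?_, fun p hp w hw => ?_, fun w hw u hu x hx h0 => ?_, fun τ hτ hle => ?_,
      fun p hp => ?_⟩
    · rw [hΔ', hC]
      refine Or.inr ⟨zeroFace σ w, Δ.zeroFace_mem hσ (hWσ hw), fun h => ?_,
        ⟨σ, hσ, hv, zeroFace_le _ _⟩, rfl⟩
      have := h.2
      rw [latticePt_dotProduct, hWv w hw] at this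
      have : l * Δ.heightLcm v = 0 := by exact_mod_cast this
      omega
    · rw [hC]; exact sup_le (rayCone_le hv) (zeroFace_le _ _)
    · rw [hC, mem_charMonoid_rayCone_sup, sub_dotProduct, hWv w hw, sub_nonneg]
      refine ⟨hp.2 hv, fun x hx => ?_⟩
      rw [sub_eq_add_neg, latticePt_add, latticePt_neg, add_dotProduct, neg_dotProduct, hx.2,
        neg_zero, add_zero]
      exact hp.1 x hx.1
    · rw [hC] at hx ⊢
      obtain ⟨c, hc, t, ht, rfl⟩ := mem_rayCone_sup.1 hx
      refine mem_rayCone_sup.2 ⟨c, hc, t, ⟨ht.1, ?_⟩, rfl⟩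
      rw [dotProduct_add, dotProduct_smul, latticePt_dotProduct, sub_dotProduct, hWv w hw,
        hWv u hu, sub_self, Int.cast_zero, smul_zero, zero_add, sub_eq_add_neg, latticePt_add,
        latticePt_neg, add_dotProduct, neg_dotProduct, ht.2, neg_zero, add_zero] at h0
      exact h0
    · obtain ⟨s, hs⟩ := Δ.rational σ hσ
      -- Moving a functional that cuts out `τ` to an edge of `σ^∨` can only enlarge its zero face.
      -- The edge point is then rescaled to height `m'` and multiplied by `l`.
      have key : ∀ τ ∈ Δ.cones, τ ≤ σ → latticePt v ∉ τ →
          ∃ w ∈ Δ.stellarMonomials σ v l, τ ≤ zeroFace σ w := by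
        intro τ hτ hle hτv
        obtain ⟨p, hp, rfl, hpv⟩ := Δ.exists_cut hτ hσ hle hv hτv
        obtain ⟨g, hg, hgv, hpg, hgh⟩ := Δ.exists_height hσ hv s hs hp hpv
        obtain ⟨e, he⟩ := hdvd _ hgh
        refine ⟨l • e • g, ?_, fun x hx => ⟨hx.1, ?_⟩⟩
        · rw [hW]
          refine ⟨e • g, nsmul_mem hg e, ?_, rfl⟩
          rw [smul_dotProduct, he, nsmul_eq_mul]
          push_cast
          rw [Int.toNat_of_nonneg hgv.le, mul_comm]
        · have := IsRational.zeroFace_le_zeroFace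
            (mem_charMonoid_hull.1 (hs.symm ▸ hp)) hpg (hs.symm ▸ hx.1) hx.2
          rw [latticePt_nsmul, latticePt_nsmul, smul_dotProduct, smul_dotProduct, this, smul_zero,
            smul_zero]
      rw [hΔ'] at hτ
      rcases hτ with ⟨hτ, hτv⟩ | ⟨τ₀, hτ, hτv, -, rfl⟩
      · obtain ⟨w, hw, h⟩ := key τ hτ hle hτv
        exact ⟨w, hw, by rw [hC]; exact h.trans le_sup_right⟩
      · obtain ⟨w, hw, h⟩ := key τ₀ hτ (le_sup_right.trans hle) hτv
        exact ⟨w, hw, by rw [hC]; exact sup_le_sup_left h _⟩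
    · obtain ⟨M, hM, h⟩ := Δ.exists_mem_reesMonoid hσ hv hl hp.1 (N := 1) (by
        rw [one_mul]; exact hp.2 hv)
      rw [mul_one] at h
      exact ⟨M, hM, h⟩
  · have hW : Δ.stellarMonomials σ v l = {0} := if_neg hv
    have hC : stellarCone σ v = fun _ => σ := funext fun w => if_neg hv
    rw [hW, hC]
    refine ⟨fun p hp => hp.1, ?_, fun w _ => ?_, fun w _ => le_rfl, ?_, ?_, fun τ _ hle =>
      ⟨0, rfl, hle⟩, fun p hp => ⟨1, one_pos, ?_⟩⟩
    · rintro _ rfl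
      exact ⟨zero_mem _, fun h => absurd h hv⟩
    · rw [hΔ']; exact Or.inl ⟨hσ, hv⟩
    · rintro p hp _ rfl
      rw [sub_zero]; exact hp.1
    · exact fun w _ u _ x hx _ => hx
    · have := add_mem (mem_reesMonoid_zero (W := {0}) hp.1)
        (mem_reesMonoid_one (σ := σ) (Set.mem_singleton (0 : Fin d → ℤ)))
      simpa using this

/-- Adding a multiple of `w` brings `c` into `S_σ`, because `σ ∩ w^⊥` is a face. Its height is then
at least `N l m'` since `c` is nonnegative at `v`, so `Fan.exists_mem_reesMonoid` applies. -/
lemma Fan.hasIntegralReesCharts_stellar {d : ℕ} (Δ : Fan d) {v : Fin d → ℤ} {σ : Cone d}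
    (hσ : σ ∈ Δ.cones) {l : ℕ} (hl : 0 < l) :
    HasIntegralReesCharts σ (Δ.stellarMonomials σ v l) (stellarCone σ v) := by
  intro w hw c hc
  by_cases hv : latticePt v ∈ σ
  · have hwσ := Δ.stellarMonomials_subset l hw
    rw [stellarMonomials, if_pos hv] at hw
    rw [stellarCone, if_pos hv, mem_charMonoid_rayCone_sup] at hc
    obtain ⟨N, hN⟩ := exists_nsmul_add_mem (Δ.rational σ hσ) hwσ (fun _ => Iff.rfl) hc.2
    refine ⟨N, hN, Δ.exists_mem_reesMonoid hσ hv hl hN ?_⟩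
    obtain ⟨u, hu, huv, rfl⟩ := hw
    rw [add_dotProduct, smul_dotProduct, smul_dotProduct, huv, nsmul_eq_mul, nsmul_eq_mul]
    push_cast
    linarith [hc.1]
  · rw [stellarMonomials, if_neg hv] at hw ⊢
    rw [stellarCone, if_neg hv] at hc
    obtain rfl : w = 0 := hw
    refine ⟨0, by simpa using hc, 1, one_pos, ?_⟩
    simpa using mem_reesMonoid_zero hc

/-- For large `l` a single copy of `w = l • u` suffices: on generators of `σ` where `u` is positive,
`l` outweighs `c`, and on those where `u` vanishes `c` is nonnegative already. The height condition
holds because `c` is nonnegative at `v`. -/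
lemma Fan.hasReesCharts_stellar {d : ℕ} (Δ Δ' : Fan d) {v : Fin d → ℤ}
    (hΔ' : Δ'.cones = Δ.stellar v) :
    ∀ᶠ l in Filter.atTop, ∀ σ ∈ Δ.cones,
      HasReesCharts σ (divisorMonomials σ v (l * Δ.heightLcm v)) (Δ.stellarMonomials σ v l)
        (stellarCone σ v) := by
  rw [Filter.eventually_all_finite Δ.finite]
  intro σ hσ
  by_cases hv : latticePt v ∈ σ
  · have key : ∀ γ ∈ Δ'.cones, ∃ G : Finset (Fin d → ℤ), AddSubmonoid.closure (G : Set _) =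
        charMonoid γ := fun γ hγ => (Δ'.rational γ hγ).fg_charMonoid
    choose! G hG using key
    obtain ⟨s, hs⟩ := Δ.rational σ hσ
    have hint : ∀ u, u ∈ charMonoid σ ↔ ∀ w ∈ s, 0 ≤ u ⬝ᵥ w := fun u => by
      rw [← hs, mem_charMonoid_hull]
    -- The cones attached to the monomials `w` change with `l`, but all are among the finitely many
    -- cones of `Δ'`. The bound is therefore imposed on generators of the monoids of all these cones
    -- at once.
    have hev : ∀ᶠ l : ℕ in Filter.atTop, ∀ γ ∈ Δ'.cones, ∀ c ∈ G γ, ∀ x ∈ s,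
        -(l : ℤ) ≤ c ⬝ᵥ x := by
      rw [Filter.eventually_all_finite Δ'.finite]
      intro γ _
      rw [Filter.eventually_all_finset]
      intro c _
      rw [Filter.eventually_all_finset]
      intro x _
      filter_upwards [Filter.eventually_ge_atTop (c ⬝ᵥ x).natAbs] with l hl
      omega
    filter_upwards [hev, Filter.eventually_gt_atTop 0] with l hl hl0
    have hlb := isLocalBlowup_stellar hΔ' hσ hl0
    intro w hw
    have hγ := hlb.cone_mem w hw
    have hwσ := Δ.stellarMonomials_subset l hw
    suffices H : charMonoid (stellarCone σ v w) ≤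
        (({ carrier := {c | ∃ N : ℕ, (c + N • w, N) ∈
              reesMonoid σ (divisorMonomials σ v (l * Δ.heightLcm v))}
            zero_mem' := ⟨0, by simpa using mem_reesMonoid_zero (zero_mem _)⟩
            add_mem' := by
              rintro a b ⟨N, hN⟩ ⟨N', hN'⟩
              refine ⟨N + N', ?_⟩
              have := add_mem hN hN'
              rwa [Prod.mk_add_mk, add_add_add_comm, ← add_smul] at this } :
          AddSubmonoid (Fin d → ℤ))) from fun c hc => H hc
    rw [← hG _ hγ, AddSubmonoid.closure_le]
    intro c hc
    have hcγ : c ∈ charMonoid (stellarCone σ v w) := hG _ hγ ▸ AddSubmonoid.subset_closure hc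
    have hcl := hl _ hγ c hc
    rw [stellarCone, if_pos hv, mem_charMonoid_rayCone_sup] at hcγ
    rw [stellarMonomials, if_pos hv] at hw
    obtain ⟨u, hu, huv, rfl⟩ := hw
    refine ⟨1, mem_reesMonoid_one ⟨(hint _).2 fun x hx => ?_, fun _ => ?_⟩⟩
    · rw [one_smul, add_dotProduct, smul_dotProduct, nsmul_eq_mul]
      have hux := (hint u).1 hu x hx
      rcases hux.eq_or_lt with h0 | h0
      · rw [← h0, mul_zero, add_zero]
        have hxσ : latticePt x ∈ σ := hs ▸ PointedCone.subset_hull ⟨x, hx, rfl⟩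
        refine dotProduct_nonneg_of_mem hcγ.2 ⟨hxσ, ?_⟩
        rw [latticePt_dotProduct, smul_dotProduct, ← h0, smul_zero, Int.cast_zero]
      · have := hcl x hx
        nlinarith
    · rw [one_smul, add_dotProduct, smul_dotProduct, huv, nsmul_eq_mul]
      push_cast
      linarith [hcγ.1]
  · refine Filter.Eventually.of_forall fun l w hw c hc => ⟨0, ?_⟩
    rw [stellarCone, if_neg hv] at hc
    simpa using mem_reesMonoid_zero hc

/-! ### The algebras `k[S_σ]` -/

instance {d : ℕ} (σ : Cone d) : TwoUniqueSums (charMonoid σ) :=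
  TwoUniqueSums.of_injective_addHom (charMonoid σ).subtype.toAddHom Subtype.val_injective
    inferInstance

instance isDomain_charAlgebra (k : Type u) [Field k] {d : ℕ} (σ : Cone d) :
    IsDomain (charAlgebra k σ) :=
  inferInstanceAs (IsDomain (AddMonoidAlgebra k (charMonoid σ)))

lemma IsRational.isNoetherianRing {d : ℕ} {σ : Cone d} (hσ : IsRational σ) (k : Type u) [Field k] :
    IsNoetherianRing (charAlgebra k σ) := by
  have := (AddMonoid.fg_iff_addSubmonoid_fg _).2 hσ.fg_charMonoid
  have := AddMonoidAlgebra.finiteType_of_fg k (charMonoid σ)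
  exact Algebra.FiniteType.isNoetherianRing k _

lemma monomial_zero (k : Type u) [Field k] {d : ℕ} {σ : Cone d} :
    monomial k (0 : charMonoid σ) = 1 := rfl

lemma monomial_add (k : Type u) [Field k] {d : ℕ} {σ : Cone d} (s t : charMonoid σ) :
    monomial k (s + t) = monomial k s * monomial k t := by
  simp [monomial, AddMonoidAlgebra.single_mul_single]

lemma monomial_nsmul (k : Type u) [Field k] {d : ℕ} {σ : Cone d} (n : ℕ) (s : charMonoid σ) :
    monomial k (n • s) = monomial k s ^ n := by
  simp [monomial, AddMonoidAlgebra.single_pow]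

lemma monomial_ne_zero (k : Type u) [Field k] {d : ℕ} {σ : Cone d} (s : charMonoid σ) :
    monomial k s ≠ 0 := by
  simp [monomial]

lemma isUnit_monomial (k : Type u) [Field k] {d : ℕ} {σ : Cone d} (s : charMonoid σ)
    (hs : -(s : Fin d → ℤ) ∈ charMonoid σ) : IsUnit (monomial k s) := by
  refine IsUnit.of_mul_eq_one (monomial k ⟨_, hs⟩) ?_
  rw [← monomial_add, ← monomial_zero]
  congr 1
  ext i
  simp

/-- The element `x` is the fraction `a / b` over `R`, which is integral over the integrally closed
ring `R`. The comparison takes place in the fraction field of `S`. -/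
lemma exists_algebraMap_eq_of_isIntegral {R S : Type*} [CommRing R] [IsDomain R]
    [IsIntegrallyClosed R] [CommRing S] [IsDomain S] [Algebra R S] [FaithfulSMul R S] {x : S}
    (hx : IsIntegral R x) {a b : R} (hb : b ≠ 0) (h : algebraMap R S b * x = algebraMap R S a) :
    ∃ r, algebraMap R S r = x := by
  let K := FractionRing R
  let L := FractionRing S
  have inj : Function.Injective (algebraMap R L) := by
    rw [IsScalarTower.algebraMap_eq R S L]
    exact (IsFractionRing.injective S L).comp (FaithfulSMul.algebraMap_injective R S)
  let φ : K →ₐ[R] L := IsFractionRing.liftAlgHom (g := Algebra.ofId R L) inj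
  have hφ : ∀ r, φ (algebraMap R K r) = algebraMap R L r := fun r => φ.commutes r
  have hb' : algebraMap R L b ≠ 0 := by
    rwa [Ne, map_eq_zero_iff _ inj]
  have hq : φ (algebraMap R K a / algebraMap R K b) = algebraMap S L x := by
    rw [map_div₀, hφ, hφ, div_eq_iff hb', IsScalarTower.algebraMap_apply R S L,
      IsScalarTower.algebraMap_apply R S L, ← h, map_mul, mul_comm]
  have hint : IsIntegral R (algebraMap R K a / algebraMap R K b) := by
    rw [← isIntegral_algHom_iff φ φ.toRingHom.injective, hq]
    exact hx.map (IsScalarTower.toAlgHom R S L)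
  obtain ⟨r, hr⟩ := IsIntegrallyClosed.algebraMap_eq_of_integral hint
  refine ⟨r, IsFractionRing.injective S L ?_⟩
  rw [← hq, ← hr, hφ]
  rfl

/-! ### Gradings and normality of the algebras `k[S_σ]` -/

lemma mem_charMonoid_bot {d : ℕ} (u : Fin d → ℤ) : u ∈ charMonoid (⊥ : Cone d) := by
  rintro x rfl
  simp

/-- The algebra of Laurent polynomials is integrally closed. -/
lemma isIntegrallyClosed_charAlgebra_bot (k : Type u) [Field k] (d : ℕ) :
    IsIntegrallyClosed (charAlgebra k (⊥ : Cone d)) := by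
  classical
  -- For the positive orthant `k[S_σ]` is a polynomial ring, and inverting the product of the
  -- variables gives the Laurent polynomials.
  let s : Finset (Fin d → ℤ) := Finset.univ.image fun i => Pi.single i 1
  let σ : Cone d := PointedCone.hull ℝ (latticePt '' (s : Set (Fin d → ℤ)))
  have hσ : ∀ u, u ∈ charMonoid σ ↔ ∀ i, 0 ≤ u i := by
    intro u
    rw [mem_charMonoid_hull]
    simp [s]
  let e : (Fin d →₀ ℕ) ≃+ charMonoid σ :=
    { toFun := fun f => ⟨fun i => f i, (hσ _).2 fun i => by positivity⟩
      invFun := fun u => Finsupp.equivFunOnFinite.symm fun i => ((u : Fin d → ℤ) i).toNat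
      left_inv := fun f => by ext i; simp
      right_inv := fun u => by
        ext i
        simpa using (hσ u).1 u.2 i
      map_add' := fun f g => by ext i; simp }
  have h1 : IsIntegrallyClosed (charAlgebra k σ) :=
    IsIntegrallyClosed.of_equiv (R := MvPolynomial (Fin d) k)
      (AddMonoidAlgebra.domCongr k k e).toRingEquiv
  have hone : (fun _ => 1 : Fin d → ℤ) ∈ charMonoid σ := (hσ _).2 fun _ => zero_le_one
  have := isLocalization_restrictChar k (bot_le : ⊥ ≤ σ) ⟨s, rfl⟩ ⟨_, hone⟩ (fun x => by
    constructor
    · rintro rfl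
      exact ⟨zero_mem _, dotProduct_zero _⟩
    · rintro ⟨hx, h0⟩
      have hi : ∀ i, 0 ≤ x i := by
        intro i
        have := ((hσ (Pi.single i 1)).2 fun j => by
          by_cases h : j = i
          · subst h; simp
          · simp [h]) x hx
        have e : latticePt (Pi.single i 1 : Fin d → ℤ) = Pi.single i 1 := by
          ext j
          by_cases h : j = i
          · subst h; simp [latticePt]
          · simp [latticePt, h]
        rwa [e, single_one_dotProduct] at this
      have h0' : ∑ i, x i = 0 := by simpa [latticePt, dotProduct] using h0
      rw [Finset.sum_eq_zero_iff_of_nonneg fun i _ => hi i] at h0'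
      exact funext fun i => h0' i (Finset.mem_univ _))
  algebraize [restrictChar k (bot_le : ⊥ ≤ σ)]
  exact isIntegrallyClosed_of_isLocalization _ (Submonoid.powers (monomial k ⟨_, hone⟩))
    (powers_le_nonZeroDivisors_of_noZeroDivisors (monomial_ne_zero k _))

lemma isIntegrallyClosed_of_forall_isIntegral {R S : Type*} [CommRing R] [IsDomain R] [CommRing S]
    [IsDomain S] [IsIntegrallyClosed S] [Algebra R S] [FaithfulSMul R S]
    (h : ∀ y : S, IsIntegral R y → ∃ r, algebraMap R S r = y) : IsIntegrallyClosed R := by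
  let L := FractionRing S
  have inj : Function.Injective (algebraMap R L) := by
    rw [IsScalarTower.algebraMap_eq R S L]
    exact (IsFractionRing.injective S L).comp (FaithfulSMul.algebraMap_injective R S)
  let φ : FractionRing R →ₐ[R] L := IsFractionRing.liftAlgHom (g := Algebra.ofId R L) inj
  refine (isIntegrallyClosed_iff (FractionRing R)).2 fun {x} hx => ?_
  have hx' : IsIntegral R (φ x) := hx.map φ
  obtain ⟨y, hy⟩ := IsIntegrallyClosed.algebraMap_eq_of_integral (R := S) hx'.tower_top
  obtain ⟨r, rfl⟩ := h y ((isIntegral_algHom_iff (IsScalarTower.toAlgHom R S L)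
    (IsFractionRing.injective S L)).1 (by rw [IsScalarTower.coe_toAlgHom', hy]; exact hx'))
  refine ⟨r, φ.toRingHom.injective ?_⟩
  change φ _ = φ x
  rw [φ.commutes, ← hy, IsScalarTower.algebraMap_apply R S L]

/-- The grading of `k[S_σ]` by the pairing with a lattice vector `v` of `σ`. -/
noncomputable def grading (k : Type u) [Field k] {d : ℕ} {σ : Cone d} {v : Fin d → ℤ}
    (hv : latticePt v ∈ σ) : charAlgebra k σ →ₐ[k] Polynomial (charAlgebra k σ) :=
  AddMonoidAlgebra.lift k _ _
    { toFun := fun s =>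
        Polynomial.monomial ((s.toAdd : Fin d → ℤ) ⬝ᵥ v).toNat (monomial k s.toAdd)
      map_one' := by
        rw [toAdd_one, monomial_zero, ZeroMemClass.coe_zero, zero_dotProduct]
        rfl
      map_mul' := fun s t => by
        rw [toAdd_mul, monomial_add, Polynomial.monomial_mul_monomial, AddSubmonoid.coe_add,
          add_dotProduct, Int.toNat_add (dotProduct_nonneg_of_mem s.toAdd.2 hv)
          (dotProduct_nonneg_of_mem t.toAdd.2 hv)] }

lemma grading_monomial (k : Type u) [Field k] {d : ℕ} {σ : Cone d} {v : Fin d → ℤ}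
    (hv : latticePt v ∈ σ) (s : charMonoid σ) :
    grading k hv (monomial k s) =
      Polynomial.monomial ((s : Fin d → ℤ) ⬝ᵥ v).toNat (monomial k s) := by
  rw [grading, monomial, AddMonoidAlgebra.lift_single, one_smul]
  rfl

lemma smul_monomial (k : Type u) [Field k] {d : ℕ} {σ : Cone d} (s : charMonoid σ) (a : k) :
    AddMonoidAlgebra.single s a = a • monomial k s := by
  rw [monomial, AddMonoidAlgebra.smul_single, smul_eq_mul, mul_one]

lemma coeff_grading (k : Type u) [Field k] {d : ℕ} {σ : Cone d} {v : Fin d → ℤ}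
    (hv : latticePt v ∈ σ) (f : charAlgebra k σ) (n : ℕ) (s : charMonoid σ) :
    ((grading k hv f).coeff n).coeff s =
      if (s : Fin d → ℤ) ⬝ᵥ v = n then f.coeff s else 0 := by
  classical
  induction f using AddMonoidAlgebra.induction_linear with
  | zero => simp
  | add f g hf hg =>
    simp only [map_add, Polynomial.coeff_add, AddMonoidAlgebra.coeff_add, Finsupp.add_apply, hf, hg]
    split_ifs <;> simp
  | single t a =>
    have ht := dotProduct_nonneg_of_mem t.2 hv
    rw [smul_monomial, map_smul, grading_monomial, Polynomial.coeff_smul, Polynomial.coeff_monomial]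
    by_cases h : t = s
    · subst h
      have : ((t : Fin d → ℤ) ⬝ᵥ v).toNat = n ↔ (t : Fin d → ℤ) ⬝ᵥ v = n := by omega
      simp only [this]
      split_ifs <;> simp
    · have h0 : ∀ b : k, (b • monomial k t).coeff s = 0 := fun b => by simp [monomial, h]
      simp only [AddMonoidAlgebra.coeff_single, ite_self, ← smul_monomial,
        Finsupp.single_eq_of_ne' h]
      split_ifs
      · exact h0 a
      · rw [smul_zero]; rfl

/-- The grading of the Laurent polynomials by the pairing with `v`. -/
noncomputable def laurentGrading (k : Type u) [Field k] {d : ℕ} (v : Fin d → ℤ) :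
    charAlgebra k (⊥ : Cone d) →ₐ[k] LaurentPolynomial (charAlgebra k (⊥ : Cone d)) :=
  AddMonoidAlgebra.lift k _ _
    { toFun := fun s => AddMonoidAlgebra.single ((s.toAdd : Fin d → ℤ) ⬝ᵥ v) (monomial k s.toAdd)
      map_one' := by
        rw [toAdd_one, monomial_zero, ZeroMemClass.coe_zero, zero_dotProduct]
        rfl
      map_mul' := fun s t => by
        rw [toAdd_mul, monomial_add, AddMonoidAlgebra.single_mul_single, AddSubmonoid.coe_add,
          add_dotProduct] }

lemma laurentGrading_monomial (k : Type u) [Field k] {d : ℕ} (v : Fin d → ℤ)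
    (s : charMonoid (⊥ : Cone d)) : laurentGrading k v (monomial k s) =
      AddMonoidAlgebra.single ((s : Fin d → ℤ) ⬝ᵥ v) (monomial k s) := by
  rw [laurentGrading, monomial, AddMonoidAlgebra.lift_single, one_smul]
  rfl

lemma coeff_laurentGrading (k : Type u) [Field k] {d : ℕ} (v : Fin d → ℤ)
    (f : charAlgebra k (⊥ : Cone d)) (s : charMonoid (⊥ : Cone d)) :
    ((laurentGrading k v f).coeff ((s : Fin d → ℤ) ⬝ᵥ v)).coeff s = f.coeff s := by
  classical
  induction f using AddMonoidAlgebra.induction_linear with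
  | zero => simp
  | add f g hf hg =>
    simp only [map_add, AddMonoidAlgebra.coeff_add, Finsupp.add_apply, hf, hg]
  | single t a =>
    rw [smul_monomial, map_smul, laurentGrading_monomial, AddMonoidAlgebra.coeff_smul,
      AddMonoidAlgebra.coeff_smul, Finsupp.smul_apply, AddMonoidAlgebra.coeff_smul,
      Finsupp.smul_apply, Finsupp.smul_apply]
    congr 1
    by_cases h : t = s
    · subst h
      rw [AddMonoidAlgebra.coeff_single, Finsupp.single_eq_same]
    · have h0 : (monomial k t).coeff s = 0 := by simp [monomial, h]
      rw [h0, AddMonoidAlgebra.coeff_single, Finsupp.single_apply]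
      split_ifs
      · exact h0
      · rfl

lemma coeff_toLaurent_of_neg {R : Type*} [CommRing R] (p : Polynomial R) {n : ℤ} (hn : n < 0) :
    (Polynomial.toLaurent p).coeff n = 0 := by
  induction p using Polynomial.induction_on' with
  | add p q hp hq => rw [map_add, AddMonoidAlgebra.coeff_add, Finsupp.add_apply, hp, hq, add_zero]
  | monomial m r =>
    rw [Polynomial.toLaurent_C_mul_T, ← LaurentPolynomial.single_eq_C_mul_T,
      AddMonoidAlgebra.coeff_single, Finsupp.single_eq_of_ne]
    omega

/-- Scalars have to be compared separately, because the target carries no `k`-algebra structure. -/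
lemma ringHom_ext_monomial {k : Type u} [Field k] {d : ℕ} {σ : Cone d} {R : Type*} [CommRing R]
    {f g : charAlgebra k σ →+* R} (h : ∀ a, f (algebraMap k _ a) = g (algebraMap k _ a))
    (h' : ∀ s, f (monomial k s) = g (monomial k s)) : f = g := by
  refine RingHom.ext fun x => ?_
  induction x using AddMonoidAlgebra.induction_linear with
  | zero => simp
  | add x y hx hy => rw [map_add, map_add, hx, hy]
  | single s a => rw [smul_monomial, Algebra.smul_def, map_mul, map_mul, h, h']

lemma restrictChar_algebraMap (k : Type u) [Field k] {d : ℕ} {τ σ : Cone d} (h : τ ≤ σ) (a : k) :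
    restrictChar k h (algebraMap k _ a) = algebraMap k _ a := by
  have (γ : Cone d) : algebraMap k (charAlgebra k γ) a = AddMonoidAlgebra.single 0 a := by
    rw [smul_monomial, monomial_zero, Algebra.algebraMap_eq_smul_one]
  rw [this, this, restrictChar, AddMonoidAlgebra.mapDomainRingHom_apply,
    AddMonoidAlgebra.mapDomain_single, map_zero]

lemma mem_range_restrictChar (k : Type u) [Field k] {d : ℕ} {τ σ : Cone d} (hle : τ ≤ σ)
    {f : charAlgebra k τ}
    (h : ∀ s : charMonoid τ, f.coeff s ≠ 0 → (s : Fin d → ℤ) ∈ charMonoid σ) :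
    ∃ g, restrictChar k hle g = f := by
  change f ∈ (restrictChar k hle).range
  rw [← AddMonoidAlgebra.sum_coeff_single f]
  refine sum_mem fun s hs => ?_
  refine ⟨AddMonoidAlgebra.single ⟨s, h s (Finsupp.mem_support_iff.1 hs)⟩ (f.coeff s), ?_⟩
  simp [restrictChar, AddSubmonoid.inclusion]

/-- For a Laurent polynomial `y` integral over `k[S_σ]` and a generator `v` of `σ`, the `v`-graded
image of `y` is integral over the polynomial ring `k[M][T]`. That ring is integrally closed, so no
exponent of `y` is negative at `v`. -/
lemma isIntegrallyClosed_charAlgebra (k : Type u) [Field k] {d : ℕ} {σ : Cone d}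
    (hσ : IsRational σ) : IsIntegrallyClosed (charAlgebra k σ) := by
  have := isIntegrallyClosed_charAlgebra_bot k d
  let := (restrictChar k (bot_le : ⊥ ≤ σ)).toAlgebra
  have : FaithfulSMul (charAlgebra k σ) (charAlgebra k (⊥ : Cone d)) :=
    (faithfulSMul_iff_algebraMap_injective _ _).2 (restrictChar_injective k bot_le)
  refine isIntegrallyClosed_of_forall_isIntegral (S := charAlgebra k (⊥ : Cone d)) fun y hy => ?_
  obtain ⟨s, rfl⟩ := hσ
  refine mem_range_restrictChar k (bot_le : ⊥ ≤ _) fun u hu => mem_charMonoid_hull.2 fun v hv => ?_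
  have hv' : latticePt v ∈ PointedCone.hull ℝ (latticePt '' (s : Set (Fin d → ℤ))) :=
    PointedCone.subset_hull ⟨v, hv, rfl⟩
  have hint : IsIntegral (Polynomial (charAlgebra k (⊥ : Cone d))) (laurentGrading k v y) := by
    refine IsIntegral.map_of_comp_eq ((Polynomial.mapRingHom (restrictChar k bot_le)).comp
      (grading k hv').toRingHom) (laurentGrading k v).toRingHom
      (ringHom_ext_monomial (fun a => ?_) fun t => ?_) hy
    · change Polynomial.toLaurent (Polynomial.mapRingHom (restrictChar k bot_le)
        (grading k hv' (algebraMap k _ a))) = laurentGrading k v (restrictChar k bot_le _)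
      rw [AlgHom.commutes, restrictChar_algebraMap, AlgHom.commutes, Polynomial.algebraMap_apply,
        Polynomial.coe_mapRingHom, Polynomial.map_C, Polynomial.toLaurent_C,
        restrictChar_algebraMap]
      rfl
    · change Polynomial.toLaurent (Polynomial.mapRingHom (restrictChar k bot_le)
        (grading k hv' (monomial k t))) = laurentGrading k v (restrictChar k bot_le _)
      rw [grading_monomial, restrictChar_monomial, laurentGrading_monomial,
        Polynomial.coe_mapRingHom, Polynomial.map_monomial, Polynomial.toLaurent_C_mul_T,
        Int.toNat_of_nonneg (dotProduct_nonneg_of_mem t.2 hv'), restrictChar_monomial,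
        ← LaurentPolynomial.single_eq_C_mul_T]
      rfl
  have : FaithfulSMul (Polynomial (charAlgebra k (⊥ : Cone d)))
      (LaurentPolynomial (charAlgebra k (⊥ : Cone d))) :=
    (faithfulSMul_iff_algebraMap_injective _ _).2 Polynomial.toLaurent_injective
  -- Multiplication by `T^n` clears the negative powers and presents the graded image as a fraction
  -- over the polynomial ring.
  obtain ⟨n, f, hf⟩ := LaurentPolynomial.exists_T_pow (laurentGrading k v y)
  obtain ⟨r, hr⟩ := exists_algebraMap_eq_of_isIntegral hint
    (pow_ne_zero n (Polynomial.X_ne_zero (R := charAlgebra k (⊥ : Cone d)))) (a := f) (by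
      rw [mul_comm]
      exact (congrArg _ (Polynomial.toLaurent_X_pow n)).trans hf.symm)
  by_contra! hneg
  rw [← coeff_laurentGrading k v, ← hr] at hu
  exact hu (by rw [show algebraMap _ _ r = Polynomial.toLaurent r from rfl,
    coeff_toLaurent_of_neg r hneg]; rfl)

/-! ### Monomial ideals and the primes of the rays -/

/-- The ideal of `k[S_σ]` generated by the monomials of `P`. -/
noncomputable def monomialIdeal (k : Type u) [Field k] {d : ℕ} (σ : Cone d) (P : Set (Fin d → ℤ)) :
    Ideal (charAlgebra k σ) :=
  Ideal.span {f | ∃ s : charMonoid σ, (s : Fin d → ℤ) ∈ P ∧ f = monomial k s}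

lemma monomial_mem_monomialIdeal {k : Type u} [Field k] {d : ℕ} {σ : Cone d}
    {P : Set (Fin d → ℤ)} {s : charMonoid σ} (hs : (s : Fin d → ℤ) ∈ P) :
    monomial k s ∈ monomialIdeal k σ P :=
  Ideal.subset_span ⟨s, hs, rfl⟩

/-- The grading turns order of vanishing along the ray into `X`-adic order, so primality of `X`
yields both the prime of the ray and its symbolic powers. -/
lemma X_pow_dvd_grading_iff (k : Type u) [Field k] {d : ℕ} {σ : Cone d} {v : Fin d → ℤ}
    (hv : latticePt v ∈ σ) (f : charAlgebra k σ) (n : ℕ) :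
    Polynomial.X ^ n ∣ grading k hv f ↔
      ∀ s : charMonoid σ, f.coeff s ≠ 0 → (n : ℤ) ≤ (s : Fin d → ℤ) ⬝ᵥ v := by
  rw [Polynomial.X_pow_dvd_iff]
  constructor
  · intro h s hs
    by_contra! hlt
    have h0 := dotProduct_nonneg_of_mem s.2 hv
    have := coeff_grading k hv f ((s : Fin d → ℤ) ⬝ᵥ v).toNat s
    rw [h _ (by omega), if_pos (by omega)] at this
    exact hs this.symm
  · intro h m hm
    ext s
    rw [coeff_grading]
    split_ifs with h'
    · by_contra h0
      have := h s h0
      omega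
    · rfl

lemma mem_divisorIdeal_iff (k : Type u) [Field k] {d : ℕ} {σ : Cone d} {v : Fin d → ℤ}
    (hv : latticePt v ∈ σ) (f : charAlgebra k σ) (n : ℕ) :
    f ∈ monomialIdeal k σ (Fan.divisorMonomials σ v n) ↔ Polynomial.X ^ n ∣ grading k hv f := by
  constructor
  · intro h
    refine Submodule.span_induction (p := fun f _ => Polynomial.X ^ n ∣ grading k hv f)
      ?_ (by simp) (fun f g _ _ hf hg => ?_) (fun a f _ hf => ?_) h
    · rintro _ ⟨s, hs, rfl⟩
      rw [grading_monomial, ← mul_one (monomial k s), ← Polynomial.C_mul_X_pow_eq_monomial]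
      exact (pow_dvd_pow _ (by have := hs.2 hv; omega)).mul_left _
    · rw [map_add]; exact dvd_add hf hg
    · rw [smul_eq_mul, map_mul]; exact hf.mul_left _
  · intro h
    rw [X_pow_dvd_grading_iff] at h
    rw [← AddMonoidAlgebra.sum_coeff_single f]
    refine sum_mem fun s hs => ?_
    rw [smul_monomial]
    exact Submodule.smul_of_tower_mem _ _ (monomial_mem_monomialIdeal
      ⟨s.2, fun _ => h s (Finsupp.mem_support_iff.1 hs)⟩)

/-- The prime of `k[S_σ]` generated by the monomials that vanish along the ray of `v`. -/
noncomputable def rayPrime (k : Type u) [Field k] {d : ℕ} {σ : Cone d} {v : Fin d → ℤ}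
    (hv : latticePt v ∈ σ) : PrimeSpectrum (charAlgebra k σ) :=
  PrimeSpectrum.comap (grading k hv).toRingHom
    ⟨Ideal.span {Polynomial.X}, (Ideal.span_singleton_prime Polynomial.X_ne_zero).2
      Polynomial.prime_X⟩

lemma mem_rayPrime (k : Type u) [Field k] {d : ℕ} {σ : Cone d} {v : Fin d → ℤ}
    (hv : latticePt v ∈ σ) (f : charAlgebra k σ) :
    f ∈ (rayPrime k hv).asIdeal ↔ Polynomial.X ∣ grading k hv f :=
  Ideal.mem_span_singleton

lemma mem_rayPrime_iff (k : Type u) [Field k] {d : ℕ} {σ : Cone d} {v : Fin d → ℤ}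
    (hv : latticePt v ∈ σ) (f : charAlgebra k σ) :
    f ∈ (rayPrime k hv).asIdeal ↔
      ∀ s : charMonoid σ, f.coeff s ≠ 0 → 0 < (s : Fin d → ℤ) ⬝ᵥ v := by
  rw [mem_rayPrime, ← pow_one Polynomial.X, X_pow_dvd_grading_iff]
  rfl

lemma rayPrime_asIdeal (k : Type u) [Field k] {d : ℕ} {σ : Cone d} {v : Fin d → ℤ}
    (hv : latticePt v ∈ σ) :
    (rayPrime k hv).asIdeal = monomialIdeal k σ (Fan.divisorMonomials σ v 1) := by
  ext f
  rw [mem_rayPrime, mem_divisorIdeal_iff k hv, pow_one]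

lemma monomial_mem_rayPrime {k : Type u} [Field k] {d : ℕ} {σ : Cone d} {v : Fin d → ℤ}
    (hv : latticePt v ∈ σ) (s : charMonoid σ) :
    monomial k s ∈ (rayPrime k hv).asIdeal ↔ 0 < (s : Fin d → ℤ) ⬝ᵥ v := by
  rw [mem_rayPrime_iff]
  constructor
  · intro h
    exact h s (by simp [monomial])
  · intro h t ht
    obtain rfl : t = s := by
      by_contra hne
      exact ht (by simp [monomial, Ne.symm hne])
    exact h

lemma comap_rayPrime (k : Type u) [Field k] {d : ℕ} {τ σ : Cone d} (hle : τ ≤ σ) {v : Fin d → ℤ}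
    (hv : latticePt v ∈ τ) :
    PrimeSpectrum.comap (restrictChar k hle) (rayPrime k hv) = rayPrime k (hle hv) := by
  ext f
  change restrictChar k hle f ∈ (rayPrime k hv).asIdeal ↔ _
  rw [mem_rayPrime_iff, mem_rayPrime_iff]
  have key : ∀ s : charMonoid σ, (restrictChar k hle f).coeff
      (AddSubmonoid.inclusion (charMonoid_anti hle) s) = f.coeff s := fun s =>
    Finsupp.mapDomain_apply (AddSubmonoid.inclusion_injective _) _ _
  constructor
  · intro h s hs
    exact h (AddSubmonoid.inclusion (charMonoid_anti hle) s) (by rwa [key])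
  · intro h s hs
    by_cases hsσ : (s : Fin d → ℤ) ∈ charMonoid σ
    · exact h ⟨s, hsσ⟩ (by rw [← key]; exact hs)
    · refine absurd (Finsupp.mapDomain_of_notMem_range f.coeff s ?_) hs
      rintro ⟨t, rfl⟩
      exact hsσ t.2

/-- Up to monomials that do not vanish along the ray of `v`, every monomial is a power of a
uniformizer. -/
lemma Fan.exists_uniformizer {d : ℕ} (Δ : Fan d) {σ : Cone d} (hσ : σ ∈ Δ.cones)
    {v : Fin d → ℤ} (hv : v ∈ Δ.raysOf σ) :
    ∃ t : charMonoid σ, (t : Fin d → ℤ) ⬝ᵥ v = 1 ∧ ∀ s : charMonoid σ, ∃ a b : charMonoid σ,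
      (a : Fin d → ℤ) ⬝ᵥ v = 0 ∧ (b : Fin d → ℤ) ⬝ᵥ v = 0 ∧
      a + s = b + ((s : Fin d → ℤ) ⬝ᵥ v).toNat • t := by
  obtain ⟨t, ht, htv⟩ := Δ.exists_dotProduct_eq_one hσ hv
  obtain ⟨u, hu, huf⟩ := Δ.isFace_rayCone hv.1 hσ hv.2
  have huv : u ⬝ᵥ v = 0 := by
    have := ((huf _).1 (latticePt_mem_rayCone v)).2
    rw [latticePt_dotProduct] at this
    exact_mod_cast this
  refine ⟨⟨t, ht⟩, htv, fun s => ?_⟩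
  have hs0 := dotProduct_nonneg_of_mem s.2 hv.2
  have hr : ((s : Fin d → ℤ) - ((s : Fin d → ℤ) ⬝ᵥ v) • t) ⬝ᵥ v = 0 := by
    rw [sub_dotProduct, smul_dotProduct, htv, smul_eq_mul, mul_one, sub_self]
  obtain ⟨N, hN⟩ := exists_nsmul_add_mem (Δ.rational σ hσ) hu huf (mem_charMonoid_rayCone.2 hr.ge)
  refine ⟨⟨N • u, nsmul_mem (S := charMonoid σ) hu N⟩, ⟨_, hN⟩, ?_, ?_, Subtype.ext ?_⟩
  · change (N • u) ⬝ᵥ v = 0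
    rw [smul_dotProduct, huv, smul_zero]
  · change (_ + N • u) ⬝ᵥ v = 0
    rw [add_dotProduct, hr, smul_dotProduct, huv, smul_zero, add_zero]
  · change N • u + (s : Fin d → ℤ) = (s - ((s : Fin d → ℤ) ⬝ᵥ v) • t + N • u) +
      ((s : Fin d → ℤ) ⬝ᵥ v).toNat • t
    rw [← natCast_zsmul t, Int.toNat_of_nonneg hs0]
    abel

/-- The symbolic powers of the prime of a ray. -/
lemma Fan.comap_maximalIdeal_pow (k : Type u) [Field k] {d : ℕ} (Δ : Fan d) {σ : Cone d}
    (hσ : σ ∈ Δ.cones) {v : Fin d → ℤ} (hv : v ∈ Δ.raysOf σ) (R : Type*) [CommRing R]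
    [Algebra (charAlgebra k σ) R] [IsLocalRing R]
    [IsLocalization.AtPrime R (rayPrime k hv.2).asIdeal] (n : ℕ) :
    (IsLocalRing.maximalIdeal R ^ n).comap (algebraMap (charAlgebra k σ) R) =
      monomialIdeal k σ (divisorMonomials σ v n) := by
  have hv' := hv.2
  refine le_antisymm (fun f hf => ?_) (Ideal.span_le.2 ?_)
  · rw [Ideal.mem_comap, ← IsLocalization.AtPrime.map_eq_maximalIdeal (rayPrime k hv.2).asIdeal R,
      ← Ideal.map_pow, IsLocalization.algebraMap_mem_map_algebraMap_iff
        (rayPrime k hv.2).asIdeal.primeCompl] at hf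
    obtain ⟨m, hm, hmf⟩ := hf
    have hle : (rayPrime k hv.2).asIdeal ^ n ≤
        Ideal.comap (grading k hv.2).toRingHom (Ideal.span {Polynomial.X ^ n}) := by
      rw [← Ideal.span_singleton_pow]
      exact Ideal.le_comap_pow _ n
    have h1 := Ideal.mem_span_singleton.1 (hle hmf)
    change _ ∣ grading k hv.2 (m * f) at h1
    rw [map_mul] at h1
    rw [mem_divisorIdeal_iff k hv.2]
    exact Polynomial.prime_X.pow_dvd_of_dvd_mul_left n
      (fun h => hm ((mem_rayPrime k hv.2 m).2 h)) h1
  · rintro _ ⟨s, hs, rfl⟩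
    obtain ⟨t, ht, H⟩ := Δ.exists_uniformizer hσ hv
    obtain ⟨a, b, ha, hb, hab⟩ := H s
    rw [SetLike.mem_coe, Ideal.mem_comap,
      ← IsLocalization.AtPrime.map_eq_maximalIdeal (rayPrime k hv.2).asIdeal R,
      ← Ideal.map_pow, IsLocalization.algebraMap_mem_map_algebraMap_iff
        (rayPrime k hv.2).asIdeal.primeCompl]
    refine ⟨monomial k a, fun h => ?_, ?_⟩
    · rw [SetLike.mem_coe, monomial_mem_rayPrime, ha] at h
      exact lt_irrefl _ h
    · rw [← monomial_add, hab, monomial_add, monomial_nsmul]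
      refine Ideal.mul_mem_left _ _ (Ideal.pow_le_pow_right (m := n) ?_ (Ideal.pow_mem_pow
        ((monomial_mem_rayPrime hv.2 t).2 (by rw [ht]; exact one_pos)) _))
      have := hs.2 hv.2
      omega

lemma Fan.rayPrime_ne_bot (k : Type u) [Field k] {d : ℕ} (Δ : Fan d) {σ : Cone d}
    (hσ : σ ∈ Δ.cones) {v : Fin d → ℤ} (hv : v ∈ Δ.raysOf σ) : (rayPrime k hv.2).asIdeal ≠ ⊥ := by
  obtain ⟨t, ht, -⟩ := Δ.exists_uniformizer hσ hv
  intro h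
  have := (monomial_mem_rayPrime (k := k) hv.2 t).2 (by omega)
  rw [h] at this
  exact monomial_ne_zero k t this

/-- By Krull's theorem it suffices that the prime is minimal over the uniformizer. A prime between
them contains each `t^s` of positive height, because a monomial outside the prime of the ray times
`t^s` is a multiple of the uniformizer. -/
lemma Fan.height_rayPrime (k : Type u) [Field k] {d : ℕ} (Δ : Fan d) {σ : Cone d}
    (hσ : σ ∈ Δ.cones) {v : Fin d → ℤ} (hv : v ∈ Δ.raysOf σ) :
    (rayPrime k hv.2).asIdeal.height = 1 := by
  have := (Δ.rational σ hσ).isNoetherianRing k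
  obtain ⟨t, ht, H⟩ := Δ.exists_uniformizer hσ hv
  refine le_antisymm (Ideal.height_le_one_of_isPrincipal_of_mem_minimalPrimes
    (Ideal.span {monomial k t}) _ ⟨⟨(rayPrime k hv.2).isPrime, ?_⟩, fun q hq hle => ?_⟩) ?_
  · rw [Ideal.span_singleton_le_iff_mem, monomial_mem_rayPrime, ht]
    exact one_pos
  · rw [rayPrime_asIdeal, monomialIdeal, Ideal.span_le]
    rintro _ ⟨s, hs, rfl⟩
    have hq1 := hq.1
    obtain ⟨a, b, ha, hb, hab⟩ := H s
    have hs1 : (1 : ℤ) ≤ (s : Fin d → ℤ) ⬝ᵥ v := hs.2 hv.2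
    have hmem : monomial k a * monomial k s ∈ q := by
      rw [← monomial_add, hab, monomial_add, monomial_nsmul]
      refine Ideal.mul_mem_left _ _ (Ideal.pow_mem_of_mem _ ?_ _ (by omega))
      exact hq.2 (Ideal.mem_span_singleton_self _)
    refine (hq1.mem_or_mem hmem).resolve_left fun h => ?_
    have := (monomial_mem_rayPrime hv.2 a).1 (hle h)
    omega
  · rw [Order.one_le_iff_ne_zero, Ne, Ideal.height_eq_zero_iff, IsDomain.minimalPrimes_eq_singleton_bot]
    exact Δ.rayPrime_ne_bot k hσ hv

/-- In the local ring `t^s` is a unit times a power of the uniformizer, with exponent `s ⬝ᵥ v`, and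
the uniformizer generates the maximal ideal. -/
lemma Fan.ordMonomial_rayPrime (k : Type u) [Field k] {d : ℕ} (Δ : Fan d) {σ : Cone d}
    (hσ : σ ∈ Δ.cones) {v : Fin d → ℤ} (hv : v ∈ Δ.raysOf σ) (s : charMonoid σ) :
    ordMonomial (rayPrime k hv.2) s = ((s : Fin d → ℤ) ⬝ᵥ v).toNat := by
  obtain ⟨t, ht, H⟩ := Δ.exists_uniformizer hσ hv
  obtain ⟨a, b, ha, hb, hab⟩ := H s
  let R := Localization.AtPrime (rayPrime k hv.2).asIdeal
  have hunit : ∀ a : charMonoid σ, (a : Fin d → ℤ) ⬝ᵥ v = 0 →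
      IsUnit (algebraMap (charAlgebra k σ) R (monomial k a)) := by
    intro a ha
    rw [IsLocalization.AtPrime.isUnit_to_map_iff R (rayPrime k hv.2).asIdeal]
    intro h
    rw [SetLike.mem_coe, monomial_mem_rayPrime, ha] at h
    exact lt_irrefl _ h
  have ht0 : algebraMap (charAlgebra k σ) R (monomial k t) ∈ nonZeroDivisors R := by
    refine IsLocalization.map_nonZeroDivisors_le (rayPrime k hv.2).asIdeal.primeCompl R
      ⟨_, mem_nonZeroDivisors_of_ne_zero (monomial_ne_zero k t), rfl⟩
  have hmax : IsLocalRing.maximalIdeal R =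
      Ideal.span {algebraMap (charAlgebra k σ) R (monomial k t)} := by
    rw [← IsLocalization.AtPrime.map_eq_maximalIdeal (rayPrime k hv.2).asIdeal R]
    refine le_antisymm (Ideal.map_le_iff_le_comap.2 ((rayPrime_asIdeal k hv.2).trans_le
      (Ideal.span_le.2 ?_))) ?_
    · rintro _ ⟨s, hs, rfl⟩
      obtain ⟨a, b, ha, hb, hab⟩ := H s
      have hs1 : (1 : ℤ) ≤ (s : Fin d → ℤ) ⬝ᵥ v := hs.2 hv.2
      rw [SetLike.mem_coe, Ideal.mem_comap, Ideal.mem_span_singleton,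
        ← (hunit a ha).dvd_mul_left, ← map_mul, ← monomial_add, hab, monomial_add, monomial_nsmul,
        map_mul, map_pow]
      exact (dvd_pow_self _ (by omega)).mul_left _
    · rw [Ideal.span_singleton_le_iff_mem]
      exact Ideal.mem_map_of_mem _ ((monomial_mem_rayPrime hv.2 t).2 (by omega))
  have h1 : Ring.ord R (algebraMap (charAlgebra k σ) R (monomial k t)) = 1 := by
    rw [Ring.ord, Module.length_eq_one_iff, ← hmax]
    exact isSimpleModule_iff_quot_maximal.2 ⟨_, inferInstance, ⟨LinearEquiv.refl _ _⟩⟩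
  have h2 := congrArg (Ring.ord R) (congrArg (algebraMap (charAlgebra k σ) R)
    (congrArg (monomial k) hab))
  rw [monomial_add, monomial_add, monomial_nsmul, map_mul, map_mul, map_pow,
    Ring.ord_mul_of_isUnit_left (hunit a ha), Ring.ord_mul_of_isUnit_left (hunit b hb),
    Ring.ord_pow ht0, h1] at h2
  rw [ordMonomial, h2, nsmul_eq_mul, mul_one]

/-- A prime of height one that is generated by monomials comes from the prime of a ray on the
chart of a face. -/
lemma Fan.exists_eq_rayPrime (k : Type u) [Field k] {d : ℕ} (Δ : Fan d) {σ : Cone d}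
    (hσ : σ ∈ Δ.cones) (p : PrimeSpectrum (charAlgebra k σ))
    (hp : p.asIdeal = Ideal.span {f | f ∈ p.asIdeal ∧ ∃ s, f = monomial k s})
    (h : p.asIdeal.height = 1) :
    ∃ v, ∃ hv : v ∈ Δ.raysOf σ, p = rayPrime k hv.2 := by
  classical
  obtain ⟨G, hG⟩ := (Δ.rational σ hσ).fg_charMonoid
  have hGσ : ∀ g ∈ G, g ∈ charMonoid σ := fun g hg => hG ▸ AddSubmonoid.subset_closure hg
  -- The exponents of monomials outside `p` form a face of the monoid `S_σ`, since `p` is prime.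
  let F : AddSubmonoid (Fin d → ℤ) :=
    { carrier := {s | ∃ hs : s ∈ charMonoid σ, monomial k ⟨s, hs⟩ ∉ p.asIdeal}
      zero_mem' := ⟨zero_mem _, fun h0 => p.isPrime.ne_top ((Ideal.eq_top_iff_one _).2 h0)⟩
      add_mem' := by
        rintro a b ⟨ha, ha'⟩ ⟨hb, hb'⟩
        refine ⟨add_mem ha hb, fun hab => ?_⟩
        rw [show (⟨a + b, add_mem ha hb⟩ : charMonoid σ) = ⟨a, ha⟩ + ⟨b, hb⟩ from rfl,
          monomial_add] at hab
        exact (p.isPrime.mem_or_mem hab).elim ha' hb' }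
  have hface : ∀ a ∈ charMonoid σ, ∀ b ∈ charMonoid σ, a + b ∈ F → a ∈ F := by
    rintro a ha b hb ⟨hab, hab'⟩
    refine ⟨ha, fun h0 => hab' ?_⟩
    rw [show (⟨a + b, hab⟩ : charMonoid σ) = ⟨a, ha⟩ + ⟨b, hb⟩ from rfl, monomial_add]
    exact Ideal.mul_mem_right _ _ h0
  -- The sum of the generators of that face bounds each of its elements up to a multiple, so the
  -- face of `σ` orthogonal to `u` corresponds to `F`.
  let u : Fin d → ℤ := ∑ g ∈ G.filter (· ∈ F), g
  have huF : u ∈ F := sum_mem fun g hg => (Finset.mem_filter.1 hg).2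
  obtain ⟨huσ, hup⟩ := huF
  have hdom : ∀ s ∈ F, ∃ n : ℕ, n • u - s ∈ charMonoid σ := by
    intro s hs
    obtain ⟨hsσ, -⟩ := id hs
    rw [← hG] at hsσ
    refine AddSubmonoid.closure_induction
      (motive := fun s _ => s ∈ F → ∃ n : ℕ, n • u - s ∈ charMonoid σ) ?_ ?_ ?_ hsσ hs
    · intro g hg hgF
      refine ⟨1, ?_⟩
      rw [one_smul, show u = ∑ g ∈ G.filter (· ∈ F), g from rfl,
        ← Finset.add_sum_erase _ _ (Finset.mem_filter.2 ⟨hg, hgF⟩), add_sub_cancel_left]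
      exact sum_mem fun g hg => hGσ g (Finset.mem_filter.1 (Finset.mem_of_mem_erase hg)).1
    · exact fun _ => ⟨0, by simp⟩
    · intro a b ha hb iha ihb hab
      rw [hG] at ha hb
      obtain ⟨n, hn⟩ := iha (hface a ha b hb hab)
      obtain ⟨m, hm⟩ := ihb (hface b hb a ha (by rwa [add_comm]))
      refine ⟨n + m, ?_⟩
      have := add_mem hn hm
      rwa [show n • u - a + (m • u - b) = (n + m) • u - (a + b) by rw [add_smul]; abel] at this
  have hτ : zeroFace σ u ∈ Δ.cones := Δ.zeroFace_mem hσ huσ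
  have hle : zeroFace σ u ≤ σ := zeroFace_le σ u
  have hpr : p ∈ Set.range (PrimeSpectrum.comap (restrictChar k hle)) := by
    rw [range_restrictChar k hle (Δ.rational σ hσ) ⟨u, huσ⟩ fun _ => Iff.rfl]
    exact hup
  -- If that face of `σ` is zero, all monomials become units on its chart, so `p` contains none and
  -- is zero, against height one. Otherwise the prime of any of its rays lies in `p`, and equal
  -- heights force equality.
  by_cases hbot : zeroFace σ u = ⊥
  · exfalso
    have hall : ∀ s : charMonoid σ, monomial k s ∉ p.asIdeal := by
      intro s hs
      obtain ⟨q, hq⟩ := hpr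
      rw [← hq] at hs
      refine q.isPrime.ne_top (Ideal.eq_top_of_isUnit_mem _ (Ideal.mem_comap.1 hs) ?_)
      rw [restrictChar_monomial]
      refine isUnit_monomial k _ ?_
      exact hbot.symm.subst (motive := fun γ => _ ∈ charMonoid γ) (mem_charMonoid_bot _)
    have : p.asIdeal = ⊥ := by
      rw [hp, Ideal.span_eq_bot]
      rintro f ⟨hf, s, rfl⟩
      exact absurd hf (hall s)
    rw [this, Ideal.height_bot] at h
    exact zero_ne_one h
  · obtain ⟨v, hv⟩ := Δ.exists_mem_raysOf hτ hbot
    have hvσ : v ∈ Δ.raysOf σ := ⟨hv.1, hle hv.2⟩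
    refine ⟨v, hvσ, ?_⟩
    have hle' : (rayPrime k hvσ.2).asIdeal ≤ p.asIdeal := by
      rw [rayPrime_asIdeal, monomialIdeal, Ideal.span_le]
      rintro _ ⟨s, hs, rfl⟩
      by_contra hsp
      obtain ⟨n, hn⟩ := hdom s ⟨s.2, hsp⟩
      have h1 := dotProduct_nonneg_of_mem hn hvσ.2
      have h2 : u ⬝ᵥ v = 0 := by
        have := hv.2.2
        rw [latticePt_dotProduct] at this
        exact_mod_cast this
      have h3 : (1 : ℤ) ≤ (s : Fin d → ℤ) ⬝ᵥ v := hs.2 hvσ.2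
      rw [sub_dotProduct, smul_dotProduct, h2, smul_zero] at h1
      omega
    refine PrimeSpectrum.ext (eq_of_le_of_not_lt hle' fun hlt => ?_).symm
    have := Ideal.height_add_one_le_of_lt_of_isPrime hlt
    rw [h, Δ.height_rayPrime k hσ hvσ] at this
    exact absurd this (by decide)

/-! ### Ideal sheaves on affine schemes and open charts -/

/-- The ideal sheaf on `Spec R` of an ideal of `R`. -/
noncomputable def specIdeal {R : CommRingCat.{u}} (J : Ideal R) : (Spec R).IdealSheafData :=
  .ofIdealTop (J.comap (Scheme.ΓSpecIso R).hom.hom)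

lemma specIdeal_ideal_top {R : CommRingCat.{u}} (J : Ideal R) :
    (specIdeal J).ideal ⟨⊤, isAffineOpen_top _⟩ = J.comap (Scheme.ΓSpecIso R).hom.hom := by
  simp [specIdeal]

lemma specIdeal_le_iff {R : CommRingCat.{u}} {J K : Ideal R} :
    specIdeal J ≤ specIdeal K ↔ J ≤ K := by
  have hs : Function.Surjective (Scheme.ΓSpecIso R).hom.hom :=
    (ConcreteCategory.bijective_of_isIso (Scheme.ΓSpecIso R).hom).2
  constructor
  · intro h
    have := h ⟨⊤, isAffineOpen_top _⟩
    rw [specIdeal_ideal_top, specIdeal_ideal_top] at this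
    exact (Ideal.comap_le_comap_iff_of_surjective _ hs _ _).1 this
  · intro h
    refine Scheme.IdealSheafData.le_of_isAffine ?_
    rw [specIdeal_ideal_top, specIdeal_ideal_top]
    exact Ideal.comap_mono h

lemma specIdeal_injective {R : CommRingCat.{u}} {J K : Ideal R} (h : specIdeal J = specIdeal K) :
    J = K :=
  le_antisymm (specIdeal_le_iff.1 h.le) (specIdeal_le_iff.1 h.ge)

lemma exists_specIdeal_eq {R : CommRingCat.{u}} (I : (Spec R).IdealSheafData) :
    ∃ J : Ideal R, specIdeal J = I := by
  refine ⟨(I.ideal ⟨⊤, isAffineOpen_top _⟩).comap (Scheme.ΓSpecIso R).inv.hom,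
    Scheme.IdealSheafData.ext_of_isAffine ?_⟩
  rw [specIdeal_ideal_top, Ideal.comap_comap, ← CommRingCat.hom_comp, Iso.hom_inv_id]
  exact Ideal.comap_id _

lemma specIdeal_top {R : CommRingCat.{u}} : specIdeal (⊤ : Ideal R) = ⊤ := by
  obtain ⟨J, hJ⟩ := exists_specIdeal_eq (⊤ : (Spec R).IdealSheafData)
  refine top_le_iff.1 ?_
  rw [← hJ, specIdeal_le_iff]
  exact le_top

lemma ker_specMap {R S : CommRingCat.{u}} (φ : R ⟶ S) :
    (Spec.map φ).ker = specIdeal (RingHom.ker φ.hom) := by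
  rw [Scheme.ker_of_isAffine, specIdeal]
  congr 1
  ext x
  rw [RingHom.mem_ker, Ideal.mem_comap, RingHom.mem_ker]
  have h1 : (Scheme.ΓSpecIso S).hom ((Spec.map φ).appTop x) =
      φ ((Scheme.ΓSpecIso R).hom x) := by
    rw [← ConcreteCategory.comp_apply, Scheme.ΓSpecIso_naturality, ConcreteCategory.comp_apply]
  have h2 := map_eq_zero_iff (Scheme.ΓSpecIso S).hom.hom
    (ConcreteCategory.bijective_of_isIso (Scheme.ΓSpecIso S).hom).1 (x := (Spec.map φ).appTop x)
  rw [← h2]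
  exact Iff.of_eq (congrArg (· = 0) h1)

lemma specIdeal_eq_ker {R : CommRingCat.{u}} (J : Ideal R) :
    specIdeal J = (Spec.map (CommRingCat.ofHom (Ideal.Quotient.mk J))).ker := by
  rw [ker_specMap]
  congr 1
  exact Ideal.mk_ker.symm

lemma map_specIdeal {R S : CommRingCat.{u}} (φ : R ⟶ S) (K : Ideal S) :
    (specIdeal K).map (Spec.map φ) = specIdeal (K.comap φ.hom) := by
  rw [specIdeal_eq_ker, Scheme.IdealSheafData.map_ker, ← Spec.map_comp, ker_specMap]
  congr 1
  rw [CommRingCat.hom_comp, CommRingCat.hom_ofHom, ← RingHom.comap_ker, Ideal.mk_ker]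

/-- On an affine scheme every ideal sheaf comes from an ideal, so the pull-back is determined by its
adjunction with push-forward, known from `map_specIdeal`. -/
lemma comap_specIdeal {R S : CommRingCat.{u}} (φ : R ⟶ S) (J : Ideal R) :
    (specIdeal J).comap (Spec.map φ) = specIdeal (J.map φ.hom) := by
  obtain ⟨K, hK⟩ := exists_specIdeal_eq ((specIdeal J).comap (Spec.map φ))
  rw [← hK]
  refine le_antisymm (hK.trans_le ?_) (specIdeal_le_iff.2 (Ideal.map_le_iff_le_comap.2 ?_))
  · rw [← Scheme.IdealSheafData.le_map_iff_comap_le, map_specIdeal, specIdeal_le_iff]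
    exact Ideal.le_comap_map
  · rw [← specIdeal_le_iff, ← map_specIdeal, Scheme.IdealSheafData.le_map_iff_comap_le, hK]

lemma comap_ker_of_isOpenImmersion {X Y Z : Scheme.{u}} (f : X ⟶ Y) [QuasiCompact f] (j : Z ⟶ Y)
    [IsOpenImmersion j] {P : Scheme.{u}} {fst : P ⟶ Z} {snd : P ⟶ X}
    (h : IsPullback fst snd j f) : f.ker.comap j = fst.ker := by
  ext U : 2
  rw [Scheme.IdealSheafData.ideal_comap_of_isOpenImmersion,
    Scheme.ker_ideal_of_isPullback_of_isOpenImmersion f fst snd j h]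

lemma IsInvertibleIdeal.of_charts {T : Scheme.{u}} {J : T.IdealSheafData}
    (h : ∀ x : T, ∃ (A : CommRingCat.{u}) (j : Spec A ⟶ T) (a : A), IsOpenImmersion j ∧
      x ∈ Set.range j ∧ a ∈ nonZeroDivisors A ∧ J.comap j = specIdeal (Ideal.span {a})) :
    IsInvertibleIdeal J := by
  intro x
  obtain ⟨A, j, a, hj, ⟨y, rfl⟩, ha, hJ⟩ := h x
  let e : A ≅ Γ(T, j ''ᵁ ⊤) := (Scheme.ΓSpecIso A).symm ≪≫ (j.appIso ⊤).symm
  let e' := e.commRingCatIsoToRingEquiv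
  refine ⟨⟨j ''ᵁ ⊤, (isAffineOpen_top _).image_of_isOpenImmersion j⟩, ⟨y, trivial, rfl⟩, e' a,
    ?_, ?_⟩
  · exact (MulEquivClass.map_nonZeroDivisors e').le ⟨a, ha, rfl⟩
  · have h1 := Scheme.IdealSheafData.ideal_comap_of_isOpenImmersion J j ⟨⊤, isAffineOpen_top _⟩
    rw [hJ, specIdeal_ideal_top] at h1
    have h2 : Ideal.span {a} = Ideal.comap (e' : A →+* Γ(T, j ''ᵁ ⊤))
        (J.ideal ⟨j ''ᵁ ⊤, (isAffineOpen_top _).image_of_isOpenImmersion j⟩) := by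
      have := congrArg (Ideal.comap (Scheme.ΓSpecIso A).inv.hom) h1
      rw [Ideal.comap_comap, ← CommRingCat.hom_comp, Iso.inv_hom_id] at this
      exact (Ideal.comap_id _).symm.trans this
    rw [← Ideal.map_comap_of_surjective (e' : A →+* _) e'.surjective
      (J.ideal ⟨j ''ᵁ ⊤, (isAffineOpen_top _).image_of_isOpenImmersion j⟩), ← h2, Ideal.map_span,
      Set.image_singleton]
    rfl

lemma comap_eq_specIdeal_of_ideal_eq {T : Scheme.{u}} {J : T.IdealSheafData} {A : CommRingCat.{u}}
    (i : Spec A ⟶ T) [IsOpenImmersion i] {U : T.affineOpens} (hU : i ''ᵁ ⊤ = U)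
    {f : Γ(T, U)} (hf : f ∈ nonZeroDivisors Γ(T, U)) (hJ : J.ideal U = Ideal.span {f}) :
    ∃ a ∈ nonZeroDivisors A, J.comap i = specIdeal (Ideal.span {a}) := by
  obtain ⟨U, hU'⟩ := U
  change _ = U at hU
  subst hU
  let e : A ≅ Γ(T, i ''ᵁ ⊤) := (Scheme.ΓSpecIso A).symm ≪≫ (i.appIso ⊤).symm
  let e' := e.commRingCatIsoToRingEquiv
  obtain ⟨K, hK⟩ := exists_specIdeal_eq (J.comap i)
  refine ⟨e'.symm f, (MulEquivClass.map_nonZeroDivisors e'.symm).le ⟨f, hf, rfl⟩, ?_⟩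
  rw [← hK]
  congr 1
  have h1 := Scheme.IdealSheafData.ideal_comap_of_isOpenImmersion J i ⟨⊤, isAffineOpen_top _⟩
  rw [← hK, specIdeal_ideal_top] at h1
  have h2 : K = Ideal.comap (e' : A →+* Γ(T, i ''ᵁ ⊤)) (J.ideal ⟨i ''ᵁ ⊤, hU'⟩) := by
    have := congrArg (Ideal.comap (Scheme.ΓSpecIso A).inv.hom) h1
    rw [Ideal.comap_comap, ← CommRingCat.hom_comp, Iso.inv_hom_id] at this
    exact (Ideal.comap_id _).symm.trans this
  rw [h2, hJ]
  refine (Ideal.comap_symm e'.symm).trans ?_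
  rw [Ideal.map_span, Set.image_singleton]

/-- Invertibility persists on arbitrarily small affine neighbourhoods: localization preserves
nonzerodivisors, so one may pass to a basic open subset inside `V`. -/
lemma IsInvertibleIdeal.exists_chart {T : Scheme.{u}} {J : T.IdealSheafData}
    (h : IsInvertibleIdeal J) (x : T) (V : T.Opens) (hx : x ∈ V) :
    ∃ (A : CommRingCat.{u}) (j : Spec A ⟶ T) (a : A), IsOpenImmersion j ∧
      x ∈ Set.range j ∧ Set.range j ⊆ V ∧ a ∈ nonZeroDivisors A ∧
      J.comap j = specIdeal (Ideal.span {a}) := by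
  obtain ⟨U, hxU, f, hf, hJ⟩ := h x
  obtain ⟨B, i, hi, hiU⟩ : ∃ (B : CommRingCat.{u}) (i : Spec B ⟶ T) (_ : IsOpenImmersion i),
      i ''ᵁ ⊤ = U.1 :=
    have hU : IsAffineOpen U.1 := U.2
    ⟨_, hU.fromSpec, hU.isOpenImmersion_fromSpec, by
      rw [Scheme.Hom.image_top_eq_opensRange, IsAffineOpen.opensRange_fromSpec]⟩
  obtain ⟨b, hb, hJb⟩ := comap_eq_specIdeal_of_ideal_eq i hiU hf hJ
  obtain ⟨y, -, hy⟩ : x ∈ i ''ᵁ ⊤ := hiU ▸ hxU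
  obtain rfl : i y = x := hy
  obtain ⟨_, ⟨_, ⟨g, rfl⟩, rfl⟩, hyg, hgV⟩ :=
    PrimeSpectrum.isBasis_basic_opens.exists_subset_of_mem_open (show y ∈ i ⁻¹ᵁ V from hx)
      (i ⁻¹ᵁ V).2
  let φ : B ⟶ CommRingCat.of (Localization.Away g) :=
    CommRingCat.ofHom (algebraMap _ (Localization.Away g))
  have hφ : IsOpenImmersion (Spec.map φ) := IsOpenImmersion.of_isLocalization g
  have hr : Set.range (Spec.map φ) = (PrimeSpectrum.basicOpen g : Set (PrimeSpectrum B)) :=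
    PrimeSpectrum.localization_away_comap_range (Localization.Away g) g
  refine ⟨_, Spec.map φ ≫ i, φ b, inferInstance, ?_, ?_, ?_, ?_⟩
  · obtain ⟨z, hz⟩ : y ∈ Set.range (Spec.map φ) := by rw [hr]; exact hyg
    exact ⟨z, by rw [Scheme.Hom.comp_apply, hz]⟩
  · rintro _ ⟨z, rfl⟩
    rw [Scheme.Hom.comp_apply]
    exact hgV (hr ▸ ⟨z, rfl⟩)
  · exact IsLocalization.map_nonZeroDivisors_le (Submonoid.powers g) (Localization.Away g)
      ⟨b, hb, rfl⟩
  · rw [Scheme.IdealSheafData.comap_comp, hJb, comap_specIdeal, Ideal.map_span,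
      Set.image_singleton]

/-! ### Symbolic powers on charts -/

/-- The closed subscheme germ defining the symbolic power. -/
noncomputable def symbolicGerm {X : Scheme.{u}} (x : X) (n : ℕ) :
    Spec (CommRingCat.of
      (X.presheaf.stalk x ⧸ IsLocalRing.maximalIdeal (X.presheaf.stalk x) ^ n)) ⟶ X :=
  Spec.map (CommRingCat.ofHom (Ideal.Quotient.mk
    (IsLocalRing.maximalIdeal (X.presheaf.stalk x) ^ n))) ≫ X.fromSpecStalk x

lemma ker_symbolicGerm {X : Scheme.{u}} (x : X) (n : ℕ) :
    (symbolicGerm x n).ker = symbolicPower x n := rfl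

lemma eq_closedPoint_of_quotient {R : Type u} [CommRing R] [IsLocalRing R] (n : ℕ)
    (q : PrimeSpectrum (R ⧸ IsLocalRing.maximalIdeal R ^ n)) :
    PrimeSpectrum.comap (Ideal.Quotient.mk _) q = IsLocalRing.closedPoint R := by
  have hle : IsLocalRing.maximalIdeal R ≤ (PrimeSpectrum.comap
      (Ideal.Quotient.mk (IsLocalRing.maximalIdeal R ^ n)) q).asIdeal := by
    intro a ha
    refine (PrimeSpectrum.comap _ q).isPrime.mem_of_pow_mem n ?_
    rw [PrimeSpectrum.comap_asIdeal, Ideal.mem_comap,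
      Ideal.Quotient.eq_zero_iff_mem.2 (Ideal.pow_mem_pow ha n)]
    exact zero_mem _
  exact PrimeSpectrum.ext ((IsLocalRing.maximalIdeal.isMaximal _).eq_of_le
    (PrimeSpectrum.comap _ q).isPrime.ne_top hle).symm

lemma symbolicGerm_apply {X : Scheme.{u}} (x : X) (n : ℕ) (q) : symbolicGerm x n q = x := by
  rw [symbolicGerm, Scheme.Hom.comp_apply]
  exact (congrArg (X.fromSpecStalk x) (eq_closedPoint_of_quotient n q)).trans
    Scheme.fromSpecStalk_closedPoint

instance {X : Scheme.{u}} (x : X) (n : ℕ) : QuasiCompact (symbolicGerm x n) := by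
  have : Subsingleton (PrimeSpectrum
      (X.presheaf.stalk x ⧸ IsLocalRing.maximalIdeal (X.presheaf.stalk x) ^ n)) :=
    ⟨fun p q => PrimeSpectrum.comap_injective_of_surjective _ Ideal.Quotient.mk_surjective
      ((eq_closedPoint_of_quotient n p).trans (eq_closedPoint_of_quotient n q).symm)⟩
  exact ⟨fun U _ _ => Set.Subsingleton.isCompact fun a _ b _ =>
    Subsingleton.elim (α := PrimeSpectrum _) a b⟩

lemma comap_symbolicPower {X Y : Scheme.{u}} (j : Y ⟶ X) [IsOpenImmersion j] (y : Y) (n : ℕ) :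
    (symbolicPower (j y) n).comap j = symbolicPower y n := by
  let e := (asIso (j.stalkMap y)).commRingCatIsoToRingEquiv
  have hm : IsLocalRing.maximalIdeal (Y.presheaf.stalk y) ^ n =
      (IsLocalRing.maximalIdeal (X.presheaf.stalk (j y)) ^ n).map (e : _ →+* _) := by
    rw [Ideal.map_pow]
    congr 1
    refine (IsLocalRing.eq_maximalIdeal ?_).symm
    exact Ideal.map_isMaximal_of_equiv e
  let q := (Ideal.quotientEquiv _ _ e hm).toCommRingCatIso
  have hq : Spec.map q.hom ≫ symbolicGerm (j y) n = symbolicGerm y n ≫ j := by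
    rw [symbolicGerm, symbolicGerm, Category.assoc, ← Scheme.SpecMap_stalkMap_fromSpecStalk,
      ← Spec.map_comp_assoc, ← Spec.map_comp_assoc]
    rfl
  rw [← ker_symbolicGerm, ← ker_symbolicGerm]
  exact comap_ker_of_isOpenImmersion _ j (IsPullback.of_vert_isIso_mono ⟨hq.symm⟩)

/-- The subscheme whose kernel is the symbolic power is topologically supported at `x`, so its
pull-back to an open subscheme missing `x` is empty. -/
lemma comap_symbolicPower_of_notMem {X Y : Scheme.{u}} (j : Y ⟶ X) [IsOpenImmersion j] (x : X)
    (hx : x ∉ Set.range j) (n : ℕ) : (symbolicPower x n).comap j = ⊤ := by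
  rw [← ker_symbolicGerm,
    comap_ker_of_isOpenImmersion _ j (IsPullback.of_hasPullback j (symbolicGerm x n))]
  have : IsEmpty (pullback j (symbolicGerm x n) : Scheme) := by
    refine ⟨fun z => hx ⟨pullback.fst j (symbolicGerm x n) z, ?_⟩⟩
    rw [← Scheme.Hom.comp_apply, pullback.condition, Scheme.Hom.comp_apply, symbolicGerm_apply]
  exact Scheme.ker_eq_top_of_isEmpty _

lemma symbolicPower_spec {R : CommRingCat.{u}} (p : Spec R) (n : ℕ) :
    symbolicPower p n = specIdeal ((IsLocalRing.maximalIdeal ((Spec R).presheaf.stalk p) ^ n).comap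
      ((Scheme.ΓSpecIso R).inv ≫ (Spec R).presheaf.germ ⊤ p trivial).hom) := by
  rw [symbolicPower, Spec.fromSpecStalk_eq, ← Spec.map_comp, ker_specMap]
  congr 1
  rw [CommRingCat.hom_comp, CommRingCat.hom_ofHom, ← RingHom.comap_ker, Ideal.mk_ker]

/-! ### Charts of toric varieties -/

instance (k : Type u) [Field k] {d : ℕ} (Δ : Fan d) (σ : Δ.cones) :
    IsOpenImmersion (Δ.chart k σ) :=
  inferInstanceAs (IsOpenImmersion (colimit.ι (Δ.diagram k) σ))

lemma Fan.map_chart (k : Type u) [Field k] {d : ℕ} (Δ : Fan d) {τ σ : Δ.cones}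
    (h : τ.1 ≤ σ.1) : (affineToric k d).map (homOfLE h) ≫ Δ.chart k σ = Δ.chart k τ :=
  colimit.w (Δ.diagram k) (homOfLE (show τ ≤ σ from h))

lemma Fan.chart_apply (k : Type u) [Field k] {d : ℕ} (Δ : Fan d) {τ σ : Δ.cones}
    (h : τ.1 ≤ σ.1) (p : PrimeSpectrum (charAlgebra k τ.1)) :
    Δ.point k σ (PrimeSpectrum.comap (restrictChar k h) p) = Δ.point k τ p :=
  congrArg (fun f : (affineToric k d).obj τ.1 ⟶ Δ.toricVariety k => f p) (Δ.map_chart k h)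

lemma Fan.exists_point (k : Type u) [Field k] {d : ℕ} (Δ : Fan d) (x : Δ.toricVariety k) :
    ∃ (σ : Δ.cones) (p : PrimeSpectrum (charAlgebra k σ.1)), Δ.point k σ p = x :=
  Scheme.IsLocallyDirected.ι_jointly_surjective (Δ.diagram k) x

lemma Fan.exists_of_point_eq (k : Type u) [Field k] {d : ℕ} (Δ : Fan d) {σ τ : Δ.cones}
    {p : PrimeSpectrum (charAlgebra k σ.1)} {q : PrimeSpectrum (charAlgebra k τ.1)}
    (h : Δ.point k σ p = Δ.point k τ q) :
    ∃ (γ : Δ.cones) (hσ : γ.1 ≤ σ.1) (hτ : γ.1 ≤ τ.1) (r : PrimeSpectrum (charAlgebra k γ.1)),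
      PrimeSpectrum.comap (restrictChar k hσ) r = p ∧
      PrimeSpectrum.comap (restrictChar k hτ) r = q := by
  obtain ⟨γ, fσ, fτ, r, h1, h2⟩ := (Scheme.IsLocallyDirected.ι_eq_ι_iff (Δ.diagram k)).1 h
  exact ⟨γ, fσ.le, fτ.le, r, h1, h2⟩

lemma Fan.point_injective (k : Type u) [Field k] {d : ℕ} (Δ : Fan d) (σ : Δ.cones) :
    Function.Injective (Δ.point k σ) :=
  (Δ.chart k σ).isOpenEmbedding.injective

lemma Fan.coheight_point (k : Type u) [Field k] {d : ℕ} (Δ : Fan d) (σ : Δ.cones)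
    (p : PrimeSpectrum (charAlgebra k σ.1)) :
    Order.coheight (Δ.point k σ p) = p.asIdeal.height :=
  (coheight_eq_of_isOpenImmersion (Δ.chart k σ)).trans
    (idealHeight_eq_coheight (CommRingCat.of (charAlgebra k σ.1)) p).symm

/-! ### Toric varieties are normal and integral -/

lemma Fan.genericPoint_eq (k : Type u) [Field k] {d : ℕ} (Δ : Fan d) {τ σ : Δ.cones}
    (h : τ.1 ≤ σ.1) : Δ.point k σ ⟨⊥, Ideal.isPrime_bot⟩ = Δ.point k τ ⟨⊥, Ideal.isPrime_bot⟩ := by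
  rw [← Δ.chart_apply k h]
  congr 1
  refine PrimeSpectrum.ext ?_
  exact (Ideal.comap_bot_of_injective _ (restrictChar_injective k h)).symm

lemma Fan.closure_genericPoint (k : Type u) [Field k] {d : ℕ} (Δ : Fan d) (σ : Δ.cones) :
    closure {Δ.point k σ ⟨⊥, Ideal.isPrime_bot⟩} = Set.univ := by
  refine Set.eq_univ_of_forall fun x => ?_
  obtain ⟨τ, p, rfl⟩ := Δ.exists_point k x
  have h0 := Δ.bot_mem σ.2
  rw [Δ.genericPoint_eq k (τ := ⟨⊥, h0⟩) (σ := σ) bot_le,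
    ← Δ.genericPoint_eq k (τ := ⟨⊥, h0⟩) (σ := τ) bot_le, ← specializes_iff_mem_closure]
  refine Specializes.map ?_ (Δ.chart k τ).continuous
  exact (PrimeSpectrum.le_iff_specializes ⟨⊥, Ideal.isPrime_bot⟩ p).1 bot_le

lemma Fan.isReduced_toricVariety (k : Type u) [Field k] {d : ℕ} (Δ : Fan d) :
    IsReduced (Δ.toricVariety k) := by
  have : ∀ i, IsReduced ((Scheme.IsLocallyDirected.openCover (Δ.diagram k)).X i) := fun σ =>
    inferInstanceAs (IsReduced (Spec (CommRingCat.of (charAlgebra k σ.1))))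
  exact IsReduced.of_openCover _ (Scheme.IsLocallyDirected.openCover (Δ.diagram k))

lemma Fan.isIntegral_toricVariety (k : Type u) [Field k] {d : ℕ} (Δ : Fan d) (σ : Δ.cones) :
    IsIntegral (Δ.toricVariety k) := by
  have := Δ.isReduced_toricVariety k
  have : IrreducibleSpace (Δ.toricVariety k) := by
    have h := (isIrreducible_singleton (x := Δ.point k σ ⟨⊥, Ideal.isPrime_bot⟩)).closure
    rw [Δ.closure_genericPoint k σ] at h
    exact (irreducibleSpace_def _).2 h
  exact isIntegral_of_irreducibleSpace_of_isReduced _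

lemma isIntegrallyClosed_stalk_spec (R : CommRingCat.{u}) [IsDomain R] [IsIntegrallyClosed R]
    (p : PrimeSpectrum R) : IsIntegrallyClosed ((Spec R).presheaf.stalk p) := by
  let : Algebra R ((Spec R).presheaf.stalk p) := StructureSheaf.stalkAlgebra R p
  have : IsLocalization.AtPrime ((Spec R).presheaf.stalk p) p.asIdeal :=
    StructureSheaf.IsLocalization.to_stalk R p
  exact isIntegrallyClosed_of_isLocalization ((Spec R).presheaf.stalk p)
    p.asIdeal.primeCompl p.asIdeal.primeCompl_le_nonZeroDivisors

lemma isIntegrallyClosed_stalk_of_isOpenImmersion {X Y : Scheme.{u}} (j : X ⟶ Y)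
    [IsOpenImmersion j] (x : X) (h : IsIntegrallyClosed (X.presheaf.stalk x)) :
    IsIntegrallyClosed (Y.presheaf.stalk (j x)) :=
  IsIntegrallyClosed.of_equiv (asIso (j.stalkMap x)).commRingCatIsoToRingEquiv.symm

lemma Fan.isNormalIntegral_toricVariety (k : Type u) [Field k] {d : ℕ} (Δ : Fan d)
    (σ : Δ.cones) : IsNormalIntegral (Δ.toricVariety k) := by
  refine ⟨Δ.isIntegral_toricVariety k σ, fun x => ?_⟩
  obtain ⟨τ, p, rfl⟩ := Δ.exists_point k x
  have := isIntegrallyClosed_charAlgebra k (Δ.rational τ.1 τ.2)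
  exact isIntegrallyClosed_stalk_of_isOpenImmersion (Δ.chart k τ) p
    (isIntegrallyClosed_stalk_spec (CommRingCat.of (charAlgebra k τ.1)) p)

/-! ### Toric morphisms -/

lemma Fan.map_chart_eq (k : Type u) [Field k] {d : ℕ} (Δ : Fan d) {τ : Cone d} {σ₁ σ₂ : Δ.cones}
    (h₁ : τ ≤ σ₁.1) (h₂ : τ ≤ σ₂.1) :
    (affineToric k d).map (homOfLE h₁) ≫ Δ.chart k σ₁ =
      (affineToric k d).map (homOfLE h₂) ≫ Δ.chart k σ₂ := by
  let γ : Δ.cones := ⟨σ₁.1 ⊓ σ₂.1, Δ.inf_mem σ₁.2 σ₂.2⟩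
  have e₁ : homOfLE h₁ = homOfLE (le_inf h₁ h₂) ≫ homOfLE (show γ.1 ≤ σ₁.1 from inf_le_left) := rfl
  have e₂ : homOfLE h₂ = homOfLE (le_inf h₁ h₂) ≫ homOfLE (show γ.1 ≤ σ₂.1 from inf_le_right) := rfl
  rw [e₁, e₂, Functor.map_comp, Functor.map_comp, Category.assoc, Category.assoc,
    Δ.map_chart k (τ := γ), Δ.map_chart k (τ := γ)]

/-- The target cone is chosen arbitrarily for each cone. The choices agree on overlaps because any
two target cones meet in a cone of the fan containing the source. -/
lemma exists_isToricMorphism (k : Type u) [Field k] {d : ℕ} {Δ' Δ : Fan d}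
    (h : ∀ σ' : Δ'.cones, ∃ σ : Δ.cones, σ'.1 ≤ σ.1) :
    ∃ π : Δ'.toricVariety k ⟶ Δ.toricVariety k, IsToricMorphism π := by
  have h' := h
  choose S hS using h
  let c : Cocone (Δ'.diagram k) :=
    { pt := Δ.toricVariety k
      ι :=
        { app := fun σ' => (affineToric k d).map (homOfLE (hS σ')) ≫ Δ.chart k (S σ')
          naturality := fun τ' σ' f => by
            have e : (Δ'.diagram k).map f ≫ (affineToric k d).map (homOfLE (hS σ')) =
              (affineToric k d).map (homOfLE (show τ'.1 ≤ (S σ').1 from le_trans (show τ'.1 ≤ σ'.1 from f.le) (hS σ'))) :=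
              ((affineToric k d).map_comp (homOfLE (show τ'.1 ≤ σ'.1 from f.le)) _).symm
            exact ((Category.assoc _ _ _).symm.trans (congrArg (· ≫ Δ.chart k (S σ')) e)).trans
              ((Δ.map_chart_eq k _ _).trans (Category.comp_id _).symm) } }
  refine ⟨colimit.desc _ c, h', fun σ' σ hle => ?_⟩
  exact (colimit.ι_desc c σ').trans (Δ.map_chart_eq k _ _)

lemma IsToricMorphism.id (k : Type u) [Field k] {d : ℕ} (Δ : Fan d) :
    IsToricMorphism (𝟙 (Δ.toricVariety k)) :=
  ⟨fun σ => ⟨σ, le_rfl⟩, fun _ _ h => by rw [Category.comp_id, Δ.map_chart k h]⟩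

lemma IsToricMorphism.comp {k : Type u} [Field k] {d : ℕ} {Δ'' Δ' Δ : Fan d}
    {π' : Δ''.toricVariety k ⟶ Δ'.toricVariety k} {π : Δ'.toricVariety k ⟶ Δ.toricVariety k}
    (h' : IsToricMorphism π') (h : IsToricMorphism π) : IsToricMorphism (π' ≫ π) := by
  refine ⟨fun σ'' => ?_, fun σ'' σ hle => ?_⟩
  · obtain ⟨σ', h1⟩ := h'.1 σ''
    obtain ⟨σ, h2⟩ := h.1 σ'
    exact ⟨σ, h1.trans h2⟩
  · obtain ⟨σ', h1⟩ := h'.1 σ''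
    obtain ⟨σ₁, h2⟩ := h.1 σ'
    rw [← Category.assoc, h'.2 σ'' σ' h1, Category.assoc, h.2 σ' σ₁ h2, ← Category.assoc,
      ← Functor.map_comp]
    exact Δ.map_chart_eq k (h1.trans h2) hle

lemma IsToricMorphism.apply_point {k : Type u} [Field k] {d : ℕ} {Δ' Δ : Fan d}
    {π : Δ'.toricVariety k ⟶ Δ.toricVariety k} (h : IsToricMorphism π) {σ' : Δ'.cones}
    {σ : Δ.cones} (hle : σ'.1 ≤ σ.1) (p : PrimeSpectrum (charAlgebra k σ'.1)) :
    π (Δ'.point k σ' p) = Δ.point k σ (PrimeSpectrum.comap (restrictChar k hle) p) :=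
  congrArg (fun f : (affineToric k d).obj σ'.1 ⟶ Δ.toricVariety k => f p) (h.2 σ' σ hle)

lemma IsToricMorphism.isDominant {k : Type u} [Field k] {d : ℕ} {Δ' Δ : Fan d}
    {π : Δ'.toricVariety k ⟶ Δ.toricVariety k} (h : IsToricMorphism π) (σ' : Δ'.cones) :
    IsDominant π := by
  refine ⟨?_⟩
  obtain ⟨σ, hle⟩ := h.1 σ'
  have : Δ.point k σ ⟨⊥, Ideal.isPrime_bot⟩ ∈ Set.range π := by
    refine ⟨Δ'.point k σ' ⟨⊥, Ideal.isPrime_bot⟩, ?_⟩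
    rw [h.apply_point hle]
    congr 1
    refine PrimeSpectrum.ext ?_
    exact Ideal.comap_bot_of_injective _ (restrictChar_injective k hle)
  have h1 := closure_mono (Set.singleton_subset_iff.2 this)
  rw [Δ.closure_genericPoint k σ] at h1
  exact dense_iff_closure_eq.2 (Set.univ_subset_iff.1 h1)

/-! ### Torus-invariant prime divisors and rays -/

/-- The generic point of the torus-invariant prime divisor of a ray. -/
noncomputable def Fan.rayPoint (k : Type u) [Field k] {d : ℕ} (Δ : Fan d) {v : Fin d → ℤ}
    (hv : v ∈ Δ.rays) : Δ.toricVariety k :=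
  Δ.point k ⟨rayCone v, hv.2⟩ (rayPrime k (latticePt_mem_rayCone v))

lemma Fan.point_rayPrime (k : Type u) [Field k] {d : ℕ} (Δ : Fan d) (σ : Δ.cones)
    {v : Fin d → ℤ} (hv : v ∈ Δ.rays) (hvσ : latticePt v ∈ σ.1) :
    Δ.point k σ (rayPrime k hvσ) = Δ.rayPoint k hv := by
  rw [rayPoint, ← Δ.chart_apply k (τ := ⟨rayCone v, hv.2⟩) (rayCone_le hvσ), comap_rayPrime]

/-- The two charts share the chart of a common subcone `γ`. If `v` were not in it, a monomial
positive at `v` would be a unit there, although it lies in the prime of the ray. -/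
lemma Fan.eq_rayPrime_of_point_eq (k : Type u) [Field k] {d : ℕ} (Δ : Fan d) {σ : Δ.cones}
    {p : PrimeSpectrum (charAlgebra k σ.1)} {v : Fin d → ℤ} (hv : v ∈ Δ.rays)
    (h : Δ.point k σ p = Δ.rayPoint k hv) : ∃ hvσ : latticePt v ∈ σ.1, p = rayPrime k hvσ := by
  obtain ⟨γ, h1, h2, r, hr1, hr2⟩ := Δ.exists_of_point_eq k h
  have hvγ : latticePt v ∈ γ.1 := by
    by_contra hn
    obtain ⟨u, hu, huf⟩ := Δ.isFace_of_le γ.2 hv.2 h2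
    have hpos : 0 < u ⬝ᵥ v := by
      refine zero_lt_dotProduct_of_notMem hu (latticePt_mem_rayCone v) fun h0 => hn ?_
      exact (huf _).2 h0
    have hmem := (monomial_mem_rayPrime (k := k) (latticePt_mem_rayCone v) ⟨u, hu⟩).2 hpos
    rw [← hr2] at hmem
    refine r.isPrime.ne_top (Ideal.eq_top_of_isUnit_mem _ (Ideal.mem_comap.1 hmem) ?_)
    rw [restrictChar_monomial]
    exact isUnit_monomial k _ (neg_mem_charMonoid huf)
  refine ⟨h1 hvγ, ?_⟩
  have e : Δ.point k γ r = Δ.rayPoint k hv := by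
    rw [← h, ← hr1, Δ.chart_apply k h1]
  rw [← Δ.point_rayPrime k γ hv hvγ] at e
  rw [← hr1, Δ.point_injective k γ e, comap_rayPrime]

lemma Fan.rayPoint_injective (k : Type u) [Field k] {d : ℕ} (Δ : Fan d) {v w : Fin d → ℤ}
    (hv : v ∈ Δ.rays) (hw : w ∈ Δ.rays) (h : Δ.rayPoint k hv = Δ.rayPoint k hw) : v = w := by
  obtain ⟨h', -⟩ := Δ.eq_rayPrime_of_point_eq k hw h
  exact (hv.1.eq_of_mem_rayCone hw.1 h').symm

lemma Fan.rayPoint_mem (k : Type u) [Field k] {d : ℕ} (Δ : Fan d) {v : Fin d → ℤ}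
    (hv : v ∈ Δ.rays) : Δ.rayPoint k hv ∈ Δ.torusDivisors k := by
  refine ⟨?_, _, _, rfl, le_antisymm ?_ (Ideal.span_le.2 fun f hf => hf.1)⟩
  · refine (Δ.coheight_point k _ _).trans ?_
    exact Δ.height_rayPrime k hv.2 ⟨hv, latticePt_mem_rayCone v⟩
  · conv_lhs => rw [rayPrime_asIdeal]
    refine Ideal.span_le.2 ?_
    rintro _ ⟨s, hs, rfl⟩
    refine Ideal.subset_span ⟨?_, s, rfl⟩
    rw [rayPrime_asIdeal]
    exact monomial_mem_monomialIdeal hs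

lemma Fan.exists_eq_rayPoint (k : Type u) [Field k] {d : ℕ} (Δ : Fan d) {x : Δ.toricVariety k}
    (hx : x ∈ Δ.torusDivisors k) : ∃ v, ∃ hv : v ∈ Δ.rays, x = Δ.rayPoint k hv := by
  obtain ⟨h1, σ, p, rfl, hp⟩ := hx
  rw [Δ.coheight_point k] at h1
  obtain ⟨v, hv, rfl⟩ := Δ.exists_eq_rayPrime k σ.2 p hp h1
  exact ⟨v, hv.1, Δ.point_rayPrime k σ hv.1 hv.2⟩

lemma Fan.isDivisorOfRay_iff {k : Type u} [Field k] {d : ℕ} {Δ : Fan d} {x : Δ.toricVariety k}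
    {v : Fin d → ℤ} : Fan.IsDivisorOfRay x v ↔ ∃ hv : v ∈ Δ.rays, x = Δ.rayPoint k hv := by
  have key : (rayPrime k (latticePt_mem_rayCone v)).asIdeal = Ideal.span {f | ∃ s : charMonoid
      (rayCone v), 0 < (s : Fin d → ℤ) ⬝ᵥ v ∧ f = monomial k s} := by
    rw [rayPrime_asIdeal, monomialIdeal]
    congr 1
    ext f
    refine exists_congr fun s => and_congr_left fun _ => ?_
    exact ⟨fun h => h.2 (latticePt_mem_rayCone v), fun h => ⟨s.2, fun _ => h⟩⟩
  constructor
  · rintro ⟨hv, hv', p, rfl, hp⟩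
    exact ⟨⟨hv, hv'⟩, congrArg (Δ.point k ⟨rayCone v, hv'⟩)
      (PrimeSpectrum.ext (hp.trans key.symm))⟩
  · rintro ⟨hv, rfl⟩
    exact ⟨hv.1, hv.2, _, rfl, key⟩

/-- The torus-invariant prime divisors correspond to the rays. -/
noncomputable def Fan.divisorEquiv (k : Type u) [Field k] {d : ℕ} (Δ : Fan d) :
    Δ.rays ≃ Δ.torusDivisors k :=
  Equiv.ofBijective (fun v => ⟨Δ.rayPoint k v.2, Δ.rayPoint_mem k v.2⟩)
    ⟨fun v w h => Subtype.ext (Δ.rayPoint_injective k v.2 w.2 (congrArg Subtype.val h)),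
      fun x => by
        obtain ⟨v, hv, h⟩ := Δ.exists_eq_rayPoint k x.2
        exact ⟨⟨v, hv⟩, Subtype.ext h.symm⟩⟩

lemma Fan.coe_divisorEquiv (k : Type u) [Field k] {d : ℕ} (Δ : Fan d) (v : Δ.rays) :
    (Δ.divisorEquiv k v : Δ.toricVariety k) = Δ.rayPoint k v.2 := rfl

lemma IsToricMorphism.apply_rayPoint {k : Type u} [Field k] {d : ℕ} {Δ' Δ : Fan d}
    {π : Δ'.toricVariety k ⟶ Δ.toricVariety k} (h : IsToricMorphism π) {v : Fin d → ℤ}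
    (hv' : v ∈ Δ'.rays) (hv : v ∈ Δ.rays) : π (Δ'.rayPoint k hv') = Δ.rayPoint k hv := by
  rw [Fan.rayPoint, h.apply_point (σ := ⟨rayCone v, hv.2⟩) le_rfl, comap_rayPrime]
  rfl

lemma IsToricMorphism.bijOn {k : Type u} [Field k] {d : ℕ} {Δ' Δ : Fan d}
    {π : Δ'.toricVariety k ⟶ Δ.toricVariety k} (h : IsToricMorphism π)
    (hr : Δ'.rays = Δ.rays) : Set.BijOn π (Δ'.torusDivisors k) (Δ.torusDivisors k) := by
  refine ⟨fun x hx => ?_, fun x hx y hy hxy => ?_, fun x hx => ?_⟩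
  · obtain ⟨v, hv, rfl⟩ := Δ'.exists_eq_rayPoint k hx
    rw [h.apply_rayPoint hv (hr ▸ hv)]
    exact Δ.rayPoint_mem k _
  · obtain ⟨v, hv, rfl⟩ := Δ'.exists_eq_rayPoint k hx
    obtain ⟨w, hw, rfl⟩ := Δ'.exists_eq_rayPoint k hy
    rw [h.apply_rayPoint hv (hr ▸ hv), h.apply_rayPoint hw (hr ▸ hw)] at hxy
    obtain rfl := Δ.rayPoint_injective k _ _ hxy
    rfl
  · obtain ⟨v, hv, rfl⟩ := Δ.exists_eq_rayPoint k hx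
    exact ⟨_, Δ'.rayPoint_mem k (hr ▸ hv), h.apply_rayPoint _ hv⟩

/-- The ideal sheaf of `n D` on the charts. -/
lemma Fan.comap_chart_symbolicPower (k : Type u) [Field k] {d : ℕ} (Δ : Fan d) {v : Fin d → ℤ}
    (hv : v ∈ Δ.rays) (n : ℕ) (σ : Δ.cones) :
    (symbolicPower (Δ.rayPoint k hv) n).comap (Δ.chart k σ) =
      specIdeal (R := CommRingCat.of (charAlgebra k σ.1))
        (monomialIdeal k σ.1 (divisorMonomials σ.1 v n)) := by
  by_cases hvσ : latticePt v ∈ σ.1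
  · rw [← Δ.point_rayPrime k σ hv hvσ]
    refine (comap_symbolicPower (Δ.chart k σ) _ n).trans ?_
    refine (symbolicPower_spec (R := CommRingCat.of (charAlgebra k σ.1)) (rayPrime k hvσ) n).trans ?_
    congr 1
    let R := CommRingCat.of (charAlgebra k σ.1)
    let : Algebra (charAlgebra k σ.1) ((Spec R).presheaf.stalk (rayPrime k hvσ)) :=
      StructureSheaf.stalkAlgebra R (rayPrime k hvσ)
    have : IsLocalization.AtPrime ((Spec R).presheaf.stalk (rayPrime k hvσ))
        (rayPrime k hvσ).asIdeal := StructureSheaf.IsLocalization.to_stalk R (rayPrime k hvσ)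
    have : IsLocalRing ((Spec R).presheaf.stalk (rayPrime k hvσ)) :=
      inferInstanceAs (IsLocalRing ((Spec R).presheaf.stalk (show Spec R from rayPrime k hvσ)))
    exact Δ.comap_maximalIdeal_pow k σ.2 ⟨hv, hvσ⟩ ((Spec R).presheaf.stalk (rayPrime k hvσ)) n
  · rw [comap_symbolicPower_of_notMem]
    · refine (specIdeal_top (R := CommRingCat.of (charAlgebra k σ.1))).symm.trans ?_
      congr 1
      refine ((Ideal.eq_top_iff_one _).2 ?_).symm
      exact monomial_mem_monomialIdeal (k := k) (s := (0 : charMonoid σ.1))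
        ⟨zero_mem _, fun h => absurd h hvσ⟩
    · rintro ⟨p, hp⟩
      exact hvσ (Δ.eq_rayPrime_of_point_eq k hv hp).1

/-! ### The group `G` -/

lemma Fan.isCartier_iff {k : Type u} [Field k] {d : ℕ} {Δ : Fan d} {E : Δ.WeilDiv k} :
    Fan.IsCartier E ↔ ∀ σ ∈ Δ.cones, ∃ u : Fin d → ℤ, ∀ v (hv : v ∈ Δ.raysOf σ),
      E (Δ.divisorEquiv k ⟨v, hv.1⟩) = u ⬝ᵥ v := by
  constructor
  · intro h σ hσ
    obtain ⟨s, s', hs⟩ := h ⟨σ, hσ⟩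
    refine ⟨s - s', fun v hv => ?_⟩
    rw [hs _ (rayPrime k hv.2) (Δ.point_rayPrime k ⟨σ, hσ⟩ hv.1 hv.2),
      Δ.ordMonomial_rayPrime k hσ hv, Δ.ordMonomial_rayPrime k hσ hv, sub_dotProduct,
      ENat.toNat_natCast, ENat.toNat_natCast, Int.toNat_of_nonneg (dotProduct_nonneg_of_mem s.2 hv.2),
      Int.toNat_of_nonneg (dotProduct_nonneg_of_mem s'.2 hv.2)]
  · intro h σ
    obtain ⟨u, hu⟩ := h σ.1 σ.2
    obtain ⟨s, hs, s', hs', rfl⟩ := Δ.exists_sub_eq σ.2 u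
    refine ⟨⟨s, hs⟩, ⟨s', hs'⟩, fun D p hp => ?_⟩
    obtain ⟨⟨v, hv⟩, rfl⟩ := (Δ.divisorEquiv k).surjective D
    obtain ⟨hvσ, rfl⟩ := Δ.eq_rayPrime_of_point_eq k hv hp
    have hvr : v ∈ Δ.raysOf σ.1 := ⟨hv, hvσ⟩
    rw [hu v hvr, Δ.ordMonomial_rayPrime k σ.2 hvr, Δ.ordMonomial_rayPrime k σ.2 hvr,
      sub_dotProduct, ENat.toNat_natCast, ENat.toNat_natCast,
      Int.toNat_of_nonneg (dotProduct_nonneg_of_mem hs hvσ),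
      Int.toNat_of_nonneg (dotProduct_nonneg_of_mem hs' hvσ)]

lemma Fan.mem_cartierSubgroup_iff {k : Type u} [Field k] {d : ℕ} {Δ : Fan d} {E : Δ.WeilDiv k} :
    E ∈ Δ.cartierSubgroup k ↔ ∀ σ ∈ Δ.cones, ∃ u : Fin d → ℤ, ∀ v (hv : v ∈ Δ.raysOf σ),
      E (Δ.divisorEquiv k ⟨v, hv.1⟩) = u ⬝ᵥ v := by
  rw [← isCartier_iff]
  -- Taking the generated subgroup adds nothing: the local functionals can be added and negated.
  refine ⟨fun h => ?_, fun h => AddSubgroup.subset_closure h⟩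
  refine AddSubgroup.closure_induction (p := fun E _ => Fan.IsCartier E) (fun E h => h) ?_
    (fun E F _ _ hE hF => ?_) (fun E _ hE => ?_) h
  · exact isCartier_iff.2 fun σ _ => ⟨0, fun v _ => by simp⟩
  · rw [isCartier_iff] at hE hF ⊢
    intro σ hσ
    obtain ⟨u, hu⟩ := hE σ hσ
    obtain ⟨w, hw⟩ := hF σ hσ
    exact ⟨u + w, fun v hv => by rw [Finsupp.add_apply, hu v hv, hw v hv, add_dotProduct]⟩
  · rw [isCartier_iff] at hE ⊢
    intro σ hσ
    obtain ⟨u, hu⟩ := hE σ hσ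
    exact ⟨-u, fun v hv => by rw [Finsupp.neg_apply, hu v hv, neg_dotProduct]⟩

lemma Fan.IsSplit.exists_nsmul {k : Type u} [Field k] {d : ℕ} {Δ : Fan d} {v : Fin d → ℤ}
    (hv : v ∈ Δ.rays) (h : Δ.IsSplit v) :
    ∃ n : ℕ, 0 < n ∧ n • Finsupp.single (Δ.divisorEquiv k ⟨v, hv⟩) (1 : ℤ) ∈
      Δ.cartierSubgroup k := by
  classical
  choose! U hU0 hU using h
  let F := Δ.finite.toFinset.filter (fun σ => latticePt v ∈ σ)
  have hF : ∀ σ, σ ∈ F ↔ σ ∈ Δ.cones ∧ latticePt v ∈ σ := by simp [F]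
  -- The product over the cones through `v` is divisible by each value `U σ ⬝ᵥ v`, so on each of
  -- these cones a multiple of `U σ` realizes the divisor.
  refine ⟨∏ σ ∈ F, (U σ ⬝ᵥ v).natAbs, Finset.prod_pos fun σ hσ => Int.natAbs_pos.2
    (hU0 σ ((hF σ).1 hσ).1 ((hF σ).1 hσ).2), mem_cartierSubgroup_iff.2 fun σ hσ => ?_⟩
  by_cases hvσ : latticePt v ∈ σ
  · have hdvd : U σ ⬝ᵥ v ∣ ((∏ σ ∈ F, (U σ ⬝ᵥ v).natAbs : ℕ) : ℤ) :=
      Int.natAbs_dvd.1 (Int.natCast_dvd_natCast.2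
        (Finset.dvd_prod_of_mem (fun σ => (U σ ⬝ᵥ v).natAbs) ((hF σ).2 ⟨hσ, hvσ⟩)))
    obtain ⟨c, hc⟩ := hdvd
    refine ⟨c • U σ, fun w hw => ?_⟩
    rw [smul_dotProduct, Finsupp.smul_apply, nsmul_eq_mul, hc, Finsupp.single_apply]
    split_ifs with hvw
    · obtain rfl : v = w := congrArg Subtype.val ((Δ.divisorEquiv k).injective hvw)
      rw [mul_one, smul_eq_mul, mul_comm]
    · rw [hU σ hσ hvσ w hw fun e => hvw (by subst e; rfl), mul_zero, smul_zero]
  · refine ⟨0, fun w hw => ?_⟩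
    rw [Finsupp.smul_apply, Finsupp.single_eq_of_ne, smul_zero, zero_dotProduct]
    intro e
    obtain rfl : w = v := congrArg Subtype.val ((Δ.divisorEquiv k).injective e)
    exact hvσ hw.2

/-- A functional realizing `n D` on a cone has value `n` at `v` and `0` at the other rays, which is
the splitting condition. The converse is the common multiple of `Fan.IsSplit.exists_nsmul`. -/
lemma Fan.hasInfiniteOrder_iff {k : Type u} [Field k] {d : ℕ} {Δ : Fan d} {v : Fin d → ℤ}
    (hv : v ∈ Δ.rays) :
    Fan.HasInfiniteOrder (Δ.divisorEquiv k ⟨v, hv⟩) ↔ ¬ Δ.IsSplit v := by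
  have key : ∀ n : ℕ, n • Δ.divisorClass k (Δ.divisorEquiv k ⟨v, hv⟩) = 0 ↔
      n • Finsupp.single (Δ.divisorEquiv k ⟨v, hv⟩) (1 : ℤ) ∈ Δ.cartierSubgroup k := by
    intro n
    rw [← QuotientAddGroup.eq_zero_iff]
    rfl
  rw [HasInfiniteOrder, not_iff_not, isOfFinAddOrder_iff_nsmul_eq_zero]
  constructor
  · rintro ⟨n, hn, h⟩ σ hσ hvσ
    obtain ⟨u, hu⟩ := mem_cartierSubgroup_iff.1 ((key n).1 h) σ hσ
    refine ⟨u, ?_, fun w hw hwv => ?_⟩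
    · rw [← hu v ⟨hv, hvσ⟩, Finsupp.smul_apply, Finsupp.single_eq_same, nsmul_eq_mul, mul_one]
      exact_mod_cast hn.ne'
    · rw [← hu w hw, Finsupp.smul_apply, Finsupp.single_eq_of_ne, smul_zero]
      exact fun e => hwv (congrArg Subtype.val ((Δ.divisorEquiv k).injective e))
  · intro h
    obtain ⟨n, hn, h'⟩ := h.exists_nsmul (k := k) hv
    exact ⟨n, hn, (key n).2 h'⟩

instance (k : Type u) [Field k] {d : ℕ} (Δ : Fan d) : Module.Finite ℤ (Δ.G k) := by
  have : Finite Δ.rays := Δ.rays_finite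
  have : Finite (Δ.torusDivisors k) := Finite.of_equiv _ (Δ.divisorEquiv k)
  exact Module.Finite.of_surjective (QuotientAddGroup.mk' (Δ.cartierSubgroup k)).toIntLinearMap
    (QuotientAddGroup.mk'_surjective _)

/-- Some multiple of `a` lies in the kernel and still has infinite order, so the kernel has positive
rank. -/
lemma finrank_lt_of_surjective {A B : Type*} [AddCommGroup A] [AddCommGroup B]
    [Module.Finite ℤ A] (f : A →+ B) (hf : Function.Surjective f) {a : A}
    (ha : ¬ IsOfFinAddOrder a) (h : IsOfFinAddOrder (f a)) :
    Module.finrank ℤ B < Module.finrank ℤ A := by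
  obtain ⟨n, hn, hna⟩ := isOfFinAddOrder_iff_nsmul_eq_zero.1 h
  have h1 := (LinearMap.ker f.toIntLinearMap).finrank_quotient_add_finrank
  rw [(f.toIntLinearMap.quotKerEquivOfSurjective hf).finrank_eq] at h1
  let b : LinearMap.ker f.toIntLinearMap := ⟨n • a, by
    rw [LinearMap.mem_ker, map_nsmul]; exact hna⟩
  have hb : LinearIndependent ℤ ![b] := by
    refine Fintype.linearIndependent_iff.2 fun g hg i => ?_
    rw [Fin.sum_univ_one, Subtype.ext_iff] at hg
    obtain rfl := Subsingleton.elim 0 i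
    by_contra h0
    refine ha (isOfFinAddOrder_iff_zsmul_eq_zero.2
      ⟨g 0 * n, mul_ne_zero h0 (by exact_mod_cast hn.ne'), ?_⟩)
    rw [mul_smul, natCast_zsmul]
    exact hg
  have h2 := hb.fintype_card_le_finrank
  rw [Fintype.card_fin] at h2
  omega

/-- The rank of `G` decreases when the class of a divisor becomes torsion. -/
lemma Fan.finrank_G_lt (k : Type u) [Field k] {d : ℕ} {Δ' Δ : Fan d} (hr : Δ'.rays = Δ.rays)
    (hle : ∀ σ' ∈ Δ'.cones, ∃ σ ∈ Δ.cones, σ' ≤ σ) {v : Fin d → ℤ} (hv : v ∈ Δ.rays)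
    (hs : Δ'.IsSplit v) (hns : ¬ Δ.IsSplit v) :
    Module.finrank ℤ (Δ'.G k) < Module.finrank ℤ (Δ.G k) := by
  let e : Δ.torusDivisors k ≃ Δ'.torusDivisors k :=
    (Δ.divisorEquiv k).symm.trans ((Equiv.setCongr hr.symm).trans (Δ'.divisorEquiv k))
  have he : ∀ w (hw : w ∈ Δ.rays), e (Δ.divisorEquiv k ⟨w, hw⟩) =
      Δ'.divisorEquiv k ⟨w, hr ▸ hw⟩ := by
    intro w hw
    simp [e]
  let F : Δ.WeilDiv k ≃+ Δ'.WeilDiv k := (Finsupp.domCongr e)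
  have hF : ∀ (E : Δ.WeilDiv k) w (hw : w ∈ Δ'.rays), F E (Δ'.divisorEquiv k ⟨w, hw⟩) =
      E (Δ.divisorEquiv k ⟨w, hr ▸ hw⟩) := by
    intro E w hw
    rw [← he w (hr ▸ hw)]
    simp [F]
  -- Every new cone lies in an old one, whose functional also serves for it.
  have hC : Δ.cartierSubgroup k ≤ (Δ'.cartierSubgroup k).comap F.toAddMonoidHom := by
    intro E hE
    rw [AddSubgroup.mem_comap, mem_cartierSubgroup_iff]
    intro σ' hσ'
    obtain ⟨σ, hσ, hle'⟩ := hle σ' hσ'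
    obtain ⟨u, hu⟩ := mem_cartierSubgroup_iff.1 hE σ hσ
    refine ⟨u, fun w hw => ?_⟩
    rw [← hu w ⟨hr ▸ hw.1, hle' hw.2⟩]
    exact hF E w hw.1
  refine finrank_lt_of_surjective (QuotientAddGroup.map _ _ F.toAddMonoidHom hC) ?_
    ((hasInfiniteOrder_iff (k := k) hv).2 hns) ?_
  · intro x
    obtain ⟨E, rfl⟩ := QuotientAddGroup.mk_surjective x
    obtain ⟨E, rfl⟩ := F.surjective E
    exact ⟨QuotientAddGroup.mk E, rfl⟩
  · have h1 : ¬ Fan.HasInfiniteOrder (Δ'.divisorEquiv k ⟨v, hr ▸ hv⟩) := fun h =>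
      (hasInfiniteOrder_iff _).1 h hs
    rw [HasInfiniteOrder, not_not] at h1
    convert h1 using 1
    change QuotientAddGroup.mk (F (Finsupp.single _ 1)) = QuotientAddGroup.mk (Finsupp.single _ 1)
    simp [F, he]

/-! ### Monomials generating the pull-back of a monomial ideal -/

/-- Along `φ` the monomial `t^w` generates the ideal of the monomials in `P`, which becomes
invertible. -/
structure Generates {k : Type u} [Field k] {d : ℕ} {σ : Cone d} {A : Type u} [CommRing A]
    (φ : charAlgebra k σ →+* A) (P : Set (Fin d → ℤ)) (w : charMonoid σ) : Prop where
  mem_nonZeroDivisors : φ (monomial k w) ∈ nonZeroDivisors A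
  dvd : ∀ p : charMonoid σ, (p : Fin d → ℤ) ∈ P → φ (monomial k w) ∣ φ (monomial k p)

lemma Generates.comp {k : Type u} [Field k] {d : ℕ} {σ : Cone d} {A B : Type u} [CommRing A]
    [CommRing B] {φ : charAlgebra k σ →+* A} {P : Set (Fin d → ℤ)} {w : charMonoid σ}
    (h : Generates φ P w) (ψ : A →+* B) (hψ : ∀ a ∈ nonZeroDivisors A, ψ a ∈ nonZeroDivisors B) :
    Generates (ψ.comp φ) P w :=
  ⟨hψ _ h.1, fun p hp => map_dvd ψ (h.2 p hp)⟩

lemma map_monomialIdeal {k : Type u} [Field k] {d : ℕ} {σ : Cone d} {A : Type u} [CommRing A]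
    (φ : charAlgebra k σ →+* A) (P : Set (Fin d → ℤ)) :
    (monomialIdeal k σ P).map φ =
      Ideal.span {a | ∃ s : charMonoid σ, (s : Fin d → ℤ) ∈ P ∧ a = φ (monomial k s)} := by
  rw [monomialIdeal, Ideal.map_span]
  congr 1
  ext a
  constructor
  · rintro ⟨_, ⟨s, hs, rfl⟩, rfl⟩
    exact ⟨s, hs, rfl⟩
  · rintro ⟨s, hs, rfl⟩
    exact ⟨_, ⟨s, hs, rfl⟩, rfl⟩

lemma Generates.map_eq {k : Type u} [Field k] {d : ℕ} {σ : Cone d} {A : Type u} [CommRing A]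
    {φ : charAlgebra k σ →+* A} {P : Set (Fin d → ℤ)} {w : charMonoid σ}
    (h : Generates φ P w) (hw : (w : Fin d → ℤ) ∈ P) :
    (monomialIdeal k σ P).map φ = Ideal.span {φ (monomial k w)} := by
  rw [map_monomialIdeal]
  refine le_antisymm (Ideal.span_le.2 ?_) (Ideal.span_le.2 (Set.singleton_subset_iff.2
    (Ideal.subset_span ⟨w, hw, rfl⟩)))
  rintro _ ⟨s, hs, rfl⟩
  exact Ideal.mem_span_singleton.2 (h.2 s hs)

/-- Elements of the Rees monoid map to multiples of powers of a common divisor. -/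
lemma reesMonoid_dvd {k : Type u} [Field k] {d : ℕ} {σ : Cone d} {A : Type u} [CommRing A]
    (φ : charAlgebra k σ →+* A) {W : Set (Fin d → ℤ)} (hW : W ⊆ charMonoid σ) {a : A} {q : Ideal A}
    (h : ∀ w : charMonoid σ, (w : Fin d → ℤ) ∈ W → ∃ c ∈ q, φ (monomial k w) = a * c)
    {s : (Fin d → ℤ) × ℕ} (hs : s ∈ reesMonoid σ W) :
    ∃ (hsσ : s.1 ∈ charMonoid σ) (c : A), φ (monomial k ⟨s.1, hsσ⟩) = a ^ s.2 * c ∧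
      (0 < s.2 → c ∈ q) := by
  refine AddSubmonoid.closure_induction
    (motive := fun s _ => ∃ (hsσ : s.1 ∈ charMonoid σ) (c : A),
      φ (monomial k ⟨s.1, hsσ⟩) = a ^ s.2 * c ∧ (0 < s.2 → c ∈ q)) ?_ ?_ ?_ hs
  · rintro ⟨p, n⟩ (⟨hp, rfl⟩ | ⟨hp, rfl⟩)
    · exact ⟨hp, _, by rw [pow_zero, one_mul], fun h => absurd h (lt_irrefl _)⟩
    · obtain ⟨c, hc, hpc⟩ := h ⟨p, hW hp⟩ hp
      exact ⟨hW hp, c, by rw [pow_one]; exact hpc, fun _ => hc⟩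
  · refine ⟨zero_mem _, 1, ?_, fun h => absurd h (lt_irrefl _)⟩
    change φ (monomial k 0) = a ^ 0 * 1
    rw [monomial_zero, map_one, pow_zero, one_mul]
  · rintro ⟨p₁, n₁⟩ ⟨p₂, n₂⟩ - - ⟨h₁, c₁, e₁, m₁⟩ ⟨h₂, c₂, e₂, m₂⟩
    refine ⟨add_mem h₁ h₂, c₁ * c₂, ?_, fun hn => ?_⟩
    · change φ (monomial k (⟨p₁, h₁⟩ + ⟨p₂, h₂⟩)) = a ^ (n₁ + n₂) * (c₁ * c₂)
      change φ (monomial k ⟨p₁, h₁⟩) = a ^ n₁ * c₁ at e₁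
      change φ (monomial k ⟨p₂, h₂⟩) = a ^ n₂ * c₂ at e₂
      rw [monomial_add, map_mul, e₁, e₂]
      ring
    · rcases Nat.eq_zero_or_pos n₁ with rfl | h
      · exact Ideal.mul_mem_left _ _ (m₂ (by simpa using hn))
      · exact Ideal.mul_mem_right _ _ (m₁ h)

/-- Near every point one of the monomials in `W` generates the ideal. -/
lemma IsLocalBlowup.exists_generates {k : Type u} [Field k] {d : ℕ} {Δ' : Fan d} {σ : Cone d}
    {P W : Set (Fin d → ℤ)} {C : (Fin d → ℤ) → Cone d} (hL : IsLocalBlowup Δ' σ P W C)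
    {A : Type u} [CommRing A] (φ : charAlgebra k σ →+* A) {a : A} (ha : a ∈ nonZeroDivisors A)
    (h : (monomialIdeal k σ P).map φ = Ideal.span {a}) (q : Ideal A) [hq : q.IsPrime] :
    ∃ (w : charMonoid σ) (c : A), (w : Fin d → ℤ) ∈ W ∧ c ∉ q ∧
      Generates ((algebraMap A (Localization.Away c)).comp φ) P w := by
  have hdvd : ∀ p : charMonoid σ, (p : Fin d → ℤ) ∈ P → ∃ c, φ (monomial k p) = a * c := by
    intro p hp
    have := Ideal.mem_map_of_mem φ (monomial_mem_monomialIdeal (k := k) hp)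
    rw [h] at this
    exact Ideal.mem_span_singleton.1 this
  obtain ⟨p, c, hp, hcq, hpc⟩ : ∃ (p : charMonoid σ) (c : A), (p : Fin d → ℤ) ∈ P ∧ c ∉ q ∧
      φ (monomial k p) = a * c := by
    by_contra! H
    -- If all cofactors lay in `q`, then `(a) ⊆ a q`; cancelling the nonzerodivisor `a` would put
    -- `1` into `q`.
    have hle : (monomialIdeal k σ P).map φ ≤ Ideal.span {a} * q := by
      rw [map_monomialIdeal, Ideal.span_le]
      rintro _ ⟨s, hs, rfl⟩
      obtain ⟨c, hc⟩ := hdvd s hs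
      rw [hc]
      exact Ideal.mul_mem_mul (Ideal.mem_span_singleton_self a)
        (by_contra fun hcq => H s c hs hcq hc)
    rw [h] at hle
    obtain ⟨e, he, hae⟩ := Ideal.mem_span_singleton_mul.1 (hle (Ideal.mem_span_singleton_self a))
    have he1 : e = 1 := (mul_cancel_left_mem_nonZeroDivisors ha).1 (hae.trans (mul_one a).symm)
    exact hq.ne_top ((Ideal.eq_top_iff_one q).2 (he1 ▸ he))
  obtain ⟨w, c', hw, hcq', hwc⟩ : ∃ (w : charMonoid σ) (c : A), (w : Fin d → ℤ) ∈ W ∧ c ∉ q ∧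
      φ (monomial k w) = a * c := by
    by_contra! H
    -- If all cofactors of monomials in `W` lay in `q`, then `p^N` being a product from `W` would
    -- put the `N`-th power of its cofactor `c` into `q`.
    obtain ⟨N, hN, hmem⟩ := hL.dominated p hp
    obtain ⟨hsσ, e, he, heq⟩ := reesMonoid_dvd φ (hL.subset.trans hL.subset_charMonoid) (a := a)
      (q := q) (fun w hw => by
        obtain ⟨c, hc⟩ := hdvd w (hL.subset hw)
        exact ⟨c, by_contra fun hcq => H w c hw hcq hc, hc⟩) hmem
    change φ (monomial k (N • p)) = a ^ N * e at he
    rw [monomial_nsmul, map_pow, hpc, mul_pow] at he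
    have := (mul_cancel_left_mem_nonZeroDivisors (pow_mem ha N)).1 he
    exact hcq (hq.mem_of_pow_mem N (this ▸ heq hN))
  refine ⟨w, c', hw, hcq', ?_, fun p' hp' => ?_⟩
  · rw [RingHom.comp_apply, hwc, map_mul]
    exact mul_mem (IsLocalization.map_nonZeroDivisors_le (Submonoid.powers c')
      (Localization.Away c') ⟨a, ha, rfl⟩)
      (IsLocalization.Away.algebraMap_isUnit c').mem_nonZeroDivisors
  · obtain ⟨e, he⟩ := hdvd p' hp'
    rw [RingHom.comp_apply, RingHom.comp_apply, hwc, he, map_mul, map_mul]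
    exact mul_dvd_mul_left _ (IsLocalization.Away.algebraMap_isUnit c').dvd

/-- Two lifts of `φ` to the chart of a generating monomial agree. -/
lemma Generates.lift_unique {k : Type u} [Field k] {d : ℕ} {σ τ : Cone d} (hle : τ ≤ σ)
    {A : Type u} [CommRing A] {φ : charAlgebra k σ →+* A} {P : Set (Fin d → ℤ)} {w : charMonoid σ}
    (h : Generates φ P w) (hτ : ∀ c ∈ charMonoid τ, ∃ N : ℕ, c + N • (w : Fin d → ℤ) ∈ charMonoid σ)
    {ψ ψ' : charAlgebra k τ →+* A} (hψ : ψ.comp (restrictChar k hle) = φ)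
    (hψ' : ψ'.comp (restrictChar k hle) = φ) : ψ = ψ' := by
  have hm : ∀ {χ : charAlgebra k τ →+* A}, χ.comp (restrictChar k hle) = φ → ∀ s : charMonoid σ,
      χ (monomial k ⟨s, charMonoid_anti hle s.2⟩) = φ (monomial k s) := by
    rintro χ rfl s
    rw [RingHom.comp_apply, restrictChar_monomial]
    rfl
  refine ringHom_ext_monomial (fun r => ?_) fun c => ?_
  · rw [← restrictChar_algebraMap k hle]
    exact (RingHom.congr_fun hψ _).trans (RingHom.congr_fun hψ' _).symm
  · obtain ⟨N, hN⟩ := hτ c c.2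
    have key : ∀ {χ : charAlgebra k τ →+* A}, χ.comp (restrictChar k hle) = φ →
        χ (monomial k c) * φ (monomial k w) ^ N = φ (monomial k ⟨_, hN⟩) := by
      intro χ hχ
      rw [← hm hχ, ← hm hχ, ← map_pow, ← map_mul, ← monomial_nsmul, ← monomial_add]
      rfl
    exact (mul_cancel_right_mem_nonZeroDivisors (pow_mem h.1 N)).1 ((key hψ).trans (key hψ').symm)

/-- The lift of `φ` to the chart of a generating monomial. -/
lemma Generates.exists_lift {k : Type u} [Field k] {d : ℕ} {σ τ : Cone d} (hle : τ ≤ σ)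
    {A : Type u} [CommRing A] {φ : charAlgebra k σ →+* A} {P : Set (Fin d → ℤ)} {w : charMonoid σ}
    (h : Generates φ P w) (hτ : ∀ c ∈ charMonoid τ, ∃ (N : ℕ)
      (hN : c + N • (w : Fin d → ℤ) ∈ charMonoid σ),
      φ (monomial k w) ^ N ∣ φ (monomial k ⟨_, hN⟩)) :
    ∃ ψ : charAlgebra k τ →+* A, ψ.comp (restrictChar k hle) = φ := by
  -- The value of `t^c` has to be the quotient of `t^(c + N w)` by `t^(N w)`. It is independent of
  -- `N` because `t^w` maps to a nonzerodivisor.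
  have hτ' : ∀ c : charMonoid τ, ∃ (z : A), ∀ (N : ℕ)
      (hN : (c : Fin d → ℤ) + N • (w : Fin d → ℤ) ∈ charMonoid σ),
      φ (monomial k ⟨_, hN⟩) = φ (monomial k w) ^ N * z := by
    intro c
    obtain ⟨N, hN, z, hz⟩ := hτ c c.2
    refine ⟨z, fun N' hN' => ?_⟩
    refine (mul_cancel_left_mem_nonZeroDivisors (pow_mem h.1 N)).1 ?_
    rw [mul_left_comm, ← hz, ← map_pow, ← map_pow, ← map_mul, ← map_mul, ← monomial_nsmul,
      ← monomial_nsmul, ← monomial_add, ← monomial_add]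
    congr 2
    ext1
    change N • (w : Fin d → ℤ) + (c + N' • (w : Fin d → ℤ)) = N' • (w : Fin d → ℤ) + (c + N • _)
    abel
  choose z hz using hτ'
  have hzσ : ∀ s : charMonoid σ, z ⟨s, charMonoid_anti hle s.2⟩ = φ (monomial k s) := by
    intro s
    have := hz ⟨s, charMonoid_anti hle s.2⟩ 0 (by rw [zero_smul, add_zero]; exact s.2)
    rw [pow_zero, one_mul] at this
    rw [← this]
    congr 2
    ext1
    change (s : Fin d → ℤ) + 0 • _ = s
    rw [zero_smul, add_zero]
  let Z : Multiplicative (charMonoid τ) →* A :=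
    { toFun := fun c => z c.toAdd
      map_one' := by
        refine (hzσ 0).trans ?_
        rw [monomial_zero, map_one]
      map_mul' := fun c c' => by
        obtain ⟨N, hN, -⟩ := hτ c.toAdd c.toAdd.2
        obtain ⟨N', hN', -⟩ := hτ c'.toAdd c'.toAdd.2
        have e : ((c * c').toAdd : Fin d → ℤ) + (N + N') • (w : Fin d → ℤ) =
            (c.toAdd + N • (w : Fin d → ℤ)) + (c'.toAdd + N' • (w : Fin d → ℤ)) := by
          change (c.toAdd : Fin d → ℤ) + c'.toAdd + (N + N') • (w : Fin d → ℤ) = _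
          rw [add_smul]; abel
        have h1 := hz (c * c').toAdd (N + N') (e ▸ add_mem hN hN')
        refine (mul_cancel_left_mem_nonZeroDivisors (pow_mem h.1 (N + N'))).1 (h1.symm.trans ?_)
        have h2 : (⟨_, e ▸ add_mem hN hN'⟩ : charMonoid σ) = ⟨_, hN⟩ + ⟨_, hN'⟩ := Subtype.ext e
        rw [h2, monomial_add, map_mul, hz _ N hN, hz _ N' hN']
        ring }
  let _ : Algebra k A := (φ.comp (algebraMap k (charAlgebra k σ))).toAlgebra
  refine ⟨(AddMonoidAlgebra.lift k A (charMonoid τ) Z).toRingHom, ?_⟩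
  refine ringHom_ext_monomial (fun r => ?_) fun s => ?_
  · rw [RingHom.comp_apply, restrictChar_algebraMap]
    exact (AddMonoidAlgebra.lift k A (charMonoid τ) Z).commutes r
  · rw [RingHom.comp_apply, restrictChar_monomial]
    refine (AddMonoidAlgebra.lift_single _ _ _).trans ?_
    rw [one_smul]
    exact hzσ s

lemma HasReesCharts.exists_dvd {k : Type u} [Field k] {d : ℕ} {σ : Cone d}
    {P W : Set (Fin d → ℤ)} {C : (Fin d → ℤ) → Cone d} (hR : HasReesCharts σ P W C)
    (hP : P ⊆ charMonoid σ) {A : Type u} [CommRing A] {φ : charAlgebra k σ →+* A}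
    {w : charMonoid σ} (h : Generates φ P w) (hw : (w : Fin d → ℤ) ∈ W) :
    ∀ c ∈ charMonoid (C w), ∃ (N : ℕ) (hN : c + N • (w : Fin d → ℤ) ∈ charMonoid σ),
      φ (monomial k w) ^ N ∣ φ (monomial k ⟨_, hN⟩) := by
  intro c hc
  obtain ⟨N, hN⟩ := hR w hw c hc
  obtain ⟨h1, z, hz, -⟩ := reesMonoid_dvd φ hP (q := ⊤) (fun p hp => by
    obtain ⟨e, he⟩ := h.2 p hp
    exact ⟨e, trivial, he⟩) hN
  exact ⟨N, h1, z, hz⟩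

/-- The Rees monoid only provides divisibility between `M`-th powers. The hypothesis `hA`, valid in
integrally closed domains, extracts the root. -/
lemma HasIntegralReesCharts.exists_dvd {k : Type u} [Field k] {d : ℕ} {σ : Cone d}
    {P W : Set (Fin d → ℤ)} {C : (Fin d → ℤ) → Cone d} (hR : HasIntegralReesCharts σ W C)
    (hP : P ⊆ charMonoid σ) (hW : W ⊆ P) {A : Type u} [CommRing A]
    (hA : ∀ (a b : A) (n : ℕ), n ≠ 0 → a ^ n ∣ b ^ n → a ∣ b) {φ : charAlgebra k σ →+* A}
    {w : charMonoid σ} (h : Generates φ P w) (hw : (w : Fin d → ℤ) ∈ W) :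
    ∀ c ∈ charMonoid (C w), ∃ (N : ℕ) (hN : c + N • (w : Fin d → ℤ) ∈ charMonoid σ),
      φ (monomial k w) ^ N ∣ φ (monomial k ⟨_, hN⟩) := by
  intro c hc
  obtain ⟨N, hN, M, hM, hMN⟩ := hR w hw c hc
  obtain ⟨h1, z, hz, -⟩ := reesMonoid_dvd φ (hW.trans hP) (q := ⊤) (fun p hp => by
    obtain ⟨e, he⟩ := h.2 p (hW hp)
    exact ⟨e, trivial, he⟩) hMN
  refine ⟨N, hN, hA _ _ M hM.ne' ⟨z, ?_⟩⟩
  rw [← map_pow, ← monomial_nsmul, ← pow_mul, mul_comm N M]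
  exact hz

/-! ### Charts as morphisms from spectra -/

/-- The chart of a cone as a morphism from a spectrum. -/
noncomputable def Fan.specChart (k : Type u) [Field k] {d : ℕ} (Δ : Fan d) (σ : Δ.cones) :
    Spec (CommRingCat.of (charAlgebra k σ.1)) ⟶ Δ.toricVariety k :=
  Δ.chart k σ

instance (k : Type u) [Field k] {d : ℕ} (Δ : Fan d) (σ : Δ.cones) :
    IsOpenImmersion (Δ.specChart k σ) :=
  inferInstanceAs (IsOpenImmersion (Δ.chart k σ))

lemma IsToricMorphism.specChart_comp {k : Type u} [Field k] {d : ℕ} {Δ' Δ : Fan d}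
    {π : Δ'.toricVariety k ⟶ Δ.toricVariety k} (h : IsToricMorphism π) {σ' : Δ'.cones}
    {σ : Δ.cones} (hle : σ'.1 ≤ σ.1) :
    Δ'.specChart k σ' ≫ π =
      Spec.map (CommRingCat.ofHom (restrictChar k hle)) ≫ Δ.specChart k σ :=
  h.2 σ' σ hle

lemma Fan.exists_point_zeroFace {k : Type u} [Field k] {d : ℕ} (Δ : Fan d) {τ : Δ.cones}
    (u : charMonoid τ.1) (r : PrimeSpectrum (charAlgebra k τ.1)) (hr : monomial k u ∉ r.asIdeal) :
    ∃ r', Δ.point k ⟨zeroFace τ.1 u, Δ.zeroFace_mem τ.2 u.2⟩ r' = Δ.point k τ r := by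
  have hle : zeroFace τ.1 u ≤ τ.1 := zeroFace_le _ _
  have h1 : r ∈ Set.range (PrimeSpectrum.comap (restrictChar k hle)) := by
    rw [range_restrictChar k hle (Δ.rational _ τ.2) u fun x => mem_zeroFace]
    exact hr
  obtain ⟨r', rfl⟩ := h1
  exact ⟨r', (Δ.chart_apply k (τ := ⟨zeroFace τ.1 u, _⟩) hle r').symm⟩

lemma exists_factor {A R : CommRingCat.{u}} {X : Scheme.{u}} (g : Spec A ⟶ X) (c : Spec R ⟶ X)
    [IsOpenImmersion c] (h : Set.range g ⊆ Set.range c) : ∃ ψ : R ⟶ A, g = Spec.map ψ ≫ c :=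
  ⟨Spec.preimage (IsOpenImmersion.lift c g h), by
    rw [Spec.map_preimage, IsOpenImmersion.lift_fac]⟩

/-- The morphism from the spectrum of a localization. -/
noncomputable abbrev specAway {A : CommRingCat.{u}} (s : A) :
    Spec (CommRingCat.of (Localization.Away s)) ⟶ Spec A :=
  Spec.map (CommRingCat.ofHom (algebraMap A (Localization.Away s)))

instance {A : CommRingCat.{u}} (s : A) : IsOpenImmersion (specAway s) :=
  IsOpenImmersion.of_isLocalization s

lemma range_specAway {A : CommRingCat.{u}} (s : A) :
    Set.range (specAway s) = (PrimeSpectrum.basicOpen s : Set (PrimeSpectrum A)) :=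
  PrimeSpectrum.localization_away_comap_range (Localization.Away s) s

lemma algebraMap_away_mem {A : Type u} [CommRing A] (s : A) (a : A) (ha : a ∈ nonZeroDivisors A) :
    algebraMap A (Localization.Away s) a ∈ nonZeroDivisors (Localization.Away s) :=
  IsLocalization.map_nonZeroDivisors_le (Submonoid.powers s) (Localization.Away s) ⟨a, ha, rfl⟩

lemma exists_away_factor {A R : CommRingCat.{u}} {X : Scheme.{u}} (g : Spec A ⟶ X) (c : Spec R ⟶ X)
    [IsOpenImmersion c] (y : PrimeSpectrum A) (hy : g y ∈ Set.range c) :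
    ∃ (s : A) (ψ : R ⟶ CommRingCat.of (Localization.Away s)), s ∉ y.asIdeal ∧
      specAway s ≫ g = Spec.map ψ ≫ c := by
  obtain ⟨_, ⟨_, ⟨s, rfl⟩, rfl⟩, hys, hsV⟩ :=
    PrimeSpectrum.isBasis_basic_opens.exists_subset_of_mem_open
      (show y ∈ g ⁻¹ᵁ c.opensRange from hy) (g ⁻¹ᵁ c.opensRange).2
  obtain ⟨ψ, hψ⟩ := exists_factor (specAway s ≫ g) c (by
    rintro _ ⟨z, rfl⟩
    rw [Scheme.Hom.comp_apply]
    exact hsV (range_specAway s ▸ ⟨z, rfl⟩))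
  exact ⟨s, ψ, hys, hψ⟩

/-! ### The universal property of a local blow-up -/

section

variable {k : Type u} [Field k] {d : ℕ} {Δ' Δ : Fan d}
  {π : Δ'.toricVariety k ⟶ Δ.toricVariety k}

lemma IsToricMorphism.comp_restrictChar (hπ : IsToricMorphism π) {A : CommRingCat.{u}}
    {g : Spec A ⟶ Δ'.toricVariety k} {σ : Δ.cones}
    {φ : CommRingCat.of (charAlgebra k σ.1) ⟶ A} (hg : g ≫ π = Spec.map φ ≫ Δ.specChart k σ)
    {σ' : Δ'.cones} (hle : σ'.1 ≤ σ.1) {ψ : CommRingCat.of (charAlgebra k σ'.1) ⟶ A}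
    (hψ : g = Spec.map ψ ≫ Δ'.specChart k σ') : ψ.hom.comp (restrictChar k hle) = φ.hom := by
  rw [hψ, Category.assoc, hπ.specChart_comp hle, ← Spec.map_comp_assoc, cancel_mono] at hg
  exact congrArg CommRingCat.Hom.hom (Spec.map_injective hg)

/-- The image point lies in the charts of `σ` and of a cone `σ₁` above `τ`, hence in that of a face
of `σ₁` inside `σ`. Cutting `τ` by the functional of this face gives a smaller chart around `x`. -/
lemma IsToricMorphism.exists_point_le (hπ : IsToricMorphism π) {σ : Δ.cones}
    {x : Δ'.toricVariety k} {p : PrimeSpectrum (charAlgebra k σ.1)} (h : π x = Δ.point k σ p) :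
    ∃ (τ : Δ'.cones) (_ : τ.1 ≤ σ.1) (r : PrimeSpectrum (charAlgebra k τ.1)),
      Δ'.point k τ r = x := by
  obtain ⟨τ, r, rfl⟩ := Δ'.exists_point k x
  obtain ⟨σ₁, hle⟩ := hπ.1 τ
  rw [hπ.apply_point hle] at h
  obtain ⟨γ, h1, h2, r', hr1, -⟩ := Δ.exists_of_point_eq k h
  obtain ⟨u, hu⟩ := Δ.exists_localization (τ := γ) (σ := σ₁) h1
  have hr : PrimeSpectrum.comap (restrictChar k hle) r ∈
      Set.range (PrimeSpectrum.comap (restrictChar k h1)) := ⟨r', hr1⟩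
  rw [range_restrictChar k h1 (Δ.rational _ σ₁.2) u hu] at hr
  obtain ⟨r₂, hr₂⟩ := Δ'.exists_point_zeroFace ⟨u, charMonoid_anti hle u.2⟩ r (by
    have h3 := restrictChar_monomial k hle u
    intro hmem
    refine hr ?_
    change restrictChar k hle (monomial k u) ∈ r.asIdeal
    rw [h3]
    exact hmem)
  have hle' : zeroFace τ.1 u ≤ σ.1 := fun x hx => h2 ((hu x).2 ⟨hle hx.1, hx.2⟩)
  exact ⟨_, hle', r₂, hr₂⟩

variable {σ : Δ.cones} {P W : Set (Fin d → ℤ)} {C : (Fin d → ℤ) → Cone d}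

/-- Near a point mapping into the chart of some `u ∈ W`, both `t^u` and `t^w` generate the
pulled-back ideal, so `t^(w - u)` is a unit. The point therefore lies over the face of that cone
orthogonal to `w - u`, which is contained in `C w`. -/
lemma IsLocalBlowup.exists_factor (hL : IsLocalBlowup Δ' σ.1 P W C) (hπ : IsToricMorphism π)
    {A : CommRingCat.{u}} {φ : CommRingCat.of (charAlgebra k σ.1) ⟶ A} {w : charMonoid σ.1}
    (hw : (w : Fin d → ℤ) ∈ W) (hG : Generates φ.hom P w) {g : Spec A ⟶ Δ'.toricVariety k}
    (hg : g ≫ π = Spec.map φ ≫ Δ.specChart k σ) :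
    ∃ ψ : CommRingCat.of (charAlgebra k (C w)) ⟶ A,
      g = Spec.map ψ ≫ Δ'.specChart k ⟨C w, hL.cone_mem w hw⟩ := by
  refine Toric.exists_factor g (Δ'.specChart k ⟨C w, hL.cone_mem w hw⟩) ?_
  rintro _ ⟨y, rfl⟩
  have hy : π (g y) = Δ.point k σ (PrimeSpectrum.comap φ.hom y) :=
    congrArg (fun f : Spec A ⟶ Δ.toricVariety k => f y) hg
  obtain ⟨τ, hτ, r₀, hr₀⟩ := hπ.exists_point_le hy
  obtain ⟨u, hu, hτu⟩ := hL.exists_le τ.1 τ.2 hτ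
  let γ : Δ'.cones := ⟨C u, hL.cone_mem u hu⟩
  obtain ⟨r, hr⟩ : ∃ r, Δ'.point k γ r = g y :=
    ⟨_, (Δ'.chart_apply k (τ := τ) (σ := γ) hτu r₀).trans hr₀⟩
  have hγ : γ.1 ≤ σ.1 := hL.cone_le u hu
  let e : charMonoid γ.1 := ⟨w - u, hL.sub_mem w (hL.subset hw) u hu⟩
  suffices he : monomial k e ∉ r.asIdeal by
    obtain ⟨r₁, hr₁⟩ := Δ'.exists_point_zeroFace e r he
    have hle : zeroFace γ.1 (e : Fin d → ℤ) ≤ C w := fun x hx =>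
      hL.mem_cone u hu w hw x hx.1 hx.2
    exact ⟨_, (Δ'.chart_apply k (σ := ⟨C w, hL.cone_mem w hw⟩) (τ := ⟨zeroFace γ.1 e, _⟩)
      hle r₁).trans (hr₁.trans hr)⟩
  obtain ⟨s, ψ, hs, hψ⟩ := exists_away_factor g (Δ'.specChart k γ) y ⟨r, hr⟩
  have hψφ := hπ.comp_restrictChar (g := specAway s ≫ g)
    (φ := φ ≫ CommRingCat.ofHom (algebraMap A (Localization.Away s)))
    (by rw [Category.assoc, hg, Spec.map_comp, Category.assoc]) hγ hψ
  obtain ⟨z, hz⟩ : y ∈ Set.range (specAway s) := by rw [range_specAway]; exact hs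
  have hrz : r = PrimeSpectrum.comap ψ.hom z := by
    refine Δ'.point_injective k γ (hr.trans ?_)
    rw [← hz]
    exact congrArg (fun f : Spec _ ⟶ Δ'.toricVariety k => f z) hψ
  have hG' := hG.comp (algebraMap A (Localization.Away s)) (algebraMap_away_mem s)
  have hm : ∀ s' : charMonoid σ.1, ψ.hom (monomial k ⟨s', charMonoid_anti hγ s'.2⟩) =
      algebraMap A (Localization.Away s) (φ.hom (monomial k s')) := by
    intro s'
    have h1 := RingHom.congr_fun hψφ (monomial k s')
    rw [RingHom.comp_apply, restrictChar_monomial] at h1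
    exact h1
  have hu' : u ∈ charMonoid σ.1 := hL.subset_charMonoid (hL.subset hu)
  have hmul : ψ.hom (monomial k e) * algebraMap A (Localization.Away s) (φ.hom (monomial k ⟨u, hu'⟩))
      = algebraMap A (Localization.Away s) (φ.hom (monomial k w)) := by
    rw [← hm, ← hm, ← map_mul, ← monomial_add]
    congr 2
    ext1
    exact sub_add_cancel _ _
  obtain ⟨b, hb⟩ := hG'.2 ⟨u, hu'⟩ (hL.subset hu)
  rw [RingHom.comp_apply, RingHom.comp_apply] at hb
  have hunit : IsUnit (ψ.hom (monomial k e)) := by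
    refine IsUnit.of_mul_eq_one b ?_
    refine (mul_cancel_left_mem_nonZeroDivisors hG'.1).1 ?_
    rw [RingHom.comp_apply, mul_one]
    nth_rewrite 2 [← hmul]
    rw [hb]
    ring
  intro hmem
  rw [hrz] at hmem
  exact z.isPrime.ne_top (Ideal.eq_top_of_isUnit_mem _ hmem hunit)

/-- The ideal sheaf `I` is given on the charts by the monomials in `P`. -/
def IsMonomialSheaf (I : (Δ.toricVariety k).IdealSheafData)
    (P : Cone d → Set (Fin d → ℤ)) : Prop :=
  ∀ σ : Δ.cones, I.comap (Δ.specChart k σ) =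
    specIdeal (R := CommRingCat.of (charAlgebra k σ.1)) (monomialIdeal k σ.1 (P σ.1))

variable {I : (Δ.toricVariety k).IdealSheafData} {P W : Cone d → Set (Fin d → ℤ)}
  {C : Cone d → (Fin d → ℤ) → Cone d}

lemma IsMonomialSheaf.isInvertibleIdeal_comap (hI : IsMonomialSheaf I P)
    (hL : ∀ σ ∈ Δ.cones, IsLocalBlowup Δ' σ (P σ) (W σ) (C σ)) (hπ : IsToricMorphism π) :
    IsInvertibleIdeal (I.comap π) := by
  refine IsInvertibleIdeal.of_charts fun x => ?_
  obtain ⟨τ, r, rfl⟩ := Δ'.exists_point k x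
  obtain ⟨σ, hτ⟩ := hπ.1 τ
  have hLσ := hL σ.1 σ.2
  obtain ⟨w, hw, hτw⟩ := hLσ.exists_le τ.1 τ.2 hτ
  let γ : Δ'.cones := ⟨C σ w, hLσ.cone_mem w hw⟩
  have hγ : γ.1 ≤ σ.1 := hLσ.cone_le w hw
  have hwσ : w ∈ charMonoid σ.1 := hLσ.subset_charMonoid (hLσ.subset hw)
  have hG : Generates (restrictChar k hγ) (P σ) ⟨w, hwσ⟩ := by
    refine ⟨?_, fun p hp => ⟨monomial k ⟨p - w, hLσ.sub_mem p hp w hw⟩, ?_⟩⟩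
    · rw [restrictChar_monomial]
      exact mem_nonZeroDivisors_of_ne_zero (monomial_ne_zero k _)
    · rw [restrictChar_monomial, restrictChar_monomial, ← monomial_add]
      congr 1
      ext1
      exact (add_sub_cancel _ _).symm
  refine ⟨_, Δ'.specChart k γ, restrictChar k hγ (monomial k ⟨w, hwσ⟩), inferInstance,
    ⟨_, Δ'.chart_apply k (τ := τ) (σ := γ) hτw r⟩, hG.1, ?_⟩
  rw [← Scheme.IdealSheafData.comap_comp, hπ.specChart_comp hγ, Scheme.IdealSheafData.comap_comp,
    hI σ, comap_specIdeal]
  congr 1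
  exact hG.map_eq (hLσ.subset hw)

/-- Local form of a morphism making `I` invertible. -/
lemma IsMonomialSheaf.exists_generates (hI : IsMonomialSheaf I P)
    (hL : ∀ σ ∈ Δ.cones, IsLocalBlowup Δ' σ (P σ) (W σ) (C σ)) {T : Scheme.{u}}
    {f : T ⟶ Δ.toricVariety k} (hf : IsInvertibleIdeal (I.comap f)) (x : T) :
    ∃ (σ : Δ.cones) (w : charMonoid σ.1) (A : CommRingCat.{u}) (j : Spec A ⟶ T)
      (φ : CommRingCat.of (charAlgebra k σ.1) ⟶ A), (w : Fin d → ℤ) ∈ W σ.1 ∧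
      IsOpenImmersion j ∧ x ∈ Set.range j ∧ Generates φ.hom (P σ) w ∧
      j ≫ f = Spec.map φ ≫ Δ.specChart k σ := by
  obtain ⟨σ, p, hp⟩ := Δ.exists_point k (f x)
  obtain ⟨A, j, a, hj, ⟨y, rfl⟩, hjV, ha, hJ⟩ := hf.exists_chart x
    (f ⁻¹ᵁ (Δ.specChart k σ).opensRange) ⟨p, hp⟩
  obtain ⟨φ, hφ⟩ := Toric.exists_factor (j ≫ f) (Δ.specChart k σ) (by
    rintro _ ⟨z, rfl⟩
    rw [Scheme.Hom.comp_apply]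
    exact hjV ⟨z, rfl⟩)
  have hmap : (monomialIdeal k σ.1 (P σ.1)).map φ.hom = Ideal.span {a} := by
    refine specIdeal_injective ?_
    rw [← hJ, ← Scheme.IdealSheafData.comap_comp, hφ, Scheme.IdealSheafData.comap_comp, hI σ,
      comap_specIdeal]
  have hyp : (show PrimeSpectrum A from y).asIdeal.IsPrime := PrimeSpectrum.isPrime _
  obtain ⟨w, c, hw, hc, hG⟩ := (hL σ.1 σ.2).exists_generates φ.hom ha hmap
    (show PrimeSpectrum A from y).asIdeal
  obtain ⟨z, hz⟩ : y ∈ Set.range (specAway c) := by rw [range_specAway]; exact hc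
  refine ⟨σ, w, _, specAway c ≫ j, φ ≫ CommRingCat.ofHom (algebraMap A (Localization.Away c)), hw,
    inferInstance, ⟨z, ?_⟩, hG, ?_⟩
  · rw [Scheme.Hom.comp_apply, hz]
  · rw [Category.assoc, hφ, Spec.map_comp, Category.assoc]

end

/-! ### Gluing lifts to the blow-up -/

lemma IsInvertibleIdeal.comap {T V : Scheme.{u}} {J : T.IdealSheafData} (h : IsInvertibleIdeal J)
    (j : V ⟶ T) [IsOpenImmersion j] : IsInvertibleIdeal (J.comap j) := by
  refine IsInvertibleIdeal.of_charts fun v => ?_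
  obtain ⟨A, i, a, hi, ⟨y, hy⟩, hr, ha, hJ⟩ := h.exists_chart (j v) j.opensRange ⟨v, rfl⟩
  have hfac := IsOpenImmersion.lift_fac j i hr
  have : IsOpenImmersion (IsOpenImmersion.lift j i hr) := by
    have : IsOpenImmersion (IsOpenImmersion.lift j i hr ≫ j) := by rw [hfac]; exact hi
    exact IsOpenImmersion.of_comp _ j
  refine ⟨A, IsOpenImmersion.lift j i hr, a, this, ⟨y, j.isOpenEmbedding.injective ?_⟩, ha, ?_⟩
  · rw [← Scheme.Hom.comp_apply, hfac, hy]
  · rw [← Scheme.IdealSheafData.comap_comp, hfac, hJ]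

lemma exists_openCover {T : Scheme.{u}} {p : ∀ V : Scheme.{u}, (V ⟶ T) → Prop}
    (h : ∀ x : T, ∃ (V : Scheme.{u}) (j : V ⟶ T), IsOpenImmersion j ∧ x ∈ Set.range j ∧ p V j) :
    ∃ 𝒰 : Scheme.OpenCover.{u} T, ∀ i, p (𝒰.X i) (𝒰.f i) := by
  choose V j hj hx hp using h
  exact ⟨Scheme.Cover.mkOfCovers T V j (fun x => ⟨x, hx x⟩) hj, hp⟩

/-- Lifts of `f` along `π` glue if they exist locally and are unique over open subschemes. -/
lemma existsUnique_lift_of_local {X' X T : Scheme.{u}} {π : X' ⟶ X} {f : T ⟶ X}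
    (hu : ∀ (V : Scheme.{u}) (j : V ⟶ T) [IsOpenImmersion j] (g g' : V ⟶ X'),
      g ≫ π = j ≫ f → g' ≫ π = j ≫ f → g = g')
    (he : ∀ x : T, ∃ (V : Scheme.{u}) (j : V ⟶ T), IsOpenImmersion j ∧ x ∈ Set.range j ∧
      ∃ g : V ⟶ X', g ≫ π = j ≫ f) : ∃! g : T ⟶ X', g ≫ π = f := by
  obtain ⟨𝒰, h𝒰⟩ := exists_openCover (p := fun V j => ∃ g : V ⟶ X', g ≫ π = j ≫ f) he
  choose g hg using h𝒰
  have hcompat : ∀ x y : 𝒰.I₀, pullback.fst (𝒰.f x) (𝒰.f y) ≫ g x =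
      pullback.snd (𝒰.f x) (𝒰.f y) ≫ g y := by
    intro x y
    refine hu _ (pullback.fst (𝒰.f x) (𝒰.f y) ≫ 𝒰.f x) _ _ ?_ ?_
    · rw [Category.assoc, Category.assoc, hg x]
    · rw [pullback.condition, Category.assoc, Category.assoc, hg y]
  refine ⟨𝒰.glueMorphisms g hcompat, ?_, fun g' hg' => ?_⟩
  · refine 𝒰.hom_ext _ _ fun x => ?_
    rw [Scheme.Cover.ι_glueMorphisms_assoc, hg x]
  · refine 𝒰.hom_ext _ _ fun x => ?_
    rw [Scheme.Cover.ι_glueMorphisms]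
    exact hu _ (𝒰.f x) _ _ ((Category.assoc _ _ _).trans (congrArg _ hg')) (hg x)

section

variable {k : Type u} [Field k] {d : ℕ} {Δ' Δ : Fan d}
  {π : Δ'.toricVariety k ⟶ Δ.toricVariety k} {I : (Δ.toricVariety k).IdealSheafData}
  {P W : Cone d → Set (Fin d → ℤ)} {C : Cone d → (Fin d → ℤ) → Cone d}

lemma IsMonomialSheaf.lift_unique (hI : IsMonomialSheaf I P)
    (hL : ∀ σ ∈ Δ.cones, IsLocalBlowup Δ' σ (P σ) (W σ) (C σ)) (hπ : IsToricMorphism π)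
    (hC : ∀ σ ∈ Δ.cones, ∀ w ∈ W σ, ∀ c ∈ charMonoid (C σ w),
      ∃ N : ℕ, c + N • w ∈ charMonoid σ) {T : Scheme.{u}}
    {f : T ⟶ Δ.toricVariety k} (hf : IsInvertibleIdeal (I.comap f))
    {g g' : T ⟶ Δ'.toricVariety k} (hg : g ≫ π = f) (hg' : g' ≫ π = f) : g = g' := by
  obtain ⟨𝒰, h𝒰⟩ := exists_openCover (T := T) (p := fun V j => j ≫ g = j ≫ g') fun x => by
    obtain ⟨σ, w, A, j, φ, hw, hj, hx, hG, hφ⟩ := hI.exists_generates hL hf x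
    refine ⟨_, j, hj, hx, ?_⟩
    have hLσ := hL σ.1 σ.2
    have h1 : (j ≫ g) ≫ π = Spec.map φ ≫ Δ.specChart k σ := by rw [Category.assoc, hg, hφ]
    have h2 : (j ≫ g') ≫ π = Spec.map φ ≫ Δ.specChart k σ := by rw [Category.assoc, hg', hφ]
    obtain ⟨ψ, hψ⟩ := hLσ.exists_factor hπ hw hG h1
    obtain ⟨ψ', hψ'⟩ := hLσ.exists_factor hπ hw hG h2
    have hle : C σ w ≤ σ.1 := hLσ.cone_le _ hw
    have hψψ' : ψ = ψ' := CommRingCat.hom_ext <| hG.lift_unique hle (hC _ σ.2 _ hw)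
      (hπ.comp_restrictChar h1 (σ' := ⟨C σ w, hLσ.cone_mem w hw⟩) hle hψ)
      (hπ.comp_restrictChar h2 (σ' := ⟨C σ w, hLσ.cone_mem w hw⟩) hle hψ')
    rw [hψ, hψ', hψψ']
  exact 𝒰.hom_ext _ _ h𝒰

/-- The hypothesis `hE` is needed only on nonempty affine opens of `T`, so it may use properties of
`T` such as normality. That is the only difference between the two kinds of blow-up. -/
lemma IsMonomialSheaf.existsUnique_lift (hI : IsMonomialSheaf I P)
    (hL : ∀ σ ∈ Δ.cones, IsLocalBlowup Δ' σ (P σ) (W σ) (C σ)) (hπ : IsToricMorphism π)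
    {T : Scheme.{u}} {f : T ⟶ Δ.toricVariety k} (hf : IsInvertibleIdeal (I.comap f))
    (hC : ∀ σ ∈ Δ.cones, ∀ w ∈ W σ, ∀ c ∈ charMonoid (C σ w),
      ∃ N : ℕ, c + N • w ∈ charMonoid σ)
    (hE : ∀ (σ : Δ.cones) (w : charMonoid σ.1) (A : CommRingCat.{u}) (j : Spec A ⟶ T)
      (φ : CommRingCat.of (charAlgebra k σ.1) ⟶ A), IsOpenImmersion j → Nonempty (Spec A) →
      (w : Fin d → ℤ) ∈ W σ → Generates φ.hom (P σ) w → ∀ c ∈ charMonoid (C σ w),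
      ∃ (N : ℕ) (hN : c + N • (w : Fin d → ℤ) ∈ charMonoid σ.1),
        φ.hom (monomial k w) ^ N ∣ φ.hom (monomial k ⟨_, hN⟩)) :
    ∃! g : T ⟶ Δ'.toricVariety k, g ≫ π = f := by
  refine existsUnique_lift_of_local (fun V j _ g g' hg hg' => ?_) fun x => ?_
  · refine hI.lift_unique hL hπ hC (f := j ≫ f) ?_ hg hg'
    rw [Scheme.IdealSheafData.comap_comp]
    exact hf.comap j
  · obtain ⟨σ, w, A, j, φ, hw, hj, hx, hG, hφ⟩ := hI.exists_generates hL hf x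
    have hLσ := hL σ.1 σ.2
    have hle : C σ w ≤ σ.1 := hLσ.cone_le _ hw
    obtain ⟨y, -⟩ := id hx
    obtain ⟨ψ, hψ⟩ := hG.exists_lift hle (hE σ w A j φ hj ⟨y⟩ hw hG)
    refine ⟨_, j, hj, hx, Spec.map (CommRingCat.ofHom ψ) ≫
      Δ'.specChart k ⟨C σ w, hLσ.cone_mem w hw⟩, ?_⟩
    rw [Category.assoc, hπ.specChart_comp hle, ← Spec.map_comp_assoc, hφ]
    congr 2
    exact CommRingCat.hom_ext hψ

/-- A refinement with the charts of the blow-up is the blow-up. -/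
theorem IsMonomialSheaf.isBlowup (hI : IsMonomialSheaf I P)
    (hL : ∀ σ ∈ Δ.cones, IsLocalBlowup Δ' σ (P σ) (W σ) (C σ)) (hπ : IsToricMorphism π)
    (hR : ∀ σ ∈ Δ.cones, HasReesCharts σ (P σ) (W σ) (C σ)) : IsBlowup π I := by
  refine ⟨hI.isInvertibleIdeal_comap hL hπ, fun T f hf => ?_⟩
  have hP := fun σ hσ => (hL σ hσ).subset_charMonoid
  refine hI.existsUnique_lift hL hπ hf (fun σ hσ w hw c hc => ?_)
    fun σ w A j φ _ _ hw hG => (hR σ.1 σ.2).exists_dvd (hP σ.1 σ.2) hG hw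
  obtain ⟨N, hN⟩ := hR σ hσ w hw c hc
  obtain ⟨h, -⟩ := reesMonoid_dvd (k := k) (RingHom.id (charAlgebra k σ)) (hP σ hσ) (a := 1) (q := ⊤)
    (fun p hp => ⟨_, trivial, (one_mul _).symm⟩) hN
  exact ⟨N, h⟩

end

/-- Divisibility is checked at maximal ideals, where `b / a` is integral over an integrally closed
local ring. -/
lemma dvd_of_isIntegrallyClosed_stalk {A : CommRingCat.{u}} [IsDomain A]
    (h : ∀ y : Spec A, IsIntegrallyClosed ((Spec A).presheaf.stalk y)) {a b : A} {n : ℕ}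
    (hn : n ≠ 0) (hab : a ^ n ∣ b ^ n) : a ∣ b := by
  rw [← Ideal.mem_span_singleton]
  refine Ideal.mem_of_localization_maximal fun p hp => ?_
  let y : PrimeSpectrum A := ⟨p, hp.isPrime⟩
  let : Algebra A ((Spec A).presheaf.stalk y) := StructureSheaf.stalkAlgebra A y
  have : IsLocalization.AtPrime ((Spec A).presheaf.stalk y) p :=
    StructureSheaf.IsLocalization.to_stalk A y
  have := h y
  have : IsIntegrallyClosed (Localization.AtPrime p) := IsIntegrallyClosed.of_equiv
    (IsLocalization.algEquiv p.primeCompl ((Spec A).presheaf.stalk y)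
      (Localization.AtPrime p)).toRingEquiv
  rw [Ideal.map_span, Set.image_singleton, Ideal.mem_span_singleton,
    ← IsIntegrallyClosed.pow_dvd_pow_iff hn, ← map_pow, ← map_pow]
  exact map_dvd _ hab

section

variable {k : Type u} [Field k] {d : ℕ} {Δ' Δ : Fan d}
  {π : Δ'.toricVariety k ⟶ Δ.toricVariety k} {I : (Δ.toricVariety k).IdealSheafData}
  {P W : Cone d → Set (Fin d → ℤ)} {C : Cone d → (Fin d → ℤ) → Cone d}

/-- A refinement whose charts are integral over those of the blow-up is the normalized blow-up. -/
theorem IsMonomialSheaf.isNormalizedBlowup (hI : IsMonomialSheaf I P)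
    (hL : ∀ σ ∈ Δ.cones, IsLocalBlowup Δ' σ (P σ) (W σ) (C σ)) (hπ : IsToricMorphism π)
    (σ' : Δ'.cones) (hR : ∀ σ ∈ Δ.cones, HasIntegralReesCharts σ (W σ) (C σ)) :
    IsNormalizedBlowup π I := by
  refine ⟨Δ'.isNormalIntegral_toricVariety k σ', hπ.isDominant σ',
    hI.isInvertibleIdeal_comap hL hπ, fun T f hT _ hf => ?_⟩
  refine hI.existsUnique_lift hL hπ hf (fun σ hσ w hw c hc => ?_)
    fun σ w A j φ hj _ hw hG => ?_
  · obtain ⟨N, hN, -⟩ := hR σ hσ w hw c hc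
    exact ⟨N, hN⟩
  · have := hT.1
    have hA : IsIntegral (Spec A) := isIntegral_of_isOpenImmersion j
    have : IsDomain A := (affine_isIntegral_iff A).1 hA
    refine (hR σ.1 σ.2).exists_dvd (hL σ.1 σ.2).subset_charMonoid (hL σ.1 σ.2).subset
      (fun a b n hn => dvd_of_isIntegrallyClosed_stalk (fun y => ?_) hn) hG hw
    exact IsIntegrallyClosed.of_equiv (asIso (j.stalkMap y)).commRingCatIsoToRingEquiv
      (h := hT.2 (j y))

end

/-! ### Stellar subdivisions along rays as blow-ups -/

section

variable {k : Type u} [Field k] {d : ℕ}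

lemma Fan.exists_divisorEquiv_eq (Δ : Fan d) (D : Δ.torusDivisors k) :
    ∃ (v : Fin d → ℤ) (hv : v ∈ Δ.rays), D = Δ.divisorEquiv k ⟨v, hv⟩ := by
  obtain ⟨⟨v, hv⟩, rfl⟩ := (Δ.divisorEquiv k).surjective D
  exact ⟨v, hv, rfl⟩

lemma Fan.isDivisorOfRay_divisorEquiv (Δ : Fan d) {v w : Fin d → ℤ} (hv : v ∈ Δ.rays) :
    IsDivisorOfRay (Δ.divisorEquiv k ⟨v, hv⟩).1 w ↔ w = v := by
  rw [isDivisorOfRay_iff, coe_divisorEquiv]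
  constructor
  · rintro ⟨hw, h⟩
    exact (Δ.rayPoint_injective k hv hw h).symm
  · rintro rfl
    exact ⟨hv, rfl⟩

lemma Fan.isMonomialSheaf_symbolicPower (Δ : Fan d) {v : Fin d → ℤ} (hv : v ∈ Δ.rays) (n : ℕ) :
    IsMonomialSheaf (symbolicPower (Δ.rayPoint k hv) n) fun σ => divisorMonomials σ v n :=
  Δ.comap_chart_symbolicPower k hv n

/-- The stellar subdivision along a ray is the blow-up of a multiple of the divisor of the ray. -/
theorem Fan.isDivisorBlowup_of_stellar {Δ Δ' : Fan d} {v : Fin d → ℤ} (hv : v ∈ Δ.rays)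
    (h : Δ'.cones = Δ.stellar v) {π : Δ'.toricVariety k ⟶ Δ.toricVariety k}
    (hπ : IsToricMorphism π) : IsDivisorBlowup π (Δ.divisorEquiv k ⟨v, hv⟩) v := by
  have hv' : v ∈ Δ'.rays := (rays_eq_of_stellar hv h).symm ▸ hv
  refine ⟨hπ, (Δ.isDivisorOfRay_divisorEquiv hv).2 rfl, h, ?_, ?_⟩
  · rw [coe_divisorEquiv]
    have hL := fun σ (hσ : σ ∈ Δ.cones) => isLocalBlowup_stellar h hσ one_pos
    rw [one_mul] at hL
    exact (Δ.isMonomialSheaf_symbolicPower hv _).isNormalizedBlowup hL hπ ⟨_, hv'.2⟩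
      fun σ hσ => Δ.hasIntegralReesCharts_stellar hσ one_pos
  · obtain ⟨L, hL⟩ := Filter.eventually_atTop.1 (Δ.hasReesCharts_stellar Δ' h)
    -- The local description requires `l` to be positive.
    refine ⟨max L 1, fun l hl => ?_⟩
    rw [coe_divisorEquiv]
    exact (Δ.isMonomialSheaf_symbolicPower hv _).isBlowup
      (fun σ hσ => isLocalBlowup_stellar h hσ (le_of_max_le_right hl)) hπ
      (hL l (le_of_max_le_left hl))

/-! ### Steps of the procedure and their termination -/

lemma Fan.exists_isToricMorphism_of_stellar (k : Type u) [Field k] {Δ Δ' : Fan d} {v : Fin d → ℤ}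
    (h : Δ'.cones = Δ.stellar v) :
    ∃ π : Δ'.toricVariety k ⟶ Δ.toricVariety k, IsToricMorphism π :=
  exists_isToricMorphism k fun σ' => by
    obtain ⟨σ, hσ, hle⟩ := Δ.exists_le_of_mem_stellar (v := v) (h.subset σ'.2)
    exact ⟨⟨σ, hσ⟩, hle⟩

lemma Fan.finrank_G_lt_of_stellar (k : Type u) [Field k] {Δ Δ' : Fan d} {v : Fin d → ℤ}
    (hv : v ∈ Δ.rays) (hs : ¬ Δ.IsSplit v) (h : Δ'.cones = Δ.stellar v) :
    Module.finrank ℤ (Δ'.G k) < Module.finrank ℤ (Δ.G k) := by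
  have hr := rays_eq_of_stellar hv h
  obtain rfl : Δ' = Δ.stellarFan v := ext_cones h
  refine finrank_G_lt k hr (fun σ' hσ' => Δ.exists_le_of_mem_stellar (v := v) hσ') hv ?_ hs
  exact (stellar_eq_iff _ (hr.symm ▸ hv)).1 (Δ.stellarFan_stellar v)

/-- A step is purely combinatorial: the divisor determines its ray, and subdividing along a
non-split ray automatically gives the required blow-up. -/
lemma Fan.step_iff {Δ Δ' : Fan d} :
    Step k Δ Δ' ↔ ∃ v ∈ Δ.rays, ¬ Δ.IsSplit v ∧ Δ'.cones = Δ.stellar v := by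
  constructor
  · rintro ⟨D, v, π, hD, h⟩
    obtain ⟨w, hw, rfl⟩ := Δ.exists_divisorEquiv_eq D
    obtain rfl := (Δ.isDivisorOfRay_divisorEquiv hw).1 h.divisor_of_ray
    exact ⟨v, hw, (hasInfiniteOrder_iff hw).1 hD, h.stellar⟩
  · rintro ⟨v, hv, hs, h⟩
    obtain ⟨π, hπ⟩ := exists_isToricMorphism_of_stellar k h
    exact ⟨_, v, π, (hasInfiniteOrder_iff hv).2 hs, isDivisorBlowup_of_stellar hv h hπ⟩

lemma Fan.Step.rays_eq {Δ Δ' : Fan d} (h : Step k Δ Δ') : Δ'.rays = Δ.rays := by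
  obtain ⟨v, hv, -, h⟩ := step_iff.1 h
  exact rays_eq_of_stellar hv h

lemma Fan.Step.finrank_lt {Δ Δ' : Fan d} (h : Step k Δ Δ') :
    Module.finrank ℤ (Δ'.G k) < Module.finrank ℤ (Δ.G k) := by
  obtain ⟨v, hv, hs, h⟩ := step_iff.1 h
  exact finrank_G_lt_of_stellar k hv hs h

lemma Fan.exists_not_isSimplicial {Δ : Fan d} {v : Fin d → ℤ} (hv : v ∈ Δ.rays)
    (hs : ¬ Δ.IsSplit v) : ∃ σ ∈ Δ.cones, latticePt v ∈ σ ∧ ¬ PointedCone.IsSimplicial σ := by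
  rw [IsSplit] at hs
  push Not at hs
  obtain ⟨σ, hσ, hvσ, H⟩ := hs
  refine ⟨σ, hσ, hvσ, fun h => ?_⟩
  obtain ⟨u, hu, hu'⟩ := Δ.exists_of_isSimplicial hσ ⟨hv, hvσ⟩ h
  obtain ⟨w, hw, hne, h0⟩ := H u hu
  exact h0 (hu' w hw hne)

/-- The procedure stops exactly at the simplicial fans. -/
lemma Fan.isSimplicial_iff (k : Type u) [Field k] (Δ : Fan d) :
    Δ.IsSimplicial ↔ ¬ ∃ Δ' : Fan d, Step k Δ Δ' := by
  constructor
  · rintro h ⟨Δ', hstep⟩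
    obtain ⟨v, hv, hs, -⟩ := step_iff.1 hstep
    obtain ⟨σ, hσ, -, hns⟩ := exists_not_isSimplicial hv hs
    exact hns (h σ hσ)
  · intro h σ hσ
    refine Δ.isSimplicial_of_exists hσ fun v hv => ?_
    by_contra H
    refine h ⟨Δ.stellarFan v, step_iff.2 ⟨v, hv.1, fun hs => H (hs σ hσ hv.2), rfl⟩⟩

/-- Induction on the rank of `G`, which drops at each step; a non-simplicial fan always admits one.
-/
lemma Fan.exists_simplicial (k : Type u) [Field k] (Δ : Fan d) :
    ∃ (Δ' : Fan d) (π : Δ'.toricVariety k ⟶ Δ.toricVariety k),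
      Relation.ReflTransGen (Step k) Δ Δ' ∧ Δ'.IsSimplicial ∧ IsToricMorphism π ∧
      Δ'.rays = Δ.rays := by
  induction hn : Module.finrank ℤ (Δ.G k) using Nat.strong_induction_on generalizing Δ with
  | _ n ih =>
    by_cases h : Δ.IsSimplicial
    · exact ⟨Δ, 𝟙 _, .refl, h, IsToricMorphism.id k Δ, rfl⟩
    · rw [Δ.isSimplicial_iff k, not_not] at h
      obtain ⟨Δ₁, hstep⟩ := h
      obtain ⟨Δ', π', hs, hsimp, hπ', hr⟩ := ih _ (hn ▸ hstep.finrank_lt) Δ₁ rfl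
      obtain ⟨v, -, -, hst⟩ := step_iff.1 hstep
      obtain ⟨π, hπ⟩ := exists_isToricMorphism_of_stellar k hst
      exact ⟨Δ', π' ≫ π, .head hstep hs, hsimp, hπ'.comp hπ, hr.trans hstep.rays_eq⟩

lemma Fan.length_le_of_steps {n : ℕ} {c : ℕ → Fan d} (h : ∀ i < n, Step k (c i) (c (i + 1))) :
    n + Module.finrank ℤ ((c n).G k) ≤ Module.finrank ℤ ((c 0).G k) ∧ (c n).rays = (c 0).rays := by
  induction n with
  | zero => exact ⟨(zero_add _).le, rfl⟩
  | succ n ih =>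
    obtain ⟨h1, h2⟩ := ih fun i hi => h i (hi.trans (Nat.lt_succ_self n))
    have hstep := h n (Nat.lt_succ_self n)
    have := hstep.finrank_lt
    exact ⟨by omega, hstep.rays_eq.trans h2⟩

end

end Toric

theorem mainTheorem6 {k : Type u} [Field k] {d : ℕ} (Δ : Toric.Fan d) :
    -- blowing up a torus-invariant prime divisor of infinite order in `G`
    (∀ D : Δ.torusDivisors k, Toric.Fan.HasInfiniteOrder D →
      ∃ (v : Fin d → ℤ) (Δ' : Toric.Fan d) (π : Δ'.toricVariety k ⟶ Δ.toricVariety k),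
        Toric.IsDivisorBlowup π D v ∧
        Module.finrank ℤ (Δ'.G k) < Module.finrank ℤ (Δ.G k) ∧
        Set.BijOn π (Δ'.torusDivisors k) (Δ.torusDivisors k) ∧
        Δ'.rays = Δ.rays) ∧
    -- the order in `G`, nonsimplicial cones and stellar subdivisions
    (∀ D : Δ.torusDivisors k, ∃ v : Fin d → ℤ, Toric.Fan.IsDivisorOfRay D.1 v ∧
      (Toric.Fan.HasInfiniteOrder D ↔ Δ.stellar v ≠ Δ.cones) ∧
      (Toric.Fan.HasInfiniteOrder D →
        ∃ σ ∈ Δ.cones, Toric.latticePt v ∈ σ ∧ ¬ PointedCone.IsSimplicial σ)) ∧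
    -- every run of the procedure is short and can only stop at a simplicial toric variety
    (∀ (n : ℕ) (c : ℕ → Toric.Fan d), c 0 = Δ →
      (∀ i < n, Toric.Fan.Step k (c i) (c (i + 1))) →
      n ≤ Module.finrank ℤ (Δ.G k) ∧ (c n).rays = Δ.rays ∧
      ((c n).IsSimplicial ↔ ¬ ∃ Δ'' : Toric.Fan d, Toric.Fan.Step k (c n) Δ'')) ∧
    -- simplicialization
    (∃ (Δ' : Toric.Fan d) (π : Δ'.toricVariety k ⟶ Δ.toricVariety k),
      Relation.ReflTransGen (Toric.Fan.Step k) Δ Δ' ∧ Δ'.IsSimplicial ∧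
      Toric.IsToricMorphism π ∧
      Set.BijOn π (Δ'.torusDivisors k) (Δ.torusDivisors k) ∧ Δ'.rays = Δ.rays) := by
  refine ⟨fun D hD => ?_, fun D => ?_, ?_, ?_⟩
  · obtain ⟨v, hv, rfl⟩ := Δ.exists_divisorEquiv_eq D
    have hs := (Toric.Fan.hasInfiniteOrder_iff hv).1 hD
    have h : (Δ.stellarFan v).cones = Δ.stellar v := rfl
    have hr := Toric.Fan.rays_eq_of_stellar hv h
    obtain ⟨π, hπ⟩ := Toric.Fan.exists_isToricMorphism_of_stellar k h
    exact ⟨v, Δ.stellarFan v, π, Toric.Fan.isDivisorBlowup_of_stellar hv h hπ,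
      Toric.Fan.finrank_G_lt_of_stellar k hv hs h, hπ.bijOn hr, hr⟩
  · obtain ⟨v, hv, rfl⟩ := Δ.exists_divisorEquiv_eq D
    refine ⟨v, (Δ.isDivisorOfRay_divisorEquiv hv).2 rfl, ?_, fun hD =>
      Toric.Fan.exists_not_isSimplicial hv ((Toric.Fan.hasInfiniteOrder_iff hv).1 hD)⟩
    rw [Toric.Fan.hasInfiniteOrder_iff hv, Ne, Δ.stellar_eq_iff hv]
  · rintro n c rfl h
    obtain ⟨h1, h2⟩ := Toric.Fan.length_le_of_steps h
    exact ⟨le_of_add_le_left h1, h2, (c n).isSimplicial_iff k⟩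
  · obtain ⟨Δ', π, h1, h2, h3, h4⟩ := Δ.exists_simplicial k
    exact ⟨Δ', π, h1, h2, h3, h3.bijOn h4, h4⟩
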